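/- **Lemma (Defective Coloring Lemma).** There are a deterministic parallel algorithm and a constant $C$ such that the following holds for every $\varepsilon>0$ and every simple graph $G=(V,E)$ with $n\ge 1$ nodes and $m=|E|$ edges, in which the nodes have the unique identifiers $0,1,\dots,n-1$ and each edge $e\in E$ has a single-word nonnegative integer weight $w(e)$. Given $n$, $\varepsilon$ and the weighted adjacency lists of $G$, the algorithm halts and computes a (not necessarily proper) coloring $c: V\to\{0,1,\dots,C\lceil 1/\varepsilon\rceil-1\}$ with $O(1/\varepsilon)$ colors, such that the total weight of the monochromatic edges satisfies $$\sum_{\{u,v\}\in E,\ c(u)=c(v)} w(\{u,v\})\ \le\ \varepsilon\sum_{e\in E} w(e).$$ It uses $O((m+n)\log\log n)$ work, with a constant that does not depend on $\varepsilon$, and $\operatorname{poly}((\log n)/\varepsilon)$ depth. Precisely, the work is at most $C\,(m+n)\,(\lfloor\log_2\lfloor\log_2 n\rfloor\rfloor+1)$ and the depth is at most $C\,\big((\lfloor\log_2 n\rfloor+1)\lceil 1/\varepsilon\rceil\big)^{C}$ (where $\lfloor\log_2 0\rfloor$ is read as $0$). *Model.* The algorithm is one fixed program, for all inputs and all word lengths,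 in the work-depth model: a machine with words of $W$ bits and a shared memory, whose programs consist of assignments, conditionals, while-loops and (nested) parallel loops, with word arithmetic $+,-,\times$, integer division, remainder and comparisons at unit cost. Work is the total number of computational steps. Depth is the length of a longest chain of steps each depending on the previous ones: it adds up over sequential steps, and it is the maximum over parallel branches. If several parallel branches write to the same memory cell, an arbitrary one of the writes takes place, and the guarantees hold for every outcome of these choices; no branch reads a cell that a concurrent branch writes to. Words have at least $C\log_2(n+1)$ bits. The input consists of $n$, of $\varepsilon$ as a quotient of two single-word integers, and of the adjacency lists (with arbitrary order inside each list), stored consecutively together with the starting position of each list and, for each list entry, the weight of the edge; the rest of the memory is initially arbitrary. -/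

import Mathlib

/-!
# A work-depth model of parallel computation and vertex colorings with few monochromatic edges

The machine is a word machine with a shared memory. Its programs are built from assignments,
conditionals, `while` loops and a (possibly nested) parallel loop. All parallel branches read and
write the shared memory; if several branches write to the same cell, an arbitrary one of these
writes takes place. Work is the total number of steps, depth is the length of a longest chain of
steps that depend on each other.
-/

namespace WorkDepth

/-- A cell of the shared memory, which consists of arrays named by natural numbers: `(a, i)` is
position `i` of array `a`. A program can name only the finitely many arrays that occur in its
text, so this is a shared memory that is divided into a constant number of segments. -/
abbrev Cell : Type := ℕ × ℕ

/-- The contents of the shared memory, and of the registers of the branch under consideration. -/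
structure State where
  mem : Cell → ℕ
  reg : ℕ → ℕ

/-- The arithmetic operations and tests of the machine. -/
inductive Op
  | add | sub | mul | div | mod | lt | eq

/-- Arithmetic on words of `W` bits. Addition and multiplication wrap around, subtraction is
truncated at `0`, and tests return `1` (true) or `0` (false). -/
def Op.eval (W : ℕ) : Op → ℕ → ℕ → ℕ
  | .add, x, y => (x + y) % 2 ^ W
  | .sub, x, y => x - y
  | .mul, x, y => (x * y) % 2 ^ W
  | .div, x, y => x / y
  | .mod, x, y => x % y
  | .lt, x, y => (if x < y then 1 else 0) % 2 ^ W
  | .eq, x, y => (if x = y then 1 else 0) % 2 ^ W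

/-- Expressions: constants, registers, `get a e` (the content of position `e` of array `a`), and
operations. -/
inductive Expr
  | const (c : ℕ)
  | reg (r : ℕ)
  | get (a : ℕ) (e : Expr)
  | op (o : Op) (e₁ e₂ : Expr)

namespace Expr

/-- The value of an expression on a machine with words of `W` bits. -/
def eval (W : ℕ) (s : State) : Expr → ℕ
  | const c => c % 2 ^ W
  | reg r => s.reg r
  | get a e => s.mem (a, e.eval W s)
  | op o e₁ e₂ => o.eval W (e₁.eval W s) (e₂.eval W s)

/-- The number of steps needed to evaluate an expression. -/
def cost : Expr → ℕ
  | const _ => 1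
  | reg _ => 1
  | get _ e => e.cost + 1
  | op _ e₁ e₂ => e₁.cost + e₂.cost + 1

/-- The cells of the shared memory that are read in the evaluation of an expression. -/
def reads (W : ℕ) (s : State) : Expr → Set Cell
  | const _ => ∅
  | reg _ => ∅
  | get a e => insert (a, e.eval W s) (e.reads W s)
  | op _ e₁ e₂ => e₁.reads W s ∪ e₂.reads W s

end Expr

/-- Programs.
* `set r e`: assign the value of `e` to register `r`;
* `store a i e`: write the value of `e` into position `i` of array `a`;
* `par r e body`: evaluate `e` to a number `k` and run `k` copies of `body` in parallel. The copy
  number `i < k` starts with a private copy of the registers in which register `r` holds `i`; the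
  private registers disappear at the end of `body`. -/
inductive Cmd
  | skip
  | set (r : ℕ) (e : Expr)
  | store (a : ℕ) (i e : Expr)
  | seq (c₁ c₂ : Cmd)
  | ite (e : Expr) (c₁ c₂ : Cmd)
  | while (e : Expr) (body : Cmd)
  | par (r : ℕ) (e : Expr) (body : Cmd)

/-- What a completed run of a program results in: the final state, the work, the depth, and the
shared cells that have been read and written. -/
structure Outcome where
  state : State
  work : ℕ
  depth : ℕ
  reads : Set Cell
  writes : Set Cell

/-- A sequential piece of `t` steps, which contributes `t` to the work and to the depth. -/
def Outcome.steps (s : State) (t : ℕ) (rd wr : Set Cell) : Outcome := ⟨s, t, t, rd, wr⟩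

/-- Sequential composition: work and depth add up. -/
def Outcome.andThen (o o' : Outcome) : Outcome where
  state := o'.state
  work := o.work + o'.work
  depth := o.depth + o'.depth
  reads := o.reads ∪ o'.reads
  writes := o.writes ∪ o'.writes

/-- The state in which branch `i` of a parallel loop with index register `r` starts. -/
def State.branch (s : State) (r i : ℕ) : State := ⟨s.mem, Function.update s.reg r i⟩

/-- `mem'` is a possible memory after `k` parallel branches with outcomes `o 0, …, o (k - 1)`,
started on memory `mem`: a cell that nobody has written to is unchanged, and in any other cell the
write of an arbitrary one of the branches that have written to it survives. -/
def Merges (k : ℕ) (mem : Cell → ℕ) (o : ℕ → Outcome) (mem' : Cell → ℕ) : Prop :=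
  ∀ c : Cell,
    ((∀ i < k, c ∉ (o i).writes) → mem' c = mem c) ∧
    ((∃ i < k, c ∈ (o i).writes) → ∃ i < k, c ∈ (o i).writes ∧ mem' c = (o i).state.mem c)

/-- No branch reads a cell that another branch, running at the same time, writes to. (Concurrent
reads of a cell and concurrent writes to a cell are both allowed.) Hence the order in which the
steps of different branches are interleaved matters only for which of several concurrent writes
survives. -/
def RaceFree (k : ℕ) (o : ℕ → Outcome) : Prop :=
  ∀ i < k, ∀ j < k, i ≠ j → Disjoint (o i).reads (o j).writes

/-- The parallel composition of the branches `o 0, …, o (k - 1)`, with resulting memory `mem'`.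
The work is the sum over the branches (plus one step for starting each of them) and the depth is the
maximum over the branches. -/
def Outcome.join (s : State) (k : ℕ) (o : ℕ → Outcome) (mem' : Cell → ℕ) : Outcome where
  state := ⟨mem', s.reg⟩
  work := ∑ i ∈ Finset.range k, ((o i).work + 1)
  depth := (Finset.range k).sup fun i => (o i).depth
  reads := {c | ∃ i < k, c ∈ (o i).reads}
  writes := {c | ∃ i < k, c ∈ (o i).writes}

/-- `Exec W p s o`: on a machine with words of `W` bits, a run of `p` from state `s` can end with
outcome `o`. -/
inductive Exec (W : ℕ) : Cmd → State → Outcome → Prop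
  | skip (s : State) : Exec W .skip s (.steps s 1 ∅ ∅)
  | set (s : State) (r : ℕ) (e : Expr) :
      Exec W (.set r e) s
        (.steps ⟨s.mem, Function.update s.reg r (e.eval W s)⟩ (e.cost + 1) (e.reads W s) ∅)
  | store (s : State) (a : ℕ) (i e : Expr) :
      Exec W (.store a i e) s
        (.steps ⟨Function.update s.mem (a, i.eval W s) (e.eval W s), s.reg⟩
          (i.cost + e.cost + 1) (i.reads W s ∪ e.reads W s) {(a, i.eval W s)})
  | seq {s : State} {c₁ c₂ : Cmd} {o₁ o₂ : Outcome} :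
      Exec W c₁ s o₁ → Exec W c₂ o₁.state o₂ → Exec W (.seq c₁ c₂) s (o₁.andThen o₂)
  | ite_true {s : State} {e : Expr} {c₁ c₂ : Cmd} {o : Outcome} :
      e.eval W s ≠ 0 → Exec W c₁ s o →
      Exec W (.ite e c₁ c₂) s ((Outcome.steps s (e.cost + 1) (e.reads W s) ∅).andThen o)
  | ite_false {s : State} {e : Expr} {c₁ c₂ : Cmd} {o : Outcome} :
      e.eval W s = 0 → Exec W c₂ s o →
      Exec W (.ite e c₁ c₂) s ((Outcome.steps s (e.cost + 1) (e.reads W s) ∅).andThen o)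
  | while_true {s : State} {e : Expr} {body : Cmd} {o o' : Outcome} :
      e.eval W s ≠ 0 → Exec W body s o → Exec W (.while e body) o.state o' →
      Exec W (.while e body) s
        ((Outcome.steps s (e.cost + 1) (e.reads W s) ∅).andThen (o.andThen o'))
  | while_false {s : State} {e : Expr} {body : Cmd} :
      e.eval W s = 0 →
      Exec W (.while e body) s (.steps s (e.cost + 1) (e.reads W s) ∅)
  | par {s : State} {r : ℕ} {e : Expr} {body : Cmd} {o : ℕ → Outcome} {mem' : Cell → ℕ} :
      (∀ i < e.eval W s, Exec W body (s.branch r i) (o i)) →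
      Merges (e.eval W s) s.mem o mem' →
      Exec W (.par r e body) s
        ((Outcome.steps s (e.cost + 1) (e.reads W s) ∅).andThen
          (.join s (e.eval W s) o mem'))

/-- `Halts W p s`: every run of `p` from state `s` terminates and is free of races, whichever of the
concurrent writes survive. -/
inductive Halts (W : ℕ) : Cmd → State → Prop
  | skip (s : State) : Halts W .skip s
  | set (s : State) (r : ℕ) (e : Expr) : Halts W (.set r e) s
  | store (s : State) (a : ℕ) (i e : Expr) : Halts W (.store a i e) s
  | seq {s : State} {c₁ c₂ : Cmd} :
      Halts W c₁ s → (∀ o, Exec W c₁ s o → Halts W c₂ o.state) → Halts W (.seq c₁ c₂) s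
  | ite_true {s : State} {e : Expr} {c₁ c₂ : Cmd} :
      e.eval W s ≠ 0 → Halts W c₁ s → Halts W (.ite e c₁ c₂) s
  | ite_false {s : State} {e : Expr} {c₁ c₂ : Cmd} :
      e.eval W s = 0 → Halts W c₂ s → Halts W (.ite e c₁ c₂) s
  | while_true {s : State} {e : Expr} {body : Cmd} :
      e.eval W s ≠ 0 → Halts W body s →
      (∀ o, Exec W body s o → Halts W (.while e body) o.state) → Halts W (.while e body) s
  | while_false {s : State} {e : Expr} {body : Cmd} :
      e.eval W s = 0 → Halts W (.while e body) s
  | par {s : State} {r : ℕ} {e : Expr} {body : Cmd} :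
      (∀ i < e.eval W s, Halts W body (s.branch r i)) →
      (∀ o : ℕ → Outcome, (∀ i < e.eval W s, Exec W body (s.branch r i) (o i)) →
        RaceFree (e.eval W s) o) →
      Halts W (.par r e body) s

end WorkDepth

open WorkDepth

/-- The position at which the list of vertex `v` starts when the lists `adj 0, adj 1, …` are written
one after the other; for `v = n` this is the total length. -/
def adjStart {n : ℕ} (adj : Fin n → List (Fin n)) (v : ℕ) : ℕ :=
  ∑ u : Fin n with u.val < v, (adj u).length

/-- The input format: in state `s` of a machine with words of `W` bits, the memory holds the graph
`G` on the vertices with identifiers `0, …, n - 1` as adjacency lists `adj` (each in an arbitrary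
order), the edge weights `w`, and the parameter `ε`, as follows. Array `0` holds `n`, and a
numerator and a denominator of `ε`; array `1` holds the starting positions of the adjacency lists;
array `2` holds the concatenated adjacency lists; array `3` holds, at the position of each entry of
an adjacency list, the weight of the corresponding edge. Everything else is arbitrary. In
particular, each weight is a nonnegative integer that fits into a single word. -/
structure IsInput (W : ℕ) {n : ℕ} (G : SimpleGraph (Fin n)) (w : Sym2 (Fin n) → ℕ) (ε : ℝ)
    (adj : Fin n → List (Fin n)) (s : State) : Prop where
  mem_word : ∀ c, s.mem c < 2 ^ W
  reg_word : ∀ r, s.reg r < 2 ^ W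
  nodup : ∀ v, (adj v).Nodup
  adj_iff : ∀ v u, u ∈ adj v ↔ G.Adj v u
  size : s.mem (0, 0) = n
  den_pos : 0 < s.mem (0, 2)
  eps : ε = (s.mem (0, 1) : ℝ) / (s.mem (0, 2) : ℝ)
  start : ∀ v ≤ n, s.mem (1, v) = adjStart adj v
  neighbor : ∀ (v : Fin n) (j : ℕ) (hj : j < (adj v).length),
    s.mem (2, adjStart adj v + j) = ((adj v)[j] : ℕ)
  weight : ∀ (v : Fin n) (j : ℕ) (hj : j < (adj v).length),
    s.mem (3, adjStart adj v + j) = w s(v, (adj v)[j])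

/-- The coloring that a computation leaves behind: array `4` holds the colors of the vertices. -/
def outputColor {n : ℕ} (s : State) (v : Fin n) : ℕ := s.mem (4, v)

open Classical in
/-- The total weight of the monochromatic edges of `G` under the coloring `col`. -/
noncomputable def monoWeight {n : ℕ} (G : SimpleGraph (Fin n)) (w : Sym2 (Fin n) → ℕ)
    (col : Fin n → ℕ) : ℕ :=
  ∑ e ∈ G.edgeFinset with (e.map col).IsDiag, w e

open Classical in
/-- The total weight of all edges of `G`. -/
noncomputable def totalWeight {n : ℕ} (G : SimpleGraph (Fin n)) (w : Sym2 (Fin n) → ℕ) : ℕ :=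
  ∑ e ∈ G.edgeFinset, w e

/-! Write T for ⌈1/ε⌉. If n ≤ T, the identifiers themselves serve as colors. Otherwise the coloring
is found in two stages, each of which may make at most the fraction 1/(2T) of the total weight
monochromatic; `mul_monoWeight_le` adds up the two losses.

Stage 1 partitions the vertices into few classes, in the spirit of Linial's color reduction but with
defects. At first every vertex is its own class. A class number below S² is read as a linear
function with slope and intercept below S. Two different such functions agree in at most one point
(`meet_eq`), so each vertex finds a point x < K such that at most the fraction 1/K of its incident
weight leads to neighbors whose functions meet its own at x. The pair of x and the function value
becomes the new class. An edge becomes monochromatic only if its meeting point was chosen, so a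
round loses at most the fraction 1/K (`refine_dmono`). A round turns a bound 2K⁴·2^u on the class
numbers into 2K⁴·2^⌊u/2⌋, so O(log log n) rounds reach 2K⁴ classes (`rounds_tr`). The choice K =
2(⌊log₂ n⌋ + 1)T keeps the total loss below 1/(2T).

Stage 2 colors the classes one after the other, and the vertices of one class in parallel. Each
vertex takes, among 4T colors, one that carries the least weight towards lower classes
(`greedy_tr`). An edge between different classes is charged to its endpoint in the higher class, so
the loss is 1/(4T) of the sum of the weighted degrees, which is 1/(2T) of the total weight. The
depth is polynomial because the number of classes is.

The work bound rests on two facts. Choosing a light bucket costs O(deg + 1) work however large K is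
(`pick_tr`): with deg + 1 buckets one is empty, so more are never needed. And the members of a class
are found without scanning all vertices: the vertices are cut into blocks of as many vertices as
there are classes, each block with one linked list per class (`buildLists_tr`), so that visiting all
blocks once per class costs O(n) altogether. Hence only the rounds of stage 1 contribute the factor
log log n.

Runs are analyzed with the triples `Tr`. Concurrent branches always get disjoint write sets
(`Tr.par`), so the arbitrary resolution of concurrent writes never has any effect. -/

namespace WorkDepth

/-! ## Notation for programs -/

instance : Add Expr := ⟨.op .add⟩
instance : Sub Expr := ⟨.op .sub⟩
instance : Mul Expr := ⟨.op .mul⟩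
instance : Div Expr := ⟨.op .div⟩
instance : Mod Expr := ⟨.op .mod⟩

/-- The test `e₁ < e₂`. -/
def Expr.less (e₁ e₂ : Expr) : Expr := .op .lt e₁ e₂

/-- The test `e₁ = e₂`. -/
def Expr.same (e₁ e₂ : Expr) : Expr := .op .eq e₁ e₂

/-- The constant `c`. -/
def Expr.cst (c : ℕ) : Expr := .const c

/-- The content of register `r`. -/
def Expr.rg (r : ℕ) : Expr := .reg r

/-- The content of position `e` of array `a`. -/
def Expr.arr (a : ℕ) (e : Expr) : Expr := .get a e

infixr:60 " ;; " => Cmd.seq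

namespace Expr

variable (W : ℕ) (s : State) (e e₁ e₂ : Expr)

@[simp] lemma eval_add : (e₁ + e₂).eval W s = (e₁.eval W s + e₂.eval W s) % 2 ^ W := rfl
@[simp] lemma eval_sub : (e₁ - e₂).eval W s = e₁.eval W s - e₂.eval W s := rfl
@[simp] lemma eval_mul : (e₁ * e₂).eval W s = (e₁.eval W s * e₂.eval W s) % 2 ^ W := rfl
@[simp] lemma eval_div : (e₁ / e₂).eval W s = e₁.eval W s / e₂.eval W s := rfl
@[simp] lemma eval_mod : (e₁ % e₂).eval W s = e₁.eval W s % e₂.eval W s := rfl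
@[simp] lemma eval_less :
    (e₁.less e₂).eval W s = (if e₁.eval W s < e₂.eval W s then 1 else 0) % 2 ^ W := rfl
@[simp] lemma eval_same :
    (e₁.same e₂).eval W s = (if e₁.eval W s = e₂.eval W s then 1 else 0) % 2 ^ W := rfl
@[simp] lemma eval_rg (r : ℕ) : (rg r).eval W s = s.reg r := rfl
@[simp] lemma eval_arr (a : ℕ) : (arr a e).eval W s = s.mem (a, e.eval W s) := rfl
@[simp] lemma eval_cst (c : ℕ) : (cst c).eval W s = c % 2 ^ W := rfl

@[simp] lemma cost_add : (e₁ + e₂).cost = e₁.cost + e₂.cost + 1 := rfl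
@[simp] lemma cost_sub : (e₁ - e₂).cost = e₁.cost + e₂.cost + 1 := rfl
@[simp] lemma cost_mul : (e₁ * e₂).cost = e₁.cost + e₂.cost + 1 := rfl
@[simp] lemma cost_div : (e₁ / e₂).cost = e₁.cost + e₂.cost + 1 := rfl
@[simp] lemma cost_less : (e₁.less e₂).cost = e₁.cost + e₂.cost + 1 := rfl
@[simp] lemma cost_rg (r : ℕ) : (rg r).cost = 1 := rfl
@[simp] lemma cost_cst (c : ℕ) : (cst c).cost = 1 := rfl

@[simp] lemma reads_add : (e₁ + e₂).reads W s = e₁.reads W s ∪ e₂.reads W s := rfl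
@[simp] lemma reads_sub : (e₁ - e₂).reads W s = e₁.reads W s ∪ e₂.reads W s := rfl
@[simp] lemma reads_mul : (e₁ * e₂).reads W s = e₁.reads W s ∪ e₂.reads W s := rfl
@[simp] lemma reads_div : (e₁ / e₂).reads W s = e₁.reads W s ∪ e₂.reads W s := rfl
@[simp] lemma reads_mod : (e₁ % e₂).reads W s = e₁.reads W s ∪ e₂.reads W s := rfl
@[simp] lemma reads_less : (e₁.less e₂).reads W s = e₁.reads W s ∪ e₂.reads W s := rfl
@[simp] lemma reads_same : (e₁.same e₂).reads W s = e₁.reads W s ∪ e₂.reads W s := rfl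
@[simp] lemma reads_rg (r : ℕ) : (rg r).reads W s = ∅ := rfl
@[simp] lemma reads_arr (a : ℕ) :
    (arr a e).reads W s = insert (a, e.eval W s) (e.reads W s) := rfl
@[simp] lemma reads_cst (c : ℕ) : (cst c).reads W s = ∅ := rfl

end Expr

/-! ## Programs without loops -/

namespace Cmd

/-- Programs without loops. -/
def simple : Cmd → Bool
  | seq c₁ c₂ => c₁.simple && c₂.simple
  | ite _ c₁ c₂ => c₁.simple && c₂.simple
  | .while _ _ => false
  | par _ _ _ => false
  | _ => true

/-- The effect of a program without loops. -/
def run (W : ℕ) : Cmd → State → State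
  | set r e, s => ⟨s.mem, Function.update s.reg r (e.eval W s)⟩
  | store a i e, s => ⟨Function.update s.mem (a, i.eval W s) (e.eval W s), s.reg⟩
  | seq c₁ c₂, s => c₂.run W (c₁.run W s)
  | ite e c₁ c₂, s => if e.eval W s ≠ 0 then c₁.run W s else c₂.run W s
  | _, s => s

/-- An upper bound on the number of steps of a program without loops. -/
def cost : Cmd → ℕ
  | skip => 1
  | set _ e => e.cost + 1
  | store _ i e => i.cost + e.cost + 1
  | seq c₁ c₂ => c₁.cost + c₂.cost
  | ite e c₁ c₂ => e.cost + 1 + (c₁.cost + c₂.cost)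
  | _ => 0

/-- The cells read by a program without loops. -/
def rd (W : ℕ) : Cmd → State → Set Cell
  | set _ e, s => e.reads W s
  | store _ i e, s => i.reads W s ∪ e.reads W s
  | seq c₁ c₂, s => c₁.rd W s ∪ c₂.rd W (c₁.run W s)
  | ite e c₁ c₂, s => e.reads W s ∪ if e.eval W s ≠ 0 then c₁.rd W s else c₂.rd W s
  | _, _ => ∅

/-- The cells written by a program without loops. -/
def wr (W : ℕ) : Cmd → State → Set Cell
  | store a i _, s => {(a, i.eval W s)}
  | seq c₁ c₂, s => c₁.wr W s ∪ c₂.wr W (c₁.run W s)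
  | ite e c₁ c₂, s => if e.eval W s ≠ 0 then c₁.wr W s else c₂.wr W s
  | _, _ => ∅

/-- The program does not assign to register `r`. -/
def keeps (r : ℕ) : Cmd → Bool
  | set r' _ => r != r'
  | seq c₁ c₂ => c₁.keeps r && c₂.keeps r
  | ite _ c₁ c₂ => c₁.keeps r && c₂.keeps r
  | .while _ c => c.keeps r
  | _ => true

end Cmd

/-! ### Cells and registers that an execution leaves alone. -/

lemma Exec.mem_eq {W : ℕ} {c : Cmd} {s : State} {o : Outcome} (h : Exec W c s o) :
    ∀ x, x ∉ o.writes → o.state.mem x = s.mem x := by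
  induction h with
  | skip s => intro x _; rfl
  | set s r e => intro x _; rfl
  | store s a i e =>
    intro x hx
    simp only [Outcome.steps, Set.mem_singleton_iff] at hx ⊢
    exact Function.update_of_ne hx _ _
  | seq _ _ h1 h2 =>
    intro x hx
    simp only [Outcome.andThen, Set.mem_union, not_or] at hx ⊢
    rw [h2 x hx.2, h1 x hx.1]
  | ite_true _ _ h1 =>
    intro x hx
    simp only [Outcome.andThen, Set.mem_union, not_or] at hx ⊢
    exact h1 x hx.2
  | ite_false _ _ h1 =>
    intro x hx
    simp only [Outcome.andThen, Set.mem_union, not_or] at hx ⊢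
    exact h1 x hx.2
  | while_true _ _ _ h1 h2 =>
    intro x hx
    simp only [Outcome.andThen, Set.mem_union, not_or] at hx ⊢
    rw [h2 x hx.2.2, h1 x hx.2.1]
  | while_false _ => intro x _; rfl
  | par _ hm _ =>
    intro x hx
    simp only [Outcome.andThen, Outcome.join, Set.mem_union, not_or, Set.mem_ofPred_eq,
      not_exists, not_and] at hx ⊢
    exact (hm x).1 hx.2

/-- A parallel loop preserves all registers, even those its body assigns, because every branch works
on a private copy. This is why the catch-all clause of `Cmd.keeps` may cover it. -/
lemma Exec.reg_eq {W : ℕ} {c : Cmd} {s : State} {o : Outcome} (h : Exec W c s o) :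
    ∀ r, c.keeps r = true → o.state.reg r = s.reg r := by
  induction h with
  | skip s => intro x _; rfl
  | set s r e =>
    intro x hx
    simp only [Cmd.keeps, bne_iff_ne] at hx
    exact Function.update_of_ne hx _ _
  | store s a i e => intro x hx; rfl
  | seq _ _ h1 h2 =>
    intro x hx
    simp only [Cmd.keeps, Bool.and_eq_true] at hx
    exact (h2 x hx.2).trans (h1 x hx.1)
  | ite_true _ _ h1 =>
    intro x hx
    simp only [Cmd.keeps, Bool.and_eq_true] at hx
    exact h1 x hx.1
  | ite_false _ _ h1 =>
    intro x hx
    simp only [Cmd.keeps, Bool.and_eq_true] at hx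
    exact h1 x hx.2
  | while_true _ _ _ h1 h2 =>
    intro x hx
    exact (h2 x hx).trans (h1 x hx)
  | while_false _ => intro x _; rfl
  | par _ hm _ => intro x hx; rfl

/-! ## A program logic -/

/-- Every run of `c` from `s` halts without races, takes at most `t` steps and depth `d`, reads only
cells in `R`, writes only cells in `X`, and ends in a state satisfying `Q`. -/
def Tr (W : ℕ) (c : Cmd) (s : State) (t d : ℕ) (R X : Set Cell) (Q : State → Prop) : Prop :=
  Halts W c s ∧ ∀ o, Exec W c s o →
    o.work ≤ t ∧ o.depth ≤ d ∧ o.reads ⊆ R ∧ o.writes ⊆ X ∧ Q o.state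

/-- What a program that writes only to cells in `X` leaves unchanged. -/
def Frame (c : Cmd) (X : Set Cell) (s s' : State) : Prop :=
  (∀ x, x ∉ X → s'.mem x = s.mem x) ∧ ∀ r, c.keeps r = true → s'.reg r = s.reg r

namespace Tr

variable {W : ℕ} {c c₁ c₂ body : Cmd} {s : State} {t d t₁ d₁ t₂ d₂ : ℕ} {R X R₁ X₁ : Set Cell}
  {Q Q₁ : State → Prop} {e : Expr} {r : ℕ}

/-- The write set and the program text already determine what is untouched, so postconditions only
have to mention what changes; the sequencing rules supply the frame automatically. -/
lemma frame (h : Tr W c s t d R X Q) : Tr W c s t d R X (fun s' => Q s' ∧ Frame c X s s') := by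
  refine ⟨h.1, fun o ho => ?_⟩
  obtain ⟨h1, h2, h3, h4, h5⟩ := h.2 o ho
  exact ⟨h1, h2, h3, h4, h5, fun x hx => ho.mem_eq x fun hx' => hx (h4 hx'), ho.reg_eq⟩

lemma mono (h : Tr W c s t₁ d₁ R₁ X₁ Q₁) (ht : t₁ ≤ t) (hd : d₁ ≤ d) (hR : R₁ ⊆ R) (hX : X₁ ⊆ X)
    (hQ : ∀ s', Q₁ s' → Frame c X₁ s s' → Q s') : Tr W c s t d R X Q := by
  refine ⟨h.1, fun o ho => ?_⟩
  obtain ⟨h1, h2, h3, h4, h5, h6⟩ := h.frame.2 o ho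
  exact ⟨h1.trans ht, h2.trans hd, h3.trans hR, h4.trans hX, hQ _ h5 h6⟩

lemma weaken (h : Tr W c s t d R X Q₁) (hQ : ∀ s', Q₁ s' → Frame c X s s' → Q s') :
    Tr W c s t d R X Q :=
  h.mono le_rfl le_rfl subset_rfl subset_rfl hQ

lemma seq (h₁ : Tr W c₁ s t₁ d₁ R₁ X₁ Q₁)
    (h₂ : ∀ s', Q₁ s' → Frame c₁ X₁ s s' → Tr W c₂ s' t₂ d₂ R X Q)
    (ht : t₁ + t₂ ≤ t) (hd : d₁ + d₂ ≤ d) (hR : R₁ ⊆ R) (hX : X₁ ⊆ X) :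
    Tr W (c₁ ;; c₂) s t d R X Q := by
  have h := h₁.frame
  refine ⟨.seq h.1 fun o ho => (h₂ _ (h.2 o ho).2.2.2.2.1 (h.2 o ho).2.2.2.2.2).1,
    fun o ho => ?_⟩
  cases ho with
  | seq ho₁ ho₂ =>
    obtain ⟨a1, a2, a3, a4, a5, a6⟩ := h.2 _ ho₁
    obtain ⟨b1, b2, b3, b4, b5⟩ := (h₂ _ a5 a6).2 _ ho₂
    exact ⟨(add_le_add a1 b1).trans ht, (add_le_add a2 b2).trans hd,
      Set.union_subset (a3.trans hR) b3, Set.union_subset (a4.trans hX) b4, b5⟩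

lemma bind (h₁ : Tr W c₁ s t₁ d₁ R₁ X₁ Q₁)
    (ht : t₁ + t₂ ≤ t) (hd : d₁ + d₂ ≤ d) (hR : R₁ ⊆ R) (hX : X₁ ⊆ X)
    (h₂ : ∀ s', Q₁ s' → Frame c₁ X₁ s s' → Tr W c₂ s' t₂ d₂ R X Q) :
    Tr W (c₁ ;; c₂) s t d R X Q :=
  h₁.seq h₂ ht hd hR hX

lemma ite_pos (he : e.eval W s ≠ 0) (h : Tr W c₁ s t₁ d₁ R X Q)
    (ht : e.cost + 1 + t₁ ≤ t) (hd : e.cost + 1 + d₁ ≤ d) (hR : e.reads W s ⊆ R) :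
    Tr W (.ite e c₁ c₂) s t d R X Q := by
  refine ⟨.ite_true he h.1, fun o ho => ?_⟩
  cases ho with
  | ite_true _ ho =>
    obtain ⟨a1, a2, a3, a4, a5⟩ := h.2 _ ho
    exact ⟨(Nat.add_le_add_left a1 _).trans ht, (Nat.add_le_add_left a2 _).trans hd,
      Set.union_subset hR a3, Set.union_subset (Set.empty_subset _) a4, a5⟩
  | ite_false h0 _ => exact absurd h0 he

lemma ite_neg (he : e.eval W s = 0) (h : Tr W c₂ s t₁ d₁ R X Q)
    (ht : e.cost + 1 + t₁ ≤ t) (hd : e.cost + 1 + d₁ ≤ d) (hR : e.reads W s ⊆ R) :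
    Tr W (.ite e c₁ c₂) s t d R X Q := by
  refine ⟨.ite_false he h.1, fun o ho => ?_⟩
  cases ho with
  | ite_false _ ho =>
    obtain ⟨a1, a2, a3, a4, a5⟩ := h.2 _ ho
    exact ⟨(Nat.add_le_add_left a1 _).trans ht, (Nat.add_le_add_left a2 _).trans hd,
      Set.union_subset hR a3, Set.union_subset (Set.empty_subset _) a4, a5⟩
  | ite_true h0 _ => exact absurd he h0

lemma while_done (he : e.eval W s = 0) (ht : e.cost + 1 ≤ t) (hd : e.cost + 1 ≤ d)
    (hR : e.reads W s ⊆ R) (hQ : Q s) : Tr W (.while e body) s t d R X Q := by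
  refine ⟨.while_false he, fun o ho => ?_⟩
  cases ho with
  | while_true h0 _ _ => exact absurd he h0
  | while_false _ => exact ⟨ht, hd, hR, Set.empty_subset _, hQ⟩

lemma while_step (he : e.eval W s ≠ 0) (h : Tr W body s t₁ d₁ R₁ X₁ Q₁)
    (h₂ : ∀ s', Q₁ s' → Frame body X₁ s s' → Tr W (.while e body) s' t₂ d₂ R X Q)
    (ht : e.cost + 1 + t₁ + t₂ ≤ t) (hd : e.cost + 1 + d₁ + d₂ ≤ d)
    (hR : e.reads W s ⊆ R) (hR₁ : R₁ ⊆ R) (hX : X₁ ⊆ X) :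
    Tr W (.while e body) s t d R X Q := by
  have h := h.frame
  refine ⟨.while_true he h.1 fun o ho =>
    (h₂ _ (h.2 o ho).2.2.2.2.1 (h.2 o ho).2.2.2.2.2).1, fun o ho => ?_⟩
  cases ho with
  | while_false h0 => exact absurd h0 he
  | while_true _ ho₁ ho₂ =>
    obtain ⟨a1, a2, a3, a4, a5, a6⟩ := h.2 _ ho₁
    obtain ⟨b1, b2, b3, b4, b5⟩ := (h₂ _ a5 a6).2 _ ho₂
    refine ⟨?_, ?_, ?_, ?_, b5⟩
    · simp only [Outcome.andThen, Outcome.steps]; omega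
    · simp only [Outcome.andThen, Outcome.steps]; omega
    · exact Set.union_subset hR (Set.union_subset (a3.trans hR₁) b3)
    · exact Set.union_subset (Set.empty_subset _) (Set.union_subset (a4.trans hX) b4)

/-- Parallel loops whose branches write to disjoint sets of cells. -/
lemma par {k : ℕ} {P : ℕ → State → Prop} {R' X' : ℕ → Set Cell} {τ : ℕ → ℕ}
    (hk : e.eval W s = k)
    (h : ∀ i < k, Tr W body (s.branch r i) (τ i) d₁ (R' i) (X' i) (P i))
    (hdis : ∀ i < k, ∀ j < k, i ≠ j → ∀ x, x ∈ X' j → x ∉ R' i ∧ x ∉ X' i)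
    (ht : e.cost + 1 + ∑ i ∈ Finset.range k, (τ i + 1) ≤ t) (hd : e.cost + 1 + d₁ ≤ d)
    (he : e.reads W s ⊆ R) (hR : ∀ i < k, R' i ⊆ R) (hX : ∀ i < k, X' i ⊆ X)
    (hQ : ∀ mem', (∀ i < k, ∃ s', P i s' ∧ Frame body (X' i) (s.branch r i) s' ∧
        ∀ x ∈ X' i, mem' x = s'.mem x) →
      (∀ x, (∀ i < k, x ∉ X' i) → mem' x = s.mem x) → Q ⟨mem', s.reg⟩) :
    Tr W (.par r e body) s t d R X Q := by
  refine ⟨.par (fun i hi => (h i (hk ▸ hi)).1) fun o ho i hi j hj hij => ?_, fun o ho => ?_⟩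
  · rw [hk] at hi hj
    have hi' := ((h i hi).2 _ (ho i (hk ▸ hi))).2.2.1
    have hj' := ((h j hj).2 _ (ho j (hk ▸ hj))).2.2.2.1
    exact Set.disjoint_left.2 fun x hx hx' => (hdis i hi j hj hij x (hj' hx')).1 (hi' hx)
  · cases ho with
    | @par _ _ _ _ o mem' ho hm =>
      rw [hk] at ho hm ⊢
      have hh := fun i hi => (h i hi).frame.2 _ (ho i hi)
      refine ⟨?_, ?_, ?_, ?_, ?_⟩
      · refine le_trans ?_ ht
        simp only [Outcome.andThen, Outcome.steps, Outcome.join]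
        gcongr with i hi
        exact (hh i (Finset.mem_range.1 hi)).1
      · refine le_trans ?_ hd
        simp only [Outcome.andThen, Outcome.steps, Outcome.join]
        gcongr
        exact Finset.sup_le fun i hi => (hh i (Finset.mem_range.1 hi)).2.1
      · refine Set.union_subset he ?_
        rintro x ⟨i, hi, hx⟩
        exact hR i hi ((hh i hi).2.2.1 hx)
      · refine Set.union_subset (Set.empty_subset _) ?_
        rintro x ⟨i, hi, hx⟩
        exact hX i hi ((hh i hi).2.2.2.1 hx)
      · refine hQ mem' (fun i hi => ⟨_, (hh i hi).2.2.2.2.1, (hh i hi).2.2.2.2.2, ?_⟩) ?_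
        · intro x hx
          -- The set `X' i` only bounds the writes of branch `i`. If some branch did write to `x`,
          -- disjointness forces it to be branch `i`; if none did, both the merged memory and the
          -- memory of branch `i` still hold the initial value.
          by_cases hw : ∃ i < k, x ∈ (o i).writes
          · obtain ⟨j, hj, hxj, hxe⟩ := (hm x).2 hw
            have : j = i := by
              by_contra hne
              exact (hdis j hj i hi hne x hx).2 ((hh j hj).2.2.2.1 hxj)
            rw [hxe, this]
          · have hw' : ∀ i < k, x ∉ (o i).writes := fun i hi hx => hw ⟨i, hi, hx⟩
            rw [(hm x).1 hw', (ho i hi).mem_eq x (hw' i hi)]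
            rfl
        · intro x hx
          exact (hm x).1 fun i hi hxi => hx i hi ((hh i hi).2.2.2.1 hxi)

/-- Without loops the run is deterministic, so a triple reduces to computing `Cmd.run`, `Cmd.rd` and
`Cmd.wr` symbolically. All straight-line pieces of the algorithm are verified in this way. -/
lemma simple_aux (W : ℕ) (c : Cmd) : ∀ s, c.simple = true →
    Tr W c s c.cost c.cost (c.rd W s) (c.wr W s) (fun s' => s' = c.run W s) := by
  induction c with
  | skip =>
    intro s _
    refine ⟨.skip s, fun o ho => ?_⟩
    cases ho
    exact ⟨le_rfl, le_rfl, subset_rfl, subset_rfl, rfl⟩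
  | set r e =>
    intro s _
    refine ⟨.set s r e, fun o ho => ?_⟩
    cases ho
    exact ⟨le_rfl, le_rfl, subset_rfl, subset_rfl, rfl⟩
  | store a i e =>
    intro s _
    refine ⟨.store s a i e, fun o ho => ?_⟩
    cases ho
    exact ⟨le_rfl, le_rfl, subset_rfl, subset_rfl, rfl⟩
  | seq c₁ c₂ h₁ h₂ =>
    intro s hs
    simp only [Cmd.simple, Bool.and_eq_true] at hs
    refine (h₁ s hs.1).seq (t₂ := c₂.cost) (d₂ := c₂.cost) ?_ le_rfl le_rfl
      Set.subset_union_left Set.subset_union_left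
    rintro s' rfl -
    exact (h₂ _ hs.2).mono le_rfl le_rfl Set.subset_union_right Set.subset_union_right
      fun s' h _ => h
  | ite e c₁ c₂ h₁ h₂ =>
    intro s hs
    simp only [Cmd.simple, Bool.and_eq_true] at hs
    by_cases he : e.eval W s = 0
    · refine ite_neg (t₁ := c₂.cost) (d₁ := c₂.cost) he ((h₂ s hs.2).mono le_rfl le_rfl ?_ ?_ ?_)
        (by simp only [Cmd.cost]; omega) (by simp only [Cmd.cost]; omega) Set.subset_union_left
      · simp [Cmd.rd, he]
      · simp [Cmd.wr, he]
      · rintro s' rfl -; simp [Cmd.run, he]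
    · refine ite_pos (t₁ := c₁.cost) (d₁ := c₁.cost) he ((h₁ s hs.1).mono le_rfl le_rfl ?_ ?_ ?_)
        (by simp only [Cmd.cost]; omega) (by simp only [Cmd.cost]; omega) Set.subset_union_left
      · simp [Cmd.rd, he]
      · simp [Cmd.wr, he]
      · rintro s' rfl -; simp [Cmd.run, he]
  | _ => intro s hs; simp [Cmd.simple] at hs

lemma simple (hc : c.simple = true) (ht : c.cost ≤ t) (hd : c.cost ≤ d) (hR : c.rd W s ⊆ R)
    (hX : c.wr W s ⊆ X) (hQ : Q (c.run W s)) : Tr W c s t d R X Q :=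
  (simple_aux W c s hc).mono ht hd hR hX (by rintro s' rfl -; exact hQ)

end Tr

/-! ## Counting loops -/

/-- `for r := 0, …, l - 1 do body`, where `l` is a register. -/
def Cmd.upTo (r l : ℕ) (body : Cmd) : Cmd :=
  .set r (.cst 0) ;; .while (.less (.rg r) (.rg l)) (body ;; .set r (.rg r + .cst 1))

lemma ite_mod_word {M : ℕ} (hM : 1 < M) (p : Prop) [Decidable p] :
    (if p then 1 else 0) % M = if p then 1 else 0 := by
  split_ifs
  · exact Nat.mod_eq_of_lt hM
  · exact Nat.zero_mod _

/-- The time bound may vary with the iteration, which is needed when the iterations are the classes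
and only the sum of their sizes is controlled. Per iteration the loop overhead is 4 for the test and
4 for the increment; initialization and the last, failing test cost 2 + 4. -/
lemma Tr.upTo_sum {W : ℕ} {r l m d td dd : ℕ} {t : ℕ → ℕ} {body : Cmd} {s : State} {R X : Set Cell}
    {Q : State → Prop} (I : ℕ → State → Prop) (hm : m < 2 ^ W) (hl : s.reg l = m)
    (hrl : r ≠ l) (hkr : body.keeps r = true) (hkl : body.keeps l = true)
    (h0 : I 0 ⟨s.mem, Function.update s.reg r 0⟩)
    (hstep : ∀ i < m, ∀ s', I i s' → s'.reg r = i → s'.reg l = m →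
      Tr W body s' (t i) d R X (fun s'' => I (i + 1) ⟨s''.mem, Function.update s''.reg r (i + 1)⟩))
    (ht : ∑ i ∈ Finset.range m, (t i + 8) + 6 ≤ td) (hd : m * (d + 8) + 6 ≤ dd)
    (hQ : ∀ s', I m s' → s'.reg r = m → s'.reg l = m → Q s') :
    Tr W (.upTo r l body) s td dd R X Q := by
  -- Induction on the number `k` of iterations still to come.
  have key : ∀ k i, i + k = m → ∀ s', I i s' → s'.reg r = i → s'.reg l = m →
      Tr W (.while (.less (.rg r) (.rg l)) (body ;; .set r (.rg r + .cst 1))) s'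
        (∑ j ∈ Finset.range k, (t (i + j) + 8) + 4) (k * (d + 8) + 4) R X Q := by
    intro k
    induction k with
    | zero =>
      intro i hi s' hI hr hl'
      have : i = m := by omega
      subst this
      refine Tr.while_done ?_ (by simp) (by simp) (by simp) (hQ _ hI hr hl')
      simp [hr, hl']
    | succ k ih =>
      intro i hi s' hI hr hl'
      have hW : 1 < 2 ^ W := by
        have : 1 ≤ m := by omega
        omega
      refine Tr.while_step (t₁ := t i + 4) (d₁ := d + 4)
        (t₂ := ∑ j ∈ Finset.range k, (t (i + 1 + j) + 8) + 4)
        (d₂ := k * (d + 8) + 4) (R₁ := R) (X₁ := X)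
        (Q₁ := fun s'' => I (i + 1) s'' ∧ s''.reg r = i + 1 ∧ s''.reg l = m) ?_ ?_ ?_ ?_ ?_ ?_
        subset_rfl subset_rfl
      · have : i < m := by omega
        simp [hr, hl', this, Nat.mod_eq_of_lt hW]
      · refine (hstep i (by omega) s' hI hr hl').seq (t₂ := 4) (d₂ := 4) ?_ le_rfl le_rfl
          subset_rfl subset_rfl
        intro s'' h1 h2
        have e1 : s''.reg r = i := by rw [h2.2 r hkr, hr]
        have e2 : s''.reg l = m := by rw [h2.2 l hkl, hl']
        have e3 : (i + 1) % 2 ^ W = i + 1 := Nat.mod_eq_of_lt (by omega)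
        refine Tr.simple rfl le_rfl le_rfl ?_ ?_ ?_
        · simp [Cmd.rd]
        · simp [Cmd.wr]
        · simpa [Cmd.run, e1, e3, hrl.symm, e2, Nat.mod_eq_of_lt hW] using h1
      · intro s'' h1 _
        exact ih (i + 1) (by omega) s'' h1.1 h1.2.1 h1.2.2
      · have : ∀ j, t (i + (j + 1)) = t (i + 1 + j) := fun j => by rw [add_comm j, add_assoc]
        rw [Finset.sum_range_succ']
        simp only [this, Expr.cost_less, Expr.cost_rg, add_zero]
        omega
      · simp; ring_nf; omega
      · simp
  refine Tr.seq (t₁ := 2) (d₁ := 2) (R₁ := R) (X₁ := X)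
    (Q₁ := fun s' => s' = ⟨s.mem, Function.update s.reg r 0⟩)
    (Tr.simple rfl le_rfl le_rfl ?_ ?_ ?_)
    (t₂ := ∑ i ∈ Finset.range m, (t i + 8) + 4) (d₂ := m * (d + 8) + 4) ?_
    (by omega) (by omega) subset_rfl subset_rfl
  · simp [Cmd.rd]
  · simp [Cmd.wr]
  · simp [Cmd.run]
  · rintro s' rfl -
    simpa using key m 0 (by omega) _ h0 (by simp) (by simpa [hrl.symm] using hl)

lemma Tr.upTo {W : ℕ} {r l m t d td dd : ℕ} {body : Cmd} {s : State} {R X : Set Cell}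
    {Q : State → Prop} (I : ℕ → State → Prop) (hm : m < 2 ^ W) (hl : s.reg l = m)
    (hrl : r ≠ l) (hkr : body.keeps r = true) (hkl : body.keeps l = true)
    (h0 : I 0 ⟨s.mem, Function.update s.reg r 0⟩)
    (hstep : ∀ i < m, ∀ s', I i s' → s'.reg r = i → s'.reg l = m →
      Tr W body s' t d R X (fun s'' => I (i + 1) ⟨s''.mem, Function.update s''.reg r (i + 1)⟩))
    (ht : m * (t + 8) + 6 ≤ td) (hd : m * (d + 8) + 6 ≤ dd)
    (hQ : ∀ s', I m s' → s'.reg r = m → s'.reg l = m → Q s') :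
    Tr W (.upTo r l body) s td dd R X Q :=
  Tr.upTo_sum (t := fun _ => t) I hm hl hrl hkr hkl h0 hstep (by simpa using ht) hd hQ

/-! ## Selecting a bucket of small weight -/

/-- The counter at position `q`, a number of two words, the words being in the arrays `9` and `8`. -/
def cval (W : ℕ) (mem : Cell → ℕ) (q : ℕ) : ℕ := mem (9, q) * 2 ^ W + mem (8, q)

/-- The cells of `len` counters from position `base` on. -/
def cntCells (base len : ℕ) : Set Cell :=
  {x | (x.1 = 8 ∨ x.1 = 9) ∧ base ≤ x.2 ∧ x.2 < base + len}

/-- The cells of `len` keys from position `off` on. -/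
def keyCells (off len : ℕ) : Set Cell := {x | x.1 = 7 ∧ off ≤ x.2 ∧ x.2 < off + len}

/-- The cells of the weights. -/
def wtCells : Set Cell := {x | x.1 = 3}

lemma mem_cntCells {a q base len : ℕ} :
    (a, q) ∈ cntCells base len ↔ (a = 8 ∨ a = 9) ∧ base ≤ q ∧ q < base + len := Iff.rfl

lemma mem_keyCells {a q off len : ℕ} :
    (a, q) ∈ keyCells off len ↔ a = 7 ∧ off ≤ q ∧ q < off + len := Iff.rfl

lemma mem_wtCells {a q : ℕ} : (a, q) ∈ wtCells ↔ a = 3 := Iff.rfl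

lemma cntCells_subset {b l b' l' : ℕ} (h : b' ≤ b) (h' : b + l ≤ b' + l') :
    cntCells b l ⊆ cntCells b' l' := by
  rintro ⟨a, q⟩ hx
  rw [mem_cntCells] at hx ⊢
  omega

/-- Add the number with the words in registers `22` and `21` to the counter whose position is in
register `20`. -/
def addTo : Cmd :=
  .set 23 (.arr 8 (.rg 20) + .rg 21) ;;
  .store 9 (.rg 20) (.arr 9 (.rg 20) + .rg 22 + .less (.rg 23) (.rg 21)) ;;
  .store 8 (.rg 20) (.rg 23)

/-- The low words produce a carry exactly when their wrapped sum is smaller than a summand. As the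
true sum fits into two words, neither addition to the high word wraps. -/
lemma two_word_add {M hi lo x y : ℕ} (hlo : lo < M) (hx : x < M)
    (h : hi * M + lo + (y * M + x) < M * M) :
    ((hi + y) % M + if (lo + x) % M < x then 1 else 0) % M * M + (lo + x) % M =
      hi * M + lo + (y * M + x) := by
  have h1 : hi + y < M := by
    by_contra hc
    have : M * M ≤ (hi + y) * M := Nat.mul_le_mul_right _ (by omega)
    nlinarith
  rw [Nat.mod_eq_of_lt h1]
  by_cases hc : lo + x < M
  · rw [Nat.mod_eq_of_lt hc, if_neg (by omega), add_zero, Nat.mod_eq_of_lt h1]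
    ring
  · have h2 : (lo + x) % M = lo + x - M := by
      rw [Nat.mod_eq_sub_mod (by omega), Nat.mod_eq_of_lt (by omega)]
    have h3 : hi + y + 1 < M := by
      by_contra hc'
      have : M * M ≤ (hi + y + 1) * M := Nat.mul_le_mul_right _ (by omega)
      nlinarith
    rw [h2, if_pos (by omega), Nat.mod_eq_of_lt h3]
    have : lo + x = (lo + x - M) + M := by omega
    nlinarith

lemma addTo_run {W q x y : ℕ} {s : State} (hW : 1 < 2 ^ W) (hq : s.reg 20 = q) (hx : s.reg 21 = x)
    (hy : s.reg 22 = y) (hx' : x < 2 ^ W) (hlo : s.mem (8, q) < 2 ^ W)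
    (h : cval W s.mem q + (y * 2 ^ W + x) < 2 ^ W * 2 ^ W) :
    cval W (addTo.run W s).mem q = cval W s.mem q + (y * 2 ^ W + x) ∧
      (addTo.run W s).mem (8, q) < 2 ^ W := by
  have := two_word_add hlo hx' h
  constructor
  · rw [cval, cval, ← this]
    simp [addTo, Cmd.run, hq, hx, hy, ite_mod_word hW]
  · simp [addTo, Cmd.run, hq, Nat.mod_lt]

lemma addTo_rd {W q : ℕ} {s : State} (hq : s.reg 20 = q) : addTo.rd W s ⊆ cntCells q 1 := by
  simp [addTo, Cmd.rd, Cmd.run, hq, Set.insert_subset_iff, mem_cntCells]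

lemma addTo_wr {W q : ℕ} {s : State} (hq : s.reg 20 = q) : addTo.wr W s ⊆ cntCells q 1 := by
  simp [addTo, Cmd.wr, Cmd.run, hq, Set.insert_subset_iff, mem_cntCells]

lemma addTo_mem {W q : ℕ} {s : State} (hq : s.reg 20 = q) (x : Cell) (hx : x ∉ cntCells q 1) :
    (addTo.run W s).mem x = s.mem x := by
  obtain ⟨a, p⟩ := x
  rw [mem_cntCells] at hx
  have h8 : (a, p) ≠ (8, q) := by rintro ⟨⟩; omega
  have h9 : (a, p) ≠ (9, q) := by rintro ⟨⟩; omega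
  simp [addTo, Cmd.run, hq, Function.update_of_ne h8, Function.update_of_ne h9]

/-- Set the first `k * c` counters to zero. -/
def clearCounters : Cmd :=
  .par 16 (.rg 12 * .rg 11)
    (.store 8 (.rg 13 + .rg 16) (.cst 0) ;; .store 9 (.rg 13 + .rg 16) (.cst 0))

lemma clearCounters_tr {W c k base : ℕ} {s : State} (h12 : s.reg 12 = c) (h11 : s.reg 11 = k)
    (h13 : s.reg 13 = base) (hW : base + c * k < 2 ^ W) :
    Tr W clearCounters s (c * k * 11 + 4) 14 ∅ (cntCells base (c * k)) (fun s' =>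
      ∀ q, base ≤ q → q < base + c * k → s'.mem (8, q) = 0 ∧ s'.mem (9, q) = 0) := by
  have e1 : (c * k) % 2 ^ W = c * k := Nat.mod_eq_of_lt (by omega)
  refine Tr.par (k := c * k) (P := fun i s' => s'.mem (8, base + i) = 0 ∧ s'.mem (9, base + i) = 0)
    (R' := fun _ => ∅) (X' := fun i => cntCells (base + i) 1) (τ := fun _ => 10) (d₁ := 10)
    ?_ ?_ ?_ ?_ ?_ ?_ ?_ ?_ ?_
  · simp [h12, h11, e1]
  · intro i hi
    have e2 : (base + i) % 2 ^ W = base + i := Nat.mod_eq_of_lt (by omega)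
    refine Tr.simple rfl (by simp [Cmd.cost]) (by simp [Cmd.cost]) ?_ ?_ ?_
    · simp [Cmd.rd]
    · simp [Cmd.wr, Cmd.run, State.branch, h13, e2, Set.insert_subset_iff, mem_cntCells]
    · simp [Cmd.run, State.branch, h13, e2]
  · rintro i _ j _ hij ⟨a, q⟩ hx
    rw [mem_cntCells] at hx ⊢
    refine ⟨Set.notMem_empty _, by omega⟩
  · simp; omega
  · simp
  · simp
  · simp
  · intro i hi
    exact cntCells_subset (by omega) (by omega)
  · intro mem' h1 _ q hq hq'
    obtain ⟨s', h2, -, h3⟩ := h1 (q - base) (by omega)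
    rw [show base + (q - base) = q by omega] at h2
    dsimp only
    rw [h3 (8, q) (by rw [mem_cntCells]; omega), h3 (9, q) (by rw [mem_cntCells]; omega)]
    exact h2

/-- Compute the position of the counter to which an entry of the adjacency list contributes, and its
weight. -/
def countAddr : Cmd :=
  .set 20 (.rg 13 + (.rg 16 * .rg 11 + .rg 19)) ;;
  .set 21 (.arr 3 (.rg 9 + .rg 18)) ;; .set 22 (.cst 0)

/-- Add an entry of the adjacency list to its counter. -/
def countStep : Cmd :=
  .set 18 (.rg 16 * .rg 11 + .rg 17) ;;
  .ite (.less (.rg 18) (.rg 10))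
    (.set 19 (.arr 7 (.rg 9 + .rg 18)) ;;
      .ite (.less (.rg 19) (.rg 11)) (countAddr ;; addTo) .skip) .skip

/-- The contribution of entry `p` of an adjacency list to the weight of bucket `y`. -/
def entryWt (mem : Cell → ℕ) (off deg y p : ℕ) : ℕ :=
  if p < deg ∧ mem (7, off + p) = y then mem (3, off + p) else 0

/-- The total weight of the entries of an adjacency list with key `y`. -/
def bucketWt (mem : Cell → ℕ) (off deg y : ℕ) : ℕ :=
  ∑ p ∈ Finset.range deg, if mem (7, off + p) = y then mem (3, off + p) else 0

/-- Positions beyond the end of the list and keys that are not below `k` leave the counters alone.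
Dropping large keys is harmless, because only `k` buckets compete. -/
lemma countStep_tr {W k base off deg i j : ℕ} {s : State}
    (h9 : s.reg 9 = off) (h10 : s.reg 10 = deg) (h11 : s.reg 11 = k) (h13 : s.reg 13 = base)
    (h16 : s.reg 16 = i) (h17 : s.reg 17 = j) (hjk : j < k)
    (hW : base + (i + 1) * k < 2 ^ W) (hW' : off + deg < 2 ^ W) (hW1 : 1 < 2 ^ W)
    (hwt : ∀ p < deg, s.mem (3, off + p) < 2 ^ W)
    (hlo : ∀ y < k, s.mem (8, base + i * k + y) < 2 ^ W)
    (hov : ∀ y < k, cval W s.mem (base + i * k + y) + entryWt s.mem off deg y (i * k + j) <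
      2 ^ W * 2 ^ W) :
    Tr W countStep s 60 60 (wtCells ∪ keyCells off deg ∪ cntCells (base + i * k) k)
      (cntCells (base + i * k) k) (fun s' =>
        (∀ y < k, s'.mem (8, base + i * k + y) < 2 ^ W) ∧
        ∀ y < k, cval W s'.mem (base + i * k + y) =
          cval W s.mem (base + i * k + y) + entryWt s.mem off deg y (i * k + j)) := by
  have hik : (i + 1) * k = i * k + k := by ring
  have e1 : (i * k) % 2 ^ W = i * k := Nat.mod_eq_of_lt (by omega)
  have e2 : (i * k + j) % 2 ^ W = i * k + j := Nat.mod_eq_of_lt (by omega)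
  by_cases hp : i * k + j < deg
  swap
  · have hz : ∀ y, entryWt s.mem off deg y (i * k + j) = 0 := fun y => by simp [entryWt, hp]
    refine Tr.simple rfl (by decide)
      (by decide) ?_ ?_ ?_
    · simp [countStep, Cmd.rd, Cmd.run, h10, h11, h16, h17, e1, e2, hp]
    · simp [countStep, Cmd.wr, Cmd.run, h10, h11, h16, h17, e1, e2, hp]
    · simpa [countStep, Cmd.run, h10, h11, h16, h17, e1, e2, hp, hz] using hlo
  have e3 : (off + (i * k + j)) % 2 ^ W = off + (i * k + j) := Nat.mod_eq_of_lt (by omega)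
  by_cases hy : s.mem (7, off + (i * k + j)) < k
  swap
  · have hz : ∀ y < k, entryWt s.mem off deg y (i * k + j) = 0 := fun y hy' => by
      rw [entryWt, if_neg]
      omega
    refine Tr.simple rfl (by decide)
      (by decide) ?_ ?_ ?_
    · simp [countStep, Cmd.rd, Cmd.run, h9, h10, h11, h16, h17, e1, e2, e3, hp, hy,
        Nat.mod_eq_of_lt hW1, mem_keyCells]
    · simp [countStep, Cmd.wr, Cmd.run, h9, h10, h11, h16, h17, e1, e2, e3, hp, hy,
        Nat.mod_eq_of_lt hW1]
    · have : ∀ y < k, cval W s.mem (base + i * k + y) = cval W s.mem (base + i * k + y) +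
          entryWt s.mem off deg y (i * k + j) := fun y hy' => by rw [hz y hy', add_zero]
      simpa [countStep, Cmd.run, h9, h10, h11, h16, h17, e1, e2, e3, hp, hy,
        Nat.mod_eq_of_lt hW1] using And.intro hlo this
  obtain ⟨y₁, hy₁⟩ : ∃ y₁, s.mem (7, off + (i * k + j)) = y₁ := ⟨_, rfl⟩
  rw [hy₁] at hy
  have e4 : (i * k + y₁) % 2 ^ W = i * k + y₁ := Nat.mod_eq_of_lt (by omega)
  have e5 : (base + (i * k + y₁)) % 2 ^ W = base + (i * k + y₁) := Nat.mod_eq_of_lt (by omega)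
  have hs₁ : countStep.run W s = (countAddr ;; addTo).run W ⟨s.mem,
      Function.update (Function.update s.reg 18 (i * k + j)) 19 y₁⟩ := by
    simp only [countStep, Cmd.run]
    simp [h9, h10, h11, h16, h17, e1, e2, e3, hp, hy, hy₁, Nat.mod_eq_of_lt hW1]
  set s₁ := countAddr.run W ⟨s.mem, Function.update (Function.update s.reg 18 (i * k + j)) 19 y₁⟩
    with hs₁def
  have hs₂ : countStep.run W s = addTo.run W s₁ := hs₁
  have hm : s₁.mem = s.mem := rfl
  have h20 : s₁.reg 20 = base + i * k + y₁ := by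
    simp [hs₁def, countAddr, Cmd.run, h11, h13, h16, e1, e4, e5, add_assoc]
  have h21 : s₁.reg 21 = s.mem (3, off + (i * k + j)) := by
    simp [hs₁def, countAddr, Cmd.run, h9, e3]
  have h22 : s₁.reg 22 = 0 := by simp [hs₁def, countAddr, Cmd.run]
  have hen : ∀ y, entryWt s.mem off deg y (i * k + j) =
      if y = y₁ then s.mem (3, off + (i * k + j)) else 0 := fun y => by
    simp [entryWt, hp, hy₁, eq_comm]
  have hov₁ := hov y₁ hy
  rw [hen, if_pos rfl] at hov₁
  have hadd := addTo_run (W := W) (s := s₁) hW1 h20 h21 h22 (hwt _ hp) (hlo _ hy)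
    (by rw [hm]; simpa using hov₁)
  have hsub : cntCells (base + i * k + y₁) 1 ⊆ cntCells (base + i * k) k :=
    cntCells_subset (by omega) (by omega)
  refine Tr.simple rfl (by decide)
    (by decide) ?_ ?_ ?_
  · have hr : countStep.rd W s = insert (7, off + (i * k + j)) (countAddr.rd W
        ⟨s.mem, Function.update (Function.update s.reg 18 (i * k + j)) 19 y₁⟩ ∪
        addTo.rd W s₁) := by
      simp only [countStep, Cmd.rd, hs₁def]
      simp [Cmd.run, h9, h10, h11, h16, h17, e1, e2, e3, hp, hy, hy₁,
        Nat.mod_eq_of_lt hW1]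
    rw [hr]
    refine Set.insert_subset (Or.inl (Or.inr (by rw [mem_keyCells]; omega)))
      (Set.union_subset ?_ ((addTo_rd h20).trans (hsub.trans Set.subset_union_right)))
    simp [countAddr, Cmd.rd, mem_wtCells]
  · have hr : countStep.wr W s = addTo.wr W s₁ := by
      simp only [countStep, Cmd.wr, hs₁def]
      simp [Cmd.run, Cmd.wr, h9, h10, h11, h16, h17, e1, e2, e3, hp, hy, hy₁,
        Nat.mod_eq_of_lt hW1, countAddr]
    rw [hr]
    exact (addTo_wr h20).trans hsub
  · rw [hs₂]
    refine ⟨fun y hy' => ?_, fun y hy' => ?_⟩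
    · by_cases hyy : y = y₁
      · exact hyy ▸ hadd.2
      · rw [addTo_mem h20 _ (by rw [mem_cntCells]; omega)]
        exact hlo y hy'
    · by_cases hyy : y = y₁
      · rw [hen, if_pos hyy, hyy, hadd.1, hm]
        ring
      · rw [hen, if_neg hyy, cval, cval, addTo_mem h20 _ (by rw [mem_cntCells]; omega),
          addTo_mem h20 _ (by rw [mem_cntCells]; omega), hm, add_zero]

lemma entryWt_congr {mem mem' : Cell → ℕ} (h : ∀ x : Cell, x.1 = 3 ∨ x.1 = 7 → mem' x = mem x)
    (off deg y p : ℕ) : entryWt mem' off deg y p = entryWt mem off deg y p := by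
  rw [entryWt, entryWt, h (7, _) (Or.inr rfl), h (3, _) (Or.inl rfl)]

lemma entryWt_lt {mem : Cell → ℕ} {M off deg : ℕ} (hM : 0 < M)
    (h : ∀ p < deg, mem (3, off + p) < M) (y p : ℕ) : entryWt mem off deg y p < M := by
  rw [entryWt]
  split_ifs with hp
  · exact h _ hp.1
  · exact hM

/-- Add the entries of every chunk of the adjacency list to the counters of the chunk. -/
def countAll : Cmd := .par 16 (.rg 12) (.upTo 17 11 countStep)

lemma countChunk_tr {W k base off deg i : ℕ} {s : State}
    (h9 : s.reg 9 = off) (h10 : s.reg 10 = deg) (h11 : s.reg 11 = k) (h13 : s.reg 13 = base)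
    (h16 : s.reg 16 = i) (hk : k < 2 ^ W)
    (hW : base + (i + 1) * k < 2 ^ W) (hW' : off + deg < 2 ^ W) (hW1 : 1 < 2 ^ W)
    (hwt : ∀ p < deg, s.mem (3, off + p) < 2 ^ W)
    (h0 : ∀ y < k, s.mem (8, base + i * k + y) = 0 ∧ s.mem (9, base + i * k + y) = 0) :
    Tr W (.upTo 17 11 countStep) s (k * 68 + 6) (k * 68 + 6)
      (wtCells ∪ keyCells off deg ∪ cntCells (base + i * k) k)
      (cntCells (base + i * k) k) (fun s' =>
        (∀ y < k, s'.mem (8, base + i * k + y) < 2 ^ W) ∧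
        ∀ y < k, cval W s'.mem (base + i * k + y) =
          ∑ j ∈ Finset.range k, entryWt s.mem off deg y (i * k + j)) := by
  refine Tr.upTo (m := k) (t := 60) (d := 60) (fun j s' =>
    (s'.reg 9 = off ∧ s'.reg 10 = deg ∧ s'.reg 13 = base ∧ s'.reg 16 = i) ∧
    (∀ x : Cell, x.1 = 3 ∨ x.1 = 7 → s'.mem x = s.mem x) ∧
    (∀ y < k, s'.mem (8, base + i * k + y) < 2 ^ W) ∧
        ∀ y < k, cval W s'.mem (base + i * k + y) =
          ∑ j ∈ Finset.range j, entryWt s.mem off deg y (i * k + j))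
    hk h11 (by decide) (by decide) (by decide) ?_ ?_ (by omega) (by omega) ?_
  · refine ⟨by simp [h9, h10, h13, h16], by simp, fun y hy => ?_, fun y hy => ?_⟩
    · simp [h0 y hy]
    · simp [cval, h0 y hy]
  · rintro j hj s' ⟨⟨g9, g10, g13, g16⟩, hm, hlo, hv⟩ g17 g11
    have hen : ∀ y, entryWt s'.mem off deg y (i * k + j) =
        entryWt s.mem off deg y (i * k + j) := fun y => entryWt_congr hm _ _ _ _
    refine (countStep_tr g9 g10 g11 g13 g16 g17 hj hW hW' hW1 ?_ hlo ?_).weaken ?_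
    · intro p hp
      rw [hm _ (Or.inl rfl)]
      exact hwt p hp
    · intro y hy
      rw [hv y hy, hen, ← Finset.sum_range_succ]
      -- A counter has received at most `k` single-word weights, and `k` is itself a word, so two
      -- words suffice.
      calc _ ≤ ∑ _j ∈ Finset.range (j + 1), 2 ^ W :=
            Finset.sum_le_sum fun p _ => (entryWt_lt (by omega) hwt _ _).le
        _ = (j + 1) * 2 ^ W := by simp
        _ < 2 ^ W * 2 ^ W := Nat.mul_lt_mul_of_pos_right (by omega) (by omega)
    · rintro s'' ⟨k1, k2⟩ ⟨f1, f2⟩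
      refine ⟨?_, ?_, k1, ?_⟩
      · simp [f2 9 (by decide), f2 10 (by decide), f2 13 (by decide), f2 16 (by decide), *]
      · intro x hx
        rw [← hm x hx]
        refine f1 x fun hx' => ?_
        have := hx'.1
        omega
      · intro y hy
        rw [k2 y hy, hv y hy, hen, Finset.sum_range_succ]
  · rintro s' ⟨_, _, h3, h4⟩ _ _
    exact ⟨h3, h4⟩

/-- Each chunk of `k` entries has `k` counters of its own. So the chunks can be handled in parallel
without races, while a chunk is processed sequentially in depth O(k). -/
lemma countAll_tr {W k c base off deg : ℕ} {s : State}
    (h9 : s.reg 9 = off) (h10 : s.reg 10 = deg) (h11 : s.reg 11 = k) (h13 : s.reg 13 = base)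
    (h12 : s.reg 12 = c) (hk : k < 2 ^ W) (hk0 : 0 < k)
    (hW : base + c * k < 2 ^ W) (hW' : off + deg < 2 ^ W) (hW1 : 1 < 2 ^ W)
    (hwt : ∀ p < deg, s.mem (3, off + p) < 2 ^ W)
    (h0 : ∀ q, base ≤ q → q < base + c * k → s.mem (8, q) = 0 ∧ s.mem (9, q) = 0) :
    Tr W countAll s (c * (k * 68 + 7) + 2) (k * 68 + 8)
      (wtCells ∪ keyCells off deg ∪ cntCells base (c * k))
      (cntCells base (c * k)) (fun s' =>
        (∀ q, base ≤ q → q < base + c * k → s'.mem (8, q) < 2 ^ W) ∧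
        ∀ i < c, ∀ y < k, cval W s'.mem (base + i * k + y) =
          ∑ j ∈ Finset.range k, entryWt s.mem off deg y (i * k + j)) := by
  have hik : ∀ i < c, i * k + k ≤ c * k := fun i hi => by
    have := Nat.mul_le_mul_right k (show i + 1 ≤ c by omega)
    linarith
  have hik' : ∀ i, (i + 1) * k = i * k + k := fun i => by ring
  have hij : ∀ i j, i < j → i * k + k ≤ j * k := fun i j hij => by
    have := Nat.mul_le_mul_right k (show i + 1 ≤ j by omega)
    linarith
  refine Tr.par (k := c) (τ := fun _ => k * 68 + 6) (d₁ := k * 68 + 6)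
    (R' := fun i => wtCells ∪ keyCells off deg ∪ cntCells (base + i * k) k)
    (X' := fun i => cntCells (base + i * k) k) (P := fun i s' =>
      (∀ y < k, s'.mem (8, base + i * k + y) < 2 ^ W) ∧
        ∀ y < k, cval W s'.mem (base + i * k + y) =
          ∑ j ∈ Finset.range k, entryWt s.mem off deg y (i * k + j))
    (by simp [h12]) ?_ ?_ ?_ ?_ ?_ ?_ ?_ ?_
  · intro i hi
    have := hik i hi
    have := hik' i
    refine countChunk_tr (s := s.branch 16 i) ?_ ?_ ?_ ?_ ?_ hk (by omega) hW' hW1 hwt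
      fun y hy => h0 _ (by omega) (by omega)
    all_goals simp [State.branch, h9, h10, h11, h13]
  · rintro i _ j _ hne ⟨a, q⟩ hx
    simp only [mem_cntCells, Set.mem_union, mem_wtCells, mem_keyCells] at hx ⊢
    rcases Nat.lt_or_gt_of_ne hne with h | h
    · have := hij _ _ h
      omega
    · have := hij _ _ h
      omega
  · simp; ring_nf; omega
  · simp; omega
  · simp
  · intro i hi
    have := hik i hi
    exact Set.union_subset_union_right _ (cntCells_subset (by omega) (by omega))
  · intro i hi
    have := hik i hi
    exact cntCells_subset (by omega) (by omega)
  · intro mem' h1 _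
    have h8 : ∀ i < c, ∀ y < k, mem' (8, base + i * k + y) < 2 ^ W ∧
        cval W mem' (base + i * k + y) =
          ∑ j ∈ Finset.range k, entryWt s.mem off deg y (i * k + j) := by
      intro i hi y hy
      obtain ⟨s', ⟨h2, h3⟩, -, h4⟩ := h1 i hi
      have e8 := h4 (8, base + i * k + y) (by rw [mem_cntCells]; omega)
      have e9 := h4 (9, base + i * k + y) (by rw [mem_cntCells]; omega)
      rw [cval, e8, e9]
      exact ⟨h2 y hy, h3 y hy⟩
    refine ⟨fun q hq hq' => ?_, fun i hi y hy => (h8 i hi y hy).2⟩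
    have hdm := Nat.div_add_mod (q - base) k
    have hq2 : q = base + (q - base) / k * k + (q - base) % k := by
      rw [mul_comm] at hdm; omega
    rw [hq2]
    exact (h8 _ ((Nat.div_lt_iff_lt_mul hk0).2 (by omega)) _ (Nat.mod_lt _ hk0)).1

/-- Add the counter `h * k` positions further on to a counter. -/
def foldStep : Cmd :=
  .set 20 (.rg 13 + .rg 16) ;; .set 21 (.arr 8 (.rg 20 + .rg 15 * .rg 11)) ;;
  .set 22 (.arr 9 (.rg 20 + .rg 15 * .rg 11)) ;; addTo

/-- Add the counters of the last chunks to those of the first ones. -/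
def foldRound : Cmd := .par 16 ((.rg 12 - .rg 15) * .rg 11) foldStep

/-- Since `g ≤ h`, the counters that are read at distance `h * k` lie beyond the first `g * k` ones,
which are the only ones written. Hence each branch touches only its own target among the cells being
written. -/
lemma foldRound_tr {W k g h base : ℕ} {s : State}
    (h11 : s.reg 11 = k) (h13 : s.reg 13 = base) (h12 : s.reg 12 = g + h) (h15 : s.reg 15 = h)
    (hgh : g ≤ h) (hW : base + (g + h) * k < 2 ^ W) (hW1 : 1 < 2 ^ W)
    (hlo : ∀ q, base ≤ q → q < base + (g + h) * k → s.mem (8, q) < 2 ^ W)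
    (hov : ∀ q, base ≤ q → q < base + g * k →
      cval W s.mem q + cval W s.mem (q + h * k) < 2 ^ W * 2 ^ W) :
    Tr W foldRound s (g * k * 37 + 6) 42 (cntCells base ((g + h) * k)) (cntCells base (g * k))
      (fun s' => ∀ q, base ≤ q → q < base + g * k → s'.mem (8, q) < 2 ^ W ∧
        cval W s'.mem q = cval W s.mem q + cval W s.mem (q + h * k)) := by
  have hk1 : (g + h) * k = g * k + h * k := by ring
  have hk2 : g * k ≤ h * k := Nat.mul_le_mul_right _ hgh
  have e1 : g * k % 2 ^ W = g * k := Nat.mod_eq_of_lt (by omega)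
  have e3 : h * k % 2 ^ W = h * k := Nat.mod_eq_of_lt (by omega)
  refine Tr.par (k := g * k) (τ := fun _ => 36) (d₁ := 36)
    (R' := fun i => cntCells (base + i) 1 ∪ cntCells (base + i + h * k) 1)
    (X' := fun i => cntCells (base + i) 1)
    (P := fun i s' => s'.mem (8, base + i) < 2 ^ W ∧
        cval W s'.mem (base + i) = cval W s.mem (base + i) + cval W s.mem (base + i + h * k))
    (by simp [h11, h12, h15, e1]) ?_ ?_ ?_ ?_ ?_ ?_ ?_ ?_
  · intro i hi
    have e2 : (base + i) % 2 ^ W = base + i := Nat.mod_eq_of_lt (by omega)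
    have e4 : (base + i + h * k) % 2 ^ W = base + i + h * k := Nat.mod_eq_of_lt (by omega)
    set s₁ : State := ⟨s.mem, Function.update (Function.update (Function.update
      (s.branch 16 i).reg 20 (base + i)) 21 (s.mem (8, base + i + h * k)))
      22 (s.mem (9, base + i + h * k))⟩ with hs₁def
    have hs₁ : foldStep.run W (s.branch 16 i) = addTo.run W s₁ := by
      simp [foldStep, Cmd.run, State.branch, h11, h13, h15, e2, e3, e4, hs₁def]
    have h20 : s₁.reg 20 = base + i := by simp [hs₁def]
    have hadd := addTo_run (W := W) (s := s₁) (q := base + i) (x := s.mem (8, base + i + h * k))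
      (y := s.mem (9, base + i + h * k)) hW1 h20 (by simp [hs₁def])
      (by simp [hs₁def]) (hlo _ (by omega) (by omega)) (hlo _ (by omega) (by omega))
      (hov _ (by omega) (by omega))
    refine Tr.simple rfl (by decide) (by decide) ?_ ?_ ?_
    · have : foldStep.rd W (s.branch 16 i) = {(8, base + i + h * k), (9, base + i + h * k)} ∪
          addTo.rd W s₁ := by
        simp [foldStep, Cmd.rd, Cmd.run, State.branch, h11, h13, h15, e2, e3, e4, hs₁def]
        ext x
        simp only [Set.mem_insert_iff, Set.mem_union, Set.mem_singleton_iff]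
        tauto
      rw [this, Set.union_comm]
      refine Set.union_subset_union (addTo_rd h20) ?_
      simp [Set.insert_subset_iff, mem_cntCells]
    · have : foldStep.wr W (s.branch 16 i) = addTo.wr W s₁ := by
        simp [foldStep, Cmd.wr, Cmd.run, State.branch, h11, h13, h15, e2, e3, e4, hs₁def]
      rw [this]
      exact addTo_wr h20
    · rw [hs₁]
      exact ⟨hadd.2, hadd.1⟩
  · rintro i hi j hj hne ⟨a, q⟩ hx
    simp only [mem_cntCells, Set.mem_union] at hx ⊢
    omega
  · simp; omega
  · simp
  · simp
  · intro i hi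
    exact Set.union_subset (cntCells_subset (by omega) (by omega))
      (cntCells_subset (by omega) (by omega))
  · intro i hi
    exact cntCells_subset (by omega) (by omega)
  · intro mem' h1 _ q hq hq'
    obtain ⟨s', h2, -, h4⟩ := h1 (q - base) (by omega)
    rw [show base + (q - base) = q by omega] at h2 h4
    have e8 := h4 (8, q) (by rw [mem_cntCells]; omega)
    have e9 := h4 (9, q) (by rw [mem_cntCells]; omega)
    dsimp only
    rw [e8, cval, e8, e9]
    exact h2

/-- Add up the counters of all chunks. -/
def foldLoop : Cmd :=
  .while (.less (.cst 1) (.rg 12))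
    (.set 15 ((.rg 12 + .cst 1) / .cst 2) ;; foldRound ;; .set 12 (.rg 15))

/-- The invariant is that the chunk counters of bucket `y` add up to `B y`; this also excludes
overflow, since any two counters being added are summands of `B y`. A round leaves ⌈c/2⌉ of the c
chunks. Each addition removes one counter, so the work telescopes to O((c - 1) * k), with
logarithmic depth. -/
lemma foldLoop_tr {W k base : ℕ} {B : ℕ → ℕ} (hk0 : 0 < k) (hW2 : 2 < 2 ^ W)
    (hB : ∀ y < k, B y < 2 ^ W * 2 ^ W) (c : ℕ) : ∀ s : State,
    0 < c → s.reg 11 = k → s.reg 13 = base → s.reg 12 = c → base + c * k < 2 ^ W → c + 1 < 2 ^ W →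
    (∀ q, base ≤ q → q < base + c * k → s.mem (8, q) < 2 ^ W) →
    (∀ y < k, ∑ i ∈ Finset.range c, cval W s.mem (base + i * k + y) = B y) →
    Tr W foldLoop s (60 * ((c - 1) * k) + 4) (60 * Nat.clog 2 c + 4)
      (cntCells base (c * k)) (cntCells base (c * k))
      (fun s' => ∀ y < k, s'.mem (8, base + y) < 2 ^ W ∧ cval W s'.mem (base + y) = B y) := by
  induction c using Nat.strong_induction_on with
  | _ c ih =>
  intro s hc h11 h13 h12 hW hcW hlo hsum
  have o1 : 1 % 2 ^ W = 1 := Nat.mod_eq_of_lt (by omega)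
  have o2 : 2 % 2 ^ W = 2 := Nat.mod_eq_of_lt (by omega)
  have o3 : (c + 1) % 2 ^ W = c + 1 := Nat.mod_eq_of_lt (by omega)
  by_cases hc1 : c = 1
  · subst hc1
    refine Tr.while_done ?_ (by simp) (by simp) (by simp) fun y hy => ⟨?_, ?_⟩
    · simp [h12, o1]
    · exact hlo _ (by omega) (by omega)
    · simpa using hsum y hy
  obtain ⟨g, h, hgh, hh, hch, hg⟩ : ∃ g h, g ≤ h ∧ h = (c + 1) / 2 ∧ c = g + h ∧ 0 < g :=
    ⟨c - (c + 1) / 2, (c + 1) / 2, by omega, rfl, by omega, by omega⟩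
  have hgk : 0 < g * k := Nat.mul_pos hg hk0
  have hk1 : (g + h) * k = g * k + h * k := by ring
  have hk2 : g * k ≤ h * k := Nat.mul_le_mul_right _ hgh
  have hik : ∀ a i y, i < a → y < k → i * k + y < a * k := fun a i y hi hy => by
    have := Nat.mul_le_mul_right k (show i + 1 ≤ a by omega)
    have h' : (i + 1) * k = i * k + k := by ring
    omega
  rw [hch, hk1] at hlo hW
  have hsum' : ∀ y < k, ∑ i ∈ Finset.range h, cval W s.mem (base + i * k + y) +
      ∑ i ∈ Finset.range g, cval W s.mem (base + i * k + y + h * k) = B y := by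
    intro y hy
    rw [← hsum y hy, hch, add_comm g h, Finset.sum_range_add]
    congr 1
    refine Finset.sum_congr rfl fun i _ => ?_
    congr 1
    ring
  refine Tr.while_step (R₁ := cntCells base (c * k)) (X₁ := cntCells base (c * k))
    (t₁ := 6 + (g * k * 37 + 6 + 2)) (d₁ := 6 + (42 + 2))
    (Q₁ := fun s' => s'.reg 12 = h ∧
      (∀ q, base ≤ q → q < base + g * k → s'.mem (8, q) < 2 ^ W ∧
        cval W s'.mem q = cval W s.mem q + cval W s.mem (q + h * k)) ∧
      (∀ x, x ∉ cntCells base (g * k) → s'.mem x = s.mem x))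
    (t₂ := 60 * ((h - 1) * k) + 4) (d₂ := 60 * Nat.clog 2 h + 4) ?_ ?_ ?_ ?_ ?_ ?_
    subset_rfl subset_rfl
  · have : 1 < c := by omega
    simp [h12, o1, this]
  · refine Tr.seq (R₁ := ∅) (X₁ := ∅) (t₁ := 6) (d₁ := 6) (t₂ := g * k * 37 + 6 + 2) (d₂ := 42 + 2)
      (Q₁ := fun s' => s' = ⟨s.mem, Function.update s.reg 15 h⟩)
      (Tr.simple rfl (by decide) (by decide) ?_ ?_ ?_) ?_ le_rfl le_rfl
      (Set.empty_subset _) (Set.empty_subset _)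
    · simp [Cmd.rd]
    · simp [Cmd.wr]
    · simp [Cmd.run, h12, o1, o2, o3, hh]
    · rintro s' rfl -
      refine Tr.seq (foldRound_tr (k := k) (g := g) (h := h) (base := base) ?_ ?_ ?_ ?_ hgh
        (by omega) (by omega) ?_ ?_) (t₂ := 2) (d₂ := 2) ?_ le_rfl le_rfl ?_ ?_
      · simp [h11]
      · simp [h13]
      · simp [h12, hch]
      · simp
      · intro q hq hq'
        exact hlo q hq (by omega)
      · intro q hq hq'
        dsimp only
        obtain ⟨i, y, hi, hy, rfl⟩ : ∃ i y, i < g ∧ y < k ∧ q = base + i * k + y := by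
          refine ⟨(q - base) / k, (q - base) % k, (Nat.div_lt_iff_lt_mul hk0).2 (by omega),
            Nat.mod_lt _ hk0, ?_⟩
          have := Nat.div_add_mod (q - base) k
          rw [mul_comm] at this
          omega
        refine lt_of_le_of_lt ?_ (hB y hy)
        rw [← hsum' y hy]
        exact add_le_add
          (Finset.single_le_sum (f := fun i => cval W s.mem (base + i * k + y))
            (fun _ _ => Nat.zero_le _) (Finset.mem_range.2 (by omega)))
          (Finset.single_le_sum (f := fun i => cval W s.mem (base + i * k + y + h * k))
            (fun _ _ => Nat.zero_le _) (Finset.mem_range.2 hi))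
      · rintro s' h1 ⟨f1, f2⟩
        refine Tr.simple rfl (by decide) (by decide) ?_ ?_ ?_
        · simp [Cmd.rd]
        · simp [Cmd.wr]
        · refine ⟨?_, h1, f1⟩
          simp [Cmd.run, f2 15 (by decide)]
      · rw [hch]
      · rw [hch]
        exact cntCells_subset le_rfl (by omega)
  · rintro s' ⟨g12, hv, hx⟩ ⟨f1, f2⟩
    refine (ih h (by omega) s' (by omega) ?_ ?_ g12 (by omega) (by omega) ?_ ?_).mono le_rfl le_rfl
      ?_ ?_ fun s' h _ => h
    · rw [f2 11 (by decide), h11]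
    · rw [f2 13 (by decide), h13]
    · intro q hq hq'
      by_cases hqg : q < base + g * k
      · exact (hv q hq hqg).1
      · rw [hx _ (by rw [mem_cntCells]; omega)]
        exact hlo q hq (by omega)
    · intro y hy
      rw [← hsum' y hy, show h = g + (h - g) by omega, Finset.sum_range_add,
        Finset.sum_range_add, add_right_comm, ← Finset.sum_add_distrib]
      congr 1
      · refine Finset.sum_congr rfl fun i hi => ?_
        have := hik g i y (Finset.mem_range.1 hi) hy
        rw [(hv _ (by omega) (by omega)).2, show g + (h - g) = h by omega]
      · refine Finset.sum_congr rfl fun i hi => ?_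
        have : g * k ≤ (g + i) * k := Nat.mul_le_mul_right _ (by omega)
        rw [cval, cval, hx _ (by rw [mem_cntCells]; omega), hx _ (by rw [mem_cntCells]; omega)]
    · rw [hch]
      exact cntCells_subset le_rfl (by omega)
    · rw [hch]
      exact cntCells_subset le_rfl (by omega)
  · have : (c - 1) * k = (h - 1) * k + g * k := by
      rw [hch, show g + h - 1 = (h - 1) + g by omega]; ring
    simp
    omega
  · have : Nat.clog 2 c = Nat.clog 2 h + 1 := by
      rw [Nat.clog_of_two_le (by omega) (by omega), hh]
      rfl
    simp
    omega
  · simp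

/-- Choose the number `k` of buckets, the number of chunks, and the position of the counters. -/
def pickInit : Cmd :=
  .ite (.less (.rg 2) (.rg 10 + .cst 1)) (.set 11 (.rg 2)) (.set 11 (.rg 10 + .cst 1)) ;;
  .set 12 (.rg 10 / .rg 11 + .cst 1) ;; .set 13 (.cst 2 * .rg 9 + .rg 8)

/-- Replace the best bucket so far by a lighter one. -/
def minStep : Cmd :=
  .set 20 (.rg 13 + .rg 17) ;; .set 21 (.rg 13 + .rg 14) ;;
  .ite (.less (.arr 9 (.rg 20)) (.arr 9 (.rg 21))) (.set 14 (.rg 17))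
    (.ite (.same (.arr 9 (.rg 20)) (.arr 9 (.rg 21)))
      (.ite (.less (.arr 8 (.rg 20)) (.arr 8 (.rg 21))) (.set 14 (.rg 17)) .skip) .skip)

/-- For the vertex `v` in register `8`, whose adjacency list starts at the position in register `9`
and has the length in register `10`, find a bucket of small weight among at most as many buckets as
register `2` says. The result is left in register `14`. -/
def pick : Cmd :=
  pickInit ;; clearCounters ;; countAll ;; foldLoop ;; .set 14 (.cst 0) ;; .upTo 17 11 minStep

/-- The lexicographic comparison of high and low words agrees with the numerical one because the low
words are below `2 ^ W`. -/
lemma minStep_tr {W base b j : ℕ} {s : State} (hW : base + b < 2 ^ W) (hW' : base + j < 2 ^ W)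
    (hW1 : 1 < 2 ^ W)
    (h13 : s.reg 13 = base) (h14 : s.reg 14 = b) (h17 : s.reg 17 = j)
    (hlo : s.mem (8, base + b) < 2 ^ W) (hlo' : s.mem (8, base + j) < 2 ^ W) :
    Tr W minStep s 40 40 (cntCells (base + b) 1 ∪ cntCells (base + j) 1) ∅ (fun s' =>
      s'.reg 14 = if cval W s.mem (base + j) < cval W s.mem (base + b) then j else b) := by
  have e1 : (base + b) % 2 ^ W = base + b := Nat.mod_eq_of_lt hW
  have e2 : (base + j) % 2 ^ W = base + j := Nat.mod_eq_of_lt hW'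
  have o1 : 1 % 2 ^ W = 1 := Nat.mod_eq_of_lt hW1
  refine Tr.simple rfl (by decide) (by decide) ?_ ?_ ?_
  · simp only [minStep, Cmd.rd, Cmd.run]
    simp only [Expr.reads_add, Expr.reads_rg, Expr.reads_less, Expr.reads_same, Expr.reads_arr,
      Expr.eval_rg, Expr.eval_add, h13, h17, e2]
    split_ifs <;> simp [Set.insert_subset_iff, mem_cntCells, h13, h14, e1]
  · simp only [minStep, Cmd.wr]
    split_ifs <;> simp
  · rcases lt_trichotomy (s.mem (9, base + j)) (s.mem (9, base + b)) with h | h | h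
    · have : cval W s.mem (base + j) < cval W s.mem (base + b) := by
        have := Nat.mul_le_mul_right (2 ^ W) (Nat.succ_le_of_lt h)
        rw [Nat.succ_mul] at this
        simp only [cval]
        omega
      simp [minStep, Cmd.run, h13, h14, h17, e1, e2, h, this, o1]
    · by_cases h' : s.mem (8, base + j) < s.mem (8, base + b)
      · simp [minStep, Cmd.run, h13, h14, h17, e1, e2, h, h', o1, cval]
      · simp [minStep, Cmd.run, h13, h14, h17, e1, e2, h, h', o1, cval]
    · have : ¬ cval W s.mem (base + j) < cval W s.mem (base + b) := by
        have := Nat.mul_le_mul_right (2 ^ W) (Nat.succ_le_of_lt h)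
        rw [Nat.succ_mul] at this
        simp only [cval]
        omega
      simp [minStep, Cmd.run, h13, h14, h17, e1, e2, h.not_gt, h.ne', this]

lemma minLoop_tr {W base k : ℕ} {B : ℕ → ℕ} {s : State} (hk0 : 0 < k) (hW : base + k < 2 ^ W)
    (h11 : s.reg 11 = k) (h13 : s.reg 13 = base) (h14 : s.reg 14 = 0)
    (hB : ∀ y < k, s.mem (8, base + y) < 2 ^ W ∧ cval W s.mem (base + y) = B y) :
    Tr W (.upTo 17 11 minStep) s (k * 48 + 6) (k * 48 + 6) (cntCells base k) ∅ (fun s' =>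
      s'.reg 14 < k ∧ ∀ y < k, B (s'.reg 14) ≤ B y) := by
  refine Tr.upTo (m := k) (t := 40) (d := 40) (fun j s' => s'.reg 13 = base ∧ s'.mem = s.mem ∧
    s'.reg 14 < k ∧ ∀ y < j, B (s'.reg 14) ≤ B y) (by omega) h11 (by decide) (by decide)
    (by decide) ?_ ?_ le_rfl le_rfl ?_
  · simp [h13, h14, hk0]
  · rintro j hj s' ⟨g13, gm, g14, gB⟩ g17 g11
    refine (minStep_tr (b := s'.reg 14) (by omega) (by omega) (by omega) g13 rfl g17 ?_ ?_).mono
      le_rfl le_rfl ?_ subset_rfl ?_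
    · rw [gm]
      exact (hB _ g14).1
    · rw [gm]
      exact (hB _ hj).1
    · exact Set.union_subset (cntCells_subset (by omega) (by omega))
        (cntCells_subset (by omega) (by omega))
    · intro s'' h ⟨f1, f2⟩
      rw [gm, (hB _ hj).2, (hB _ g14).2] at h
      refine ⟨?_, ?_, ?_, ?_⟩
      · simp [f2 13 (by decide), g13]
      · rw [← gm]
        exact funext fun x => f1 x (Set.notMem_empty _)
      · simp only [Function.update_of_ne (show (14 : ℕ) ≠ 17 by decide), h]
        split_ifs <;> assumption
      · simp only [Function.update_of_ne (show (14 : ℕ) ≠ 17 by decide), h]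
        intro y hy
        rcases Nat.lt_succ_iff_lt_or_eq.1 hy with hy | rfl
        · split_ifs with hc
          · exact hc.le.trans (gB y hy)
          · exact gB y hy
        · split_ifs with hc
          · exact le_rfl
          · exact not_lt.1 hc
  · rintro s' ⟨_, _, h3, h4⟩ _ _
    exact ⟨h3, h4⟩

lemma sum_entryWt (mem : Cell → ℕ) (off deg y : ℕ) {m : ℕ} (hm : deg ≤ m) :
    ∑ p ∈ Finset.range m, entryWt mem off deg y p = bucketWt mem off deg y := by
  rw [bucketWt, ← Finset.sum_subset (Finset.range_mono hm)]
  · refine Finset.sum_congr rfl fun p hp => ?_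
    simp [entryWt, Finset.mem_range.1 hp]
  · intro p _ hp
    rw [Finset.mem_range] at hp
    simp [entryWt, hp]

lemma sum_range_chunks (f : ℕ → ℕ) (c k : ℕ) :
    ∑ i ∈ Finset.range c, ∑ j ∈ Finset.range k, f (i * k + j) =
      ∑ p ∈ Finset.range (c * k), f p := by
  induction c with
  | zero => simp
  | succ c ih => rw [Finset.sum_range_succ, ih, Nat.succ_mul, Finset.sum_range_add]

/-- The lightest of `min K (deg + 1)` buckets has at most the fraction `1 / K` of the weight. -/
lemma mul_bucketWt_le {mem : Cell → ℕ} {off deg K x : ℕ}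
    (hmin : ∀ y < min K (deg + 1), bucketWt mem off deg x ≤ bucketWt mem off deg y) :
    K * bucketWt mem off deg x ≤ ∑ p ∈ Finset.range deg, mem (3, off + p) := by
  by_cases hK : K ≤ deg + 1
  · rw [min_eq_left hK] at hmin
    calc K * bucketWt mem off deg x = ∑ _y ∈ Finset.range K, bucketWt mem off deg x := by simp
      _ ≤ ∑ y ∈ Finset.range K, bucketWt mem off deg y :=
          Finset.sum_le_sum fun y hy => hmin y (Finset.mem_range.1 hy)
      _ = ∑ p ∈ Finset.range deg, ∑ y ∈ Finset.range K,
            if mem (7, off + p) = y then mem (3, off + p) else 0 := Finset.sum_comm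
      _ ≤ _ := Finset.sum_le_sum fun p _ => by
          rw [Finset.sum_ite_eq]
          split_ifs <;> simp
  -- There are more buckets than entries, so by pigeonhole one bucket is empty and the lightest one
  -- has weight 0. In the other case the bound is plain averaging over `K` buckets.
  · rw [min_eq_right (by omega)] at hmin
    obtain ⟨y, hy, hy'⟩ : ∃ y ∈ Finset.range (deg + 1), y ∉ (Finset.range deg).image
        fun p => mem (7, off + p) := by
      by_contra! h
      have := Finset.card_le_card (show Finset.range (deg + 1) ⊆ _ from h)
      have := this.trans Finset.card_image_le
      simp at this
    have h0 : bucketWt mem off deg y = 0 := by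
      refine Finset.sum_eq_zero fun p hp => if_neg fun h => hy' ?_
      exact Finset.mem_image.2 ⟨p, hp, h⟩
    have := hmin y (Finset.mem_range.1 hy)
    have : bucketWt mem off deg x = 0 := by omega
    simp [this]

/-- The work does not involve `K`: with `k = min K (deg + 1)` buckets and `c = deg / k + 1` chunks
there are `c * k ≤ deg + k ≤ 2 * deg + 1` counters, and every phase costs O(1) per counter. The
depth is O(k) for counting and for the final minimum, plus O(log c) for adding up the chunks. -/
lemma pick_tr {W v off deg K : ℕ} {s : State} (hK : 0 < K)
    (h2 : s.reg 2 = K) (h8 : s.reg 8 = v) (h9 : s.reg 9 = off) (h10 : s.reg 10 = deg)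
    (hW : 2 * off + v + (2 * deg + 2) < 2 ^ W)
    (hwt : ∀ p < deg, s.mem (3, off + p) < 2 ^ W) :
    Tr W pick s (400 * (deg + 1)) (200 * K + 60 * Nat.clog 2 (deg + 1) + 100)
      (wtCells ∪ keyCells off deg ∪ cntCells (2 * off + v) (2 * deg + 1))
      (cntCells (2 * off + v) (2 * deg + 1)) (fun s' =>
        s'.reg 14 < K ∧
        K * bucketWt s.mem off deg (s'.reg 14) ≤ ∑ p ∈ Finset.range deg, s.mem (3, off + p)) := by
  obtain ⟨k, hk⟩ : ∃ k, min K (deg + 1) = k := ⟨_, rfl⟩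
  obtain ⟨c, hc⟩ : ∃ c, deg / k + 1 = c := ⟨_, rfl⟩
  have hk0 : 0 < k := by omega
  have hck : c * k ≤ deg + k := by
    have := Nat.div_mul_le_self deg k
    rw [← hc, Nat.succ_mul]
    omega
  have hck' : deg ≤ c * k := by
    rw [← hc, Nat.succ_mul, mul_comm]
    have := Nat.div_add_mod deg k
    have := Nat.mod_lt deg hk0
    omega
  have hcd : c ≤ deg + 1 := by
    rw [← hc]
    exact Nat.succ_le_succ (Nat.div_le_self _ _)
  have hckc : c ≤ c * k := Nat.le_mul_of_pos_right c hk0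
  have hsub : cntCells (2 * off + v) (c * k) ⊆ cntCells (2 * off + v) (2 * deg + 1) :=
    cntCells_subset le_rfl (by omega)
  have o1 : 1 % 2 ^ W = 1 := Nat.mod_eq_of_lt (by omega)
  have o2 : 2 % 2 ^ W = 2 := Nat.mod_eq_of_lt (by omega)
  have e1 : (deg + 1) % 2 ^ W = deg + 1 := Nat.mod_eq_of_lt (by omega)
  have e2 : (2 * off) % 2 ^ W = 2 * off := Nat.mod_eq_of_lt (by omega)
  have e3 : (2 * off + v) % 2 ^ W = 2 * off + v := Nat.mod_eq_of_lt (by omega)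
  have e4 : (deg / k + 1) % 2 ^ W = c := by
    rw [hc]
    exact Nat.mod_eq_of_lt (by omega)
  have hc0 : 0 < c := hc ▸ Nat.succ_pos _
  have hclog : Nat.clog 2 c ≤ Nat.clog 2 (deg + 1) := Nat.clog_mono_right 2 hcd
  have hkK : k ≤ K := by omega
  have hckt : c * (k * 68 + 7) = 68 * (c * k) + 7 * c := by ring
  have hckt' : (c - 1) * k ≤ c * k := Nat.mul_le_mul_right _ (by omega)
  refine Tr.seq (R₁ := ∅) (X₁ := ∅) (t₁ := 30) (d₁ := 30)
    (t₂ := (c * k * 11 + 4) + ((c * (k * 68 + 7) + 2) + ((60 * ((c - 1) * k) + 4) +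
      (2 + (k * 48 + 6)))))
    (d₂ := 14 + ((k * 68 + 8) + ((60 * Nat.clog 2 c + 4) + (2 + (k * 48 + 6)))))
    (Q₁ := fun s' => s'.mem = s.mem ∧ s'.reg 9 = off ∧ s'.reg 10 = deg ∧
      s'.reg 11 = k ∧ s'.reg 12 = c ∧ s'.reg 13 = 2 * off + v)
    (Tr.simple rfl (by decide) (by decide) ?_ ?_ ?_) ?_ (by omega) (by omega)
    (Set.empty_subset _) (Set.empty_subset _)
  · simp [pickInit, Cmd.rd]
  · simp [pickInit, Cmd.wr]
  · by_cases hK : K < deg + 1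
    · have hk' : k = K := by omega
      subst hk'
      simp [pickInit, Cmd.run, h2, h8, h9, h10, e1, e2, e3, e4, hK, o1, o2]
    · have hk' : k = deg + 1 := by omega
      rw [hk'] at e4
      simp [pickInit, Cmd.run, h2, h8, h9, h10, e1, e2, e3, e4, hK, o2, hk']
  rintro s₁ ⟨m1, r9, r10, r11, r12, r13⟩ -
  refine Tr.seq (clearCounters_tr r12 r11 r13 (by omega)) (fun s₂ q2 f2 => ?_) le_rfl le_rfl
    (Set.empty_subset _) hsub
  have hm2 : ∀ x : Cell, x.1 = 3 ∨ x.1 = 7 → s₂.mem x = s.mem x := fun x hx => by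
    rw [← m1]
    refine f2.1 x fun h => ?_
    have := h.1
    omega
  refine Tr.seq (countAll_tr (k := k) (c := c) (base := 2 * off + v) (off := off) (deg := deg)
    (s := s₂) ?_ ?_ ?_ ?_ ?_ (by omega) hk0 (by omega) (by omega) (by omega) ?_ q2)
    (fun s₃ q3 f3 => ?_) le_rfl le_rfl (Set.union_subset_union_right _ hsub) hsub
  · rw [f2.2 9 (by decide), r9]
  · rw [f2.2 10 (by decide), r10]
  · rw [f2.2 11 (by decide), r11]
  · rw [f2.2 13 (by decide), r13]
  · rw [f2.2 12 (by decide), r12]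
  · intro p hp
    rw [hm2 _ (Or.inl rfl)]
    exact hwt p hp
  have hwt_sum : ∀ y, bucketWt s.mem off deg y < 2 ^ W * 2 ^ W := fun y => by
    calc bucketWt s.mem off deg y ≤ ∑ _p ∈ Finset.range deg, 2 ^ W := by
          refine Finset.sum_le_sum fun p hp => ?_
          have := hwt p (Finset.mem_range.1 hp)
          split_ifs <;> omega
      _ = deg * 2 ^ W := by simp
      _ < 2 ^ W * 2 ^ W := Nat.mul_lt_mul_of_pos_right (by omega) (by omega)
  refine Tr.seq (foldLoop_tr (W := W) (base := 2 * off + v) (k := k) (B := bucketWt s.mem off deg)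
    hk0 (by omega) (fun y _ => hwt_sum y) c s₃ hc0 ?_ ?_ ?_ (by omega) (by omega) q3.1 ?_)
    (fun s₄ q4 f4 => ?_) le_rfl le_rfl (hsub.trans Set.subset_union_right) hsub
  · rw [f3.2 11 (by decide), f2.2 11 (by decide), r11]
  · rw [f3.2 13 (by decide), f2.2 13 (by decide), r13]
  · rw [f3.2 12 (by decide), f2.2 12 (by decide), r12]
  · intro y hy
    rw [← sum_entryWt s.mem off deg y hck', ← sum_range_chunks]
    refine Finset.sum_congr rfl fun i hi => ?_
    rw [q3.2 i (Finset.mem_range.1 hi) y hy]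
    exact Finset.sum_congr rfl fun j _ => entryWt_congr hm2 _ _ _ _
  refine Tr.seq (R₁ := ∅) (X₁ := ∅) (t₁ := 2) (d₁ := 2)
    (Q₁ := fun s' => s'.mem = s₄.mem ∧ s'.reg 14 = 0)
    (Tr.simple rfl (by decide) (by decide) ?_ ?_ ?_) (fun s₅ q5 f5 => ?_) le_rfl le_rfl
    (Set.empty_subset _) (Set.empty_subset _)
  · simp [Cmd.rd]
  · simp [Cmd.wr]
  · simp [Cmd.run]
  refine (minLoop_tr (s := s₅) (base := 2 * off + v) (B := bucketWt s.mem off deg) hk0 (by omega)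
    ?_ ?_ q5.2 ?_).mono le_rfl le_rfl ?_ (Set.empty_subset _) ?_
  · rw [f5.2 11 (by decide), f4.2 11 (by decide), f3.2 11 (by decide), f2.2 11 (by decide), r11]
  · rw [f5.2 13 (by decide), f4.2 13 (by decide), f3.2 13 (by decide), f2.2 13 (by decide), r13]
  · intro y hy
    rw [q5.1]
    exact q4 y hy
  · exact (cntCells_subset le_rfl (by omega)).trans Set.subset_union_right
  · rintro s₆ ⟨q6, q6'⟩ -
    exact ⟨by omega, mul_bucketWt_le (hk ▸ q6')⟩

/-! ## Adjacency lists in consecutive memory -/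

/-- Concatenated adjacency lists of a graph on `0, …, n - 1`: the list of `v` occupies the positions
from `st v` to `st (v + 1)`, and `nb p` and `wt p` are the neighbor and the weight at position `p`. -/
structure AdjData (n : ℕ) (st nb wt : ℕ → ℕ) : Prop where
  zero : st 0 = 0
  step : ∀ v < n, st v ≤ st (v + 1)
  nb_lt : ∀ p < st n, nb p < n

/-- The memory contains the adjacency lists. -/
structure Stored (n : ℕ) (st nb wt : ℕ → ℕ) (mem : Cell → ℕ) : Prop where
  start : ∀ v ≤ n, mem (1, v) = st v
  neighbor : ∀ p < st n, mem (2, p) = nb p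
  weight : ∀ p < st n, mem (3, p) = wt p

lemma Stored.congr {n : ℕ} {st nb wt : ℕ → ℕ} {mem mem' : Cell → ℕ} (h : Stored n st nb wt mem)
    (hm : ∀ x : Cell, x.1 = 1 ∨ x.1 = 2 ∨ x.1 = 3 → mem' x = mem x) : Stored n st nb wt mem' where
  start v hv := by rw [hm _ (by simp), h.start v hv]
  neighbor v hv := by rw [hm _ (by simp), h.neighbor v hv]
  weight v hv := by rw [hm _ (by simp), h.weight v hv]

/-- The total weight of the entries `u` of the adjacency list of `v` with `P u`. -/
def adjSum (st nb wt : ℕ → ℕ) (v : ℕ) (P : ℕ → Prop) [DecidablePred P] : ℕ :=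
  ∑ p ∈ Finset.range (st (v + 1) - st v), if P (nb (st v + p)) then wt (st v + p) else 0

/-- The total weight of the adjacency list of `v`. -/
def wdeg (st wt : ℕ → ℕ) (v : ℕ) : ℕ := ∑ p ∈ Finset.range (st (v + 1) - st v), wt (st v + p)

/-- Twice the weight of the monochromatic edges. -/
def dmono (n : ℕ) (st nb wt c : ℕ → ℕ) : ℕ :=
  ∑ v ∈ Finset.range n, adjSum st nb wt v fun u => c u = c v

/-- Twice the total weight. -/
def dtotal (n : ℕ) (st wt : ℕ → ℕ) : ℕ := ∑ v ∈ Finset.range n, wdeg st wt v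

/-- The scratch cells of vertex `v`. -/
def own (st : ℕ → ℕ) (v : ℕ) : Set Cell :=
  keyCells (st v) (st (v + 1) - st v) ∪
    cntCells (2 * st v + v) (2 * (st (v + 1) - st v) + 1)

namespace AdjData

variable {n : ℕ} {st nb wt : ℕ → ℕ}

lemma mono (h : AdjData n st nb wt) {v w : ℕ} (hvw : v ≤ w) (hw : w ≤ n) : st v ≤ st w := by
  induction w, hvw using Nat.le_induction with
  | base => exact le_rfl
  | succ w _ ih => exact (ih (by omega)).trans (h.step w (by omega))

lemma sum_deg (h : AdjData n st nb wt) {m : ℕ} (hm : m ≤ n) :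
    ∑ v ∈ Finset.range m, (st (v + 1) - st v) = st m := by
  induction m with
  | zero => simp [h.zero]
  | succ m ih =>
    have := h.step m (by omega)
    rw [Finset.sum_range_succ, ih (by omega)]
    omega

/-- The lists tile the positions of the keys. Granting `2 * deg + 1` counters to each vertex makes
`2 * st v + v` the corresponding starting position, so these intervals do not overlap either. -/
lemma own_disjoint (h : AdjData n st nb wt) {v w : ℕ} (hv : v < n) (hw : w < n) (hne : v ≠ w)
    {x : Cell}
    (hx : x ∈ own st v) : x ∉ own st w := by
  obtain ⟨a, q⟩ := x
  simp only [own, Set.mem_union, mem_keyCells, mem_cntCells] at hx ⊢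
  have h1 := h.step v hv
  have h2 := h.step w hw
  rcases Nat.lt_or_gt_of_ne hne with hlt | hlt
  · have := h.mono (show v + 1 ≤ w by omega) (by omega)
    omega
  · have := h.mono (show w + 1 ≤ v by omega) (by omega)
    omega

end AdjData

lemma own_arr {st : ℕ → ℕ} {v : ℕ} {x : Cell} (hx : x ∈ own st v) :
    x.1 = 7 ∨ x.1 = 8 ∨ x.1 = 9 := by
  obtain ⟨a, q⟩ := x
  simp only [own, Set.mem_union, mem_keyCells, mem_cntCells] at hx
  dsimp only
  omega

/-- Load the starting position and the length of the adjacency list of the vertex in register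
`8`. -/
def loadVertex : Cmd :=
  .set 9 (.arr 1 (.rg 8)) ;; .set 10 (.arr 1 (.rg 8 + .cst 1) - .rg 9)

lemma loadVertex_tr {W v n : ℕ} {st nb wt : ℕ → ℕ} {s : State} (hs : Stored n st nb wt s.mem)
    (h8 : s.reg 8 = v) (hv : v < n) (hW : n + 1 < 2 ^ W) :
    Tr W loadVertex s 10 10 {x | x.1 = 1} ∅ (fun s' => s'.mem = s.mem ∧ s'.reg 9 = st v ∧
      s'.reg 10 = st (v + 1) - st v) := by
  have o1 : 1 % 2 ^ W = 1 := Nat.mod_eq_of_lt (by omega)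
  have e1 : (v + 1) % 2 ^ W = v + 1 := Nat.mod_eq_of_lt (by omega)
  refine Tr.simple rfl (by decide) (by decide) ?_ ?_ ?_
  · simp [loadVertex, Cmd.rd, Cmd.run, h8, o1, e1, Set.insert_subset_iff]
  · simp [loadVertex, Cmd.wr]
  · simp [loadVertex, Cmd.run, h8, o1, e1, hs.start v hv.le, hs.start (v + 1) hv]

/-! ## Reducing the number of classes -/

/-- The point at which the linear functions belonging to two classes agree. -/
def meet (S c c' : ℕ) : ℕ :=
  (c % S - c' % S) / (c' / S - c / S) + (c' % S - c % S) / (c / S - c' / S)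

/-- Different classes with equal slopes have different intercepts and never meet. With different
slopes, truncated subtraction makes one divisor in `meet` zero, so that summand vanishes, and the
other is an exact quotient. Nothing is claimed about `meet` when the functions have no common point
among the naturals; a spurious value there only adds weight to some bucket. -/
lemma meet_eq {S c c' x : ℕ} (hne : c ≠ c') (h : c % S + c / S * x = c' % S + c' / S * x) :
    meet S c c' = x := by
  have h1 := Nat.div_add_mod c S
  have h2 := Nat.div_add_mod c' S
  rw [meet]
  rcases lt_trichotomy (c / S) (c' / S) with hlt | heq | hlt
  · obtain ⟨d, hd⟩ := Nat.exists_eq_add_of_lt hlt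
    rw [hd] at h ⊢
    have h3 : c % S = c' % S + (d + 1) * x := by
      have : (c / S + d + 1) * x = c / S * x + (d + 1) * x := by ring
      omega
    rw [h3, show c' % S + (d + 1) * x - c' % S = (d + 1) * x by omega,
      show c / S + d + 1 - c / S = d + 1 by omega, Nat.mul_div_cancel_left _ (by omega),
      show c / S - (c / S + d + 1) = 0 by omega, Nat.div_zero, add_zero]
  · refine absurd ?_ hne
    rw [heq] at h h1
    rw [← h1, ← h2]
    omega
  · obtain ⟨d, hd⟩ := Nat.exists_eq_add_of_lt hlt
    rw [hd] at h ⊢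
    have h3 : c' % S = c % S + (d + 1) * x := by
      have : (c' / S + d + 1) * x = c' / S * x + (d + 1) * x := by ring
      omega
    rw [h3, show c % S + (d + 1) * x - c % S = (d + 1) * x by omega,
      show c' / S + d + 1 - c' / S = d + 1 by omega, Nat.mul_div_cancel_left _ (by omega),
      show c' / S - (c' / S + d + 1) = 0 by omega, Nat.div_zero, zero_add]

/-- Write the keys of the neighbors: the points where the linear functions meet. -/
def meetKeys : Cmd :=
  .par 16 (.rg 10)
    (.set 17 (.arr 5 (.arr 2 (.rg 9 + .rg 16))) ;;
      .store 7 (.rg 9 + .rg 16)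
        ((.rg 25 - .rg 17 % .rg 4) / (.rg 17 / .rg 4 - .rg 26) +
          (.rg 17 % .rg 4 - .rg 25) / (.rg 26 - .rg 17 / .rg 4)))

lemma meetKeys_tr {W off deg S c : ℕ} {s : State} (h9 : s.reg 9 = off) (h10 : s.reg 10 = deg)
    (h4 : s.reg 4 = S) (h25 : s.reg 25 = c % S) (h26 : s.reg 26 = c / S) (hS : 0 < S)
    (hW : off + deg < 2 ^ W) (hSW : 2 * S < 2 ^ W) :
    Tr W meetKeys s (deg * 40 + 2) 37 ({x | x.1 = 2 ∨ x.1 = 5} ∪ keyCells off deg)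
      (keyCells off deg) (fun s' =>
        ∀ p < deg, s'.mem (7, off + p) = meet S c (s.mem (5, s.mem (2, off + p)))) := by
  refine Tr.par (k := deg) (τ := fun _ => 35) (d₁ := 35)
    (R' := fun i => {x | x.1 = 2 ∨ x.1 = 5}) (X' := fun i => keyCells (off + i) 1)
    (P := fun p s' => s'.mem (7, off + p) = meet S c (s.mem (5, s.mem (2, off + p))))
    (by simp [h10]) ?_ ?_ ?_ ?_ ?_ ?_ ?_ ?_
  · intro i hi
    have e1 : (off + i) % 2 ^ W = off + i := Nat.mod_eq_of_lt (by omega)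
    refine Tr.simple rfl (by decide) (by decide) ?_ ?_ ?_
    · simp [Cmd.rd, Cmd.run, State.branch, h9, e1, Set.insert_subset_iff]
    · simp [Cmd.wr, Cmd.run, State.branch, h9, e1, mem_keyCells]
    · simp only [Cmd.run, State.branch]
      simp only [Expr.eval_add, Expr.eval_rg, Expr.eval_arr, Expr.eval_div, Expr.eval_mod,
        Expr.eval_sub]
      simp [h9, h4, h25, h26, e1]
      -- Both quotients are below `S`, so their sum stays below `2 * S` and does not wrap.
      rw [meet, Nat.mod_eq_of_lt]
      have h1 := Nat.div_le_self (c % S - s.mem (5, s.mem (2, off + i)) % S)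
        (s.mem (5, s.mem (2, off + i)) / S - c / S)
      have h2 := Nat.div_le_self (s.mem (5, s.mem (2, off + i)) % S - c % S)
        (c / S - s.mem (5, s.mem (2, off + i)) / S)
      have h3 := Nat.mod_lt c hS
      have h4 := Nat.mod_lt (s.mem (5, s.mem (2, off + i))) hS
      omega
  · rintro i _ j _ hne ⟨a, q⟩ hx
    simp only [mem_keyCells, Set.mem_ofPred_eq] at hx ⊢
    omega
  · simp; omega
  · simp
  · simp
  · exact fun i hi => Set.subset_union_left
  · rintro i hi ⟨a, q⟩ hx
    rw [mem_keyCells] at hx ⊢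
    omega
  · intro mem' h1 _ p hp
    obtain ⟨s', h2, -, h3⟩ := h1 p hp
    dsimp only
    rw [h3 _ (by rw [mem_keyCells]; omega), h2]

/-- Load the two coefficients of the linear function that belongs to the class of the vertex. -/
def loadClass : Cmd :=
  .set 24 (.arr 5 (.rg 8)) ;; .set 25 (.rg 24 % .rg 4) ;; .set 26 (.rg 24 / .rg 4)

/-- Compute the new class of a vertex. -/
def refineVertex : Cmd :=
  loadVertex ;; loadClass ;; meetKeys ;; pick ;;
  .store 6 (.rg 8) (.rg 14 + .rg 2 * (.rg 25 + .rg 26 * .rg 14))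

/-- `c'` is a new class of `v` if the classes so far are given by `c`. -/
def Refines (st nb wt : ℕ → ℕ) (K S : ℕ) (c : ℕ → ℕ) (v c' : ℕ) : Prop :=
  ∃ x < K, c' = x + K * (c v % S + c v / S * x) ∧
    K * adjSum st nb wt v (fun u => meet S (c v) (c u) = x) ≤ wdeg st wt v

/-- With the meeting points as keys, a light bucket `x` is exactly what `Refines` asks for. The
bound `c v < S * S` makes the slope smaller than `S`, so the new class stays below `K * K * S` and
none of the intermediate values wraps. -/
lemma refineVertex_tr {W n K S v : ℕ} {st nb wt c : ℕ → ℕ} {s : State}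
    (hA : AdjData n st nb wt) (hs : Stored n st nb wt s.mem)
    (hwt : ∀ p < st n, wt p < 2 ^ W) (hW : 2 * st n + n + 4 < 2 ^ W)
    (hS : 0 < S) (hSW : 2 * S < 2 ^ W) (hK : 0 < K) (hKSW : K * K * S < 2 ^ W)
    (h2 : s.reg 2 = K) (h4 : s.reg 4 = S) (h8 : s.reg 8 = v) (hv : v < n)
    (hc : ∀ v < n, s.mem (5, v) = c v) (hcS : c v < S * S) :
    Tr W refineVertex s (500 * (st (v + 1) - st v + 1))
      (200 * K + 60 * Nat.clog 2 (st n + 1) + 200)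
      ({x | x.1 = 1 ∨ x.1 = 2 ∨ x.1 = 3 ∨ x.1 = 5} ∪ own st v) (own st v ∪ {(6, v)})
      (fun s' => Refines st nb wt K S c v (s'.mem (6, v))) := by
  obtain ⟨deg, hdeg⟩ : ∃ deg, st (v + 1) - st v = deg := ⟨_, rfl⟩
  have hst : st v + deg = st (v + 1) := by
    have := hA.step v hv
    omega
  have hstn : st (v + 1) ≤ st n := hA.mono hv le_rfl
  have hown : own st v = keyCells (st v) deg ∪ cntCells (2 * st v + v) (2 * deg + 1) := by
    rw [own, hdeg]
  have hclog : Nat.clog 2 (deg + 1) ≤ Nat.clog 2 (st n + 1) := Nat.clog_mono_right 2 (by omega)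
  have hm2 : ∀ p < deg, s.mem (2, st v + p) = nb (st v + p) :=
    fun p hp => hs.neighbor _ (by omega)
  have hm3 : ∀ p < deg, s.mem (3, st v + p) = wt (st v + p) := fun p hp => hs.weight _ (by omega)
  rw [hdeg, hown]
  refine Tr.bind (loadVertex_tr hs h8 hv (by omega))
    (t₂ := 12 + ((deg * 40 + 2) + (400 * (deg + 1) + 12)))
    (d₂ := 12 + (37 + ((200 * K + 60 * Nat.clog 2 (deg + 1) + 100) + 12)))
    (by omega) (by omega) ?_ (Set.empty_subset _) (fun s₁ q1 f1 => ?_)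
  · rintro x hx
    exact Or.inl (Or.inl hx)
  obtain ⟨m1, r9, r10⟩ := q1
  rw [hdeg] at r10
  refine Tr.bind (t₁ := 12) (d₁ := 12) (R₁ := {x | x.1 = 5}) (X₁ := ∅)
    (Q₁ := fun s' => s'.mem = s.mem ∧ s'.reg 25 = c v % S ∧ s'.reg 26 = c v / S)
    (Tr.simple rfl (by decide) (by decide) ?_ ?_ ?_) le_rfl le_rfl ?_
    (Set.empty_subset _) (fun s₂ q2 f2 => ?_)
  · simp [loadClass, Cmd.rd, Cmd.run]
  · simp [loadClass, Cmd.wr]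
  · simp [loadClass, Cmd.run, f1.2 8 (by decide), h8, f1.2 4 (by decide), h4, m1, hc v hv]
  · rintro x (hx : x.1 = 5)
    exact Or.inl (Or.inr (Or.inr (Or.inr hx)))
  obtain ⟨m2, r25, r26⟩ := q2
  refine Tr.bind (meetKeys_tr (s := s₂) (off := st v) (deg := deg) (S := S) (c := c v) ?_ ?_ ?_ r25
    r26 hS (by omega) hSW) le_rfl le_rfl ?_ ?_ (fun s₃ q3 f3 => ?_)
  · rw [f2.2 9 (by decide), r9]
  · rw [f2.2 10 (by decide), r10]
  · rw [f2.2 4 (by decide), f1.2 4 (by decide), h4]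
  · refine Set.union_subset_union ?_ Set.subset_union_left
    rintro x (hx | hx)
    · exact Or.inr (Or.inl hx)
    · exact Or.inr (Or.inr (Or.inr hx))
  · exact Set.subset_union_left.trans Set.subset_union_left
  have hm33 : ∀ p < deg, s₃.mem (3, st v + p) = wt (st v + p) := fun p hp => by
    rw [f3.1 _ (by rw [mem_keyCells]; omega), m2, hm3 p hp]
  have hkey : ∀ p < deg, s₃.mem (7, st v + p) = meet S (c v) (c (nb (st v + p))) := by
    intro p hp
    rw [q3 p hp, m2, hm2 p hp, hc _ (hA.nb_lt _ (by omega))]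
  refine Tr.bind (pick_tr (s := s₃) (v := v) (off := st v) (deg := deg) hK ?_ ?_ ?_ ?_ (by omega)
    ?_) le_rfl le_rfl ?_ ?_ (fun s₄ q4 f4 => ?_)
  · rw [f3.2 2 (by decide), f2.2 2 (by decide), f1.2 2 (by decide), h2]
  · rw [f3.2 8 (by decide), f2.2 8 (by decide), f1.2 8 (by decide), h8]
  · rw [f3.2 9 (by decide), f2.2 9 (by decide), r9]
  · rw [f3.2 10 (by decide), f2.2 10 (by decide), r10]
  · intro p hp
    rw [hm33 p hp]
    exact hwt _ (by omega)
  · rw [Set.union_assoc]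
    refine Set.union_subset_union_left _ ?_
    rintro x (hx : x.1 = 3)
    exact Or.inr (Or.inr (Or.inl hx))
  · exact Set.subset_union_right.trans Set.subset_union_left
  obtain ⟨hx, hle⟩ := q4
  set x := s₄.reg 14 with hxdef
  have hb : c v / S < S := Nat.div_lt_of_lt_mul hcS
  have ha : c v % S < S := Nat.mod_lt _ hS
  have hbx : c v % S + c v / S * x ≤ (S - 1) * K := by
    have : c v / S * x ≤ (S - 1) * (K - 1) := Nat.mul_le_mul (by omega) (by omega)
    have h' : (S - 1) * K = (S - 1) * (K - 1) + (S - 1) := by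
      conv_lhs => rw [show K = K - 1 + 1 by omega]
      ring
    omega
  have hbig : x + K * (c v % S + c v / S * x) < K * K * S := by
    have h1 : K * (c v % S + c v / S * x) ≤ K * ((S - 1) * K) := Nat.mul_le_mul_left _ hbx
    have h2 : K * K * S = K * ((S - 1) * K) + K * K := by
      conv_lhs => rw [show S = S - 1 + 1 by omega]
      ring
    have h3 : K ≤ K * K := Nat.le_mul_of_pos_left _ hK
    omega
  have hle' : c v % S + c v / S * x ≤ K * (c v % S + c v / S * x) := Nat.le_mul_of_pos_left _ hK
  have e1 : (c v / S * x) % 2 ^ W = c v / S * x := Nat.mod_eq_of_lt (by omega)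
  have e2 : (c v % S + c v / S * x) % 2 ^ W = c v % S + c v / S * x := Nat.mod_eq_of_lt (by omega)
  have e3 : (K * (c v % S + c v / S * x)) % 2 ^ W = K * (c v % S + c v / S * x) :=
    Nat.mod_eq_of_lt (by omega)
  have e4 : (x + K * (c v % S + c v / S * x)) % 2 ^ W = x + K * (c v % S + c v / S * x) :=
    Nat.mod_eq_of_lt (by omega)
  have r2 : s₄.reg 2 = K := by
    rw [f4.2 2 (by decide), f3.2 2 (by decide), f2.2 2 (by decide), f1.2 2 (by decide), h2]
  have r8 : s₄.reg 8 = v := by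
    rw [f4.2 8 (by decide), f3.2 8 (by decide), f2.2 8 (by decide), f1.2 8 (by decide), h8]
  have r25 : s₄.reg 25 = c v % S := by rw [f4.2 25 (by decide), f3.2 25 (by decide), r25]
  have r26 : s₄.reg 26 = c v / S := by rw [f4.2 26 (by decide), f3.2 26 (by decide), r26]
  refine Tr.simple rfl (by decide +revert) (by decide +revert) ?_ ?_ ?_
  · simp [Cmd.rd]
  · simp [Cmd.wr, r8]
  · refine ⟨x, hx, ?_, ?_⟩
    · simp [Cmd.run, r2, r8, r25, r26, ← hxdef, e1, e2, e3, e4]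
    · rw [wdeg, hdeg, ← Finset.sum_congr rfl fun p hp => hm33 p (Finset.mem_range.1 hp)]
      convert hle using 2
      rw [adjSum, bucketWt, hdeg]
      refine Finset.sum_congr rfl fun p hp => ?_
      rw [hkey p (Finset.mem_range.1 hp), hm33 p (Finset.mem_range.1 hp)]

/-- For `x < K` the function value is at most (S - 1) + (S - 1)(K - 1) = (S - 1)K, so the encoded
pair is less than K + K(S - 1)K ≤ K²S. -/
lemma Refines.lt {st nb wt c : ℕ → ℕ} {K S v c' : ℕ} (h : Refines st nb wt K S c v c')
    (hS : 0 < S) (hcS : c v < S * S) : c' < K * K * S := by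
  obtain ⟨x, hx, rfl, -⟩ := h
  have hb : c v / S < S := Nat.div_lt_of_lt_mul hcS
  have ha : c v % S < S := Nat.mod_lt _ hS
  have hbx : c v % S + c v / S * x ≤ (S - 1) * K := by
    have : c v / S * x ≤ (S - 1) * (K - 1) := Nat.mul_le_mul (by omega) (by omega)
    have h' : (S - 1) * K = (S - 1) * (K - 1) + (S - 1) := by
      conv_lhs => rw [show K = K - 1 + 1 by omega]
      ring
    omega
  have h1 : K * (c v % S + c v / S * x) ≤ K * ((S - 1) * K) := Nat.mul_le_mul_left _ hbx
  have h2 : K * K * S = K * ((S - 1) * K) + K * K := by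
    conv_lhs => rw [show S = S - 1 + 1 by omega]
    ring
  have h3 : K ≤ K * K := Nat.le_mul_of_pos_left _ (by omega)
  omega

/-- An entry that was monochromatic before is paid for by the old term. If it becomes monochromatic,
both ends chose the same `x` and their functions agree there, so the entry lies in the bucket of
weight at most `wdeg / K` that `v` selected. -/
lemma refine_dmono {n K S : ℕ} {st nb wt c c' : ℕ → ℕ} (hA : AdjData n st nb wt)
    (h : ∀ v < n, Refines st nb wt K S c v (c' v)) :
    K * dmono n st nb wt c' ≤ K * dmono n st nb wt c + dtotal n st wt := by
  rw [dmono, dmono, dtotal, Finset.mul_sum, Finset.mul_sum, ← Finset.sum_add_distrib]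
  refine Finset.sum_le_sum fun v hv => ?_
  rw [Finset.mem_range] at hv
  obtain ⟨x, hx, hcv, hle⟩ := h v hv
  refine le_trans ?_ (Nat.add_le_add_left hle _)
  rw [← mul_add]
  refine Nat.mul_le_mul_left _ ?_
  rw [adjSum, adjSum, adjSum, ← Finset.sum_add_distrib]
  refine Finset.sum_le_sum fun p hp => ?_
  have hst : st v + p < st n := by
    have := hA.mono (show v + 1 ≤ n by omega) le_rfl
    rw [Finset.mem_range] at hp
    omega
  obtain ⟨x', hx', hcu, -⟩ := h _ (hA.nb_lt _ hst)
  by_cases he : c' (nb (st v + p)) = c' v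
  swap
  · rw [if_neg he]
    exact Nat.zero_le _
  by_cases hc : c (nb (st v + p)) = c v
  · rw [if_pos he, if_pos hc]
    exact Nat.le_add_right _ _
  · rw [if_pos he, if_neg hc, if_pos, zero_add]
    rw [hcu, hcv] at he
    -- The new class modulo `K` recovers the chosen point; the quotient then recovers the function
    -- value.
    have hxx : x' = x := by
      have := congrArg (· % K) he
      simpa [Nat.add_mul_mod_self_left, Nat.mod_eq_of_lt hx, Nat.mod_eq_of_lt hx'] using this
    subst hxx
    refine meet_eq (Ne.symm hc) ?_
    exact (Nat.eq_of_mul_eq_mul_left (by omega) (Nat.add_left_cancel he)).symm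

/-- Compute new classes of all vertices. -/
def refineAll : Cmd :=
  .par 8 (.rg 0) refineVertex ;; .par 8 (.rg 0) (.store 5 (.rg 8) (.arr 6 (.rg 8)))

/-- All vertices read the old classes of their neighbors from array `5`. The new ones therefore go
to array `6` and are copied back only after all branches have finished. -/
lemma refineAll_tr {W n K S : ℕ} {st nb wt c : ℕ → ℕ} {s : State}
    (hA : AdjData n st nb wt) (hs : Stored n st nb wt s.mem)
    (hwt : ∀ p < st n, wt p < 2 ^ W) (hW : 2 * st n + n + 4 < 2 ^ W)
    (hS : 0 < S) (hSW : 2 * S < 2 ^ W) (hK : 0 < K) (hKSW : K * K * S < 2 ^ W)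
    (h0 : s.reg 0 = n) (h2 : s.reg 2 = K) (h4 : s.reg 4 = S)
    (hc : ∀ v < n, s.mem (5, v) = c v) (hcS : ∀ v < n, c v < S * S) :
    Tr W refineAll s (500 * st n + 510 * n + 4) (200 * K + 60 * Nat.clog 2 (st n + 1) + 210)
      Set.univ {x | 5 ≤ x.1 ∧ x.1 ≤ 9}
      (fun s' => ∀ v < n, Refines st nb wt K S c v (s'.mem (5, v))) := by
  refine Tr.bind (t₁ := 500 * st n + 501 * n + 2)
    (d₁ := 2 + (200 * K + 60 * Nat.clog 2 (st n + 1) + 200)) (t₂ := 5 * n + 2) (d₂ := 6)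
    (R₁ := Set.univ) (X₁ := {x | 6 ≤ x.1 ∧ x.1 ≤ 9})
    (Q₁ := fun s' => ∀ v < n, Refines st nb wt K S c v (s'.mem (6, v)))
    (Tr.par (k := n) (τ := fun v => 500 * (st (v + 1) - st v + 1))
      (d₁ := 200 * K + 60 * Nat.clog 2 (st n + 1) + 200)
      (R' := fun v => {x | x.1 = 1 ∨ x.1 = 2 ∨ x.1 = 3 ∨ x.1 = 5} ∪ own st v)
      (X' := fun v => own st v ∪ {(6, v)})
      (P := fun v s' => Refines st nb wt K S c v (s'.mem (6, v)))
      (by simp [h0]) ?_ ?_ ?_ ?_ ?_ ?_ ?_ ?_)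
    (by omega) (by omega) subset_rfl ?_ ?_
  · intro v hv
    refine refineVertex_tr (s := s.branch 8 v) hA hs hwt hW hS hSW hK hKSW ?_ ?_ ?_ hv hc
      (hcS v hv)
    · simpa [State.branch] using h2
    · simpa [State.branch] using h4
    · simp [State.branch]
  · rintro v hv w hw hne ⟨a, q⟩ (hx | hx)
    · have h1 := hA.own_disjoint hw hv hne.symm hx
      have h2 := own_arr hx
      simp only [Set.mem_union, Set.mem_ofPred_eq, h1, or_false, Set.mem_singleton_iff,
        Prod.mk.injEq, false_or] at h2 ⊢
      omega
    · obtain ⟨rfl, rfl⟩ := Prod.mk.inj hx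
      have h1 : ((6, q) : Cell) ∉ own st v := fun h => by have := own_arr h; omega
      simp only [Set.mem_union, Set.mem_ofPred_eq, h1, or_false, Set.mem_singleton_iff,
        Prod.mk.injEq, false_or]
      omega
  · rw [Finset.sum_add_distrib, ← Finset.mul_sum, Finset.sum_add_distrib, hA.sum_deg le_rfl]
    simp
    omega
  · simp
  · simp
  · exact fun _ _ => Set.subset_univ _
  · rintro v hv ⟨a, q⟩ (hx | hx)
    · have h2 := own_arr hx
      simp only [Set.mem_ofPred_eq] at h2 ⊢
      omega
    · obtain ⟨rfl, rfl⟩ := Prod.mk.inj hx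
      simp
  · intro mem' h1 _ v hv
    obtain ⟨s', h2, -, h3⟩ := h1 v hv
    rw [← h3 _ (Or.inr rfl)] at h2
    exact h2
  · rintro ⟨a, q⟩ hx
    simp only [Set.mem_ofPred_eq] at hx ⊢
    omega
  intro s₁ q1 f1
  have r0 : s₁.reg 0 = n := by rw [f1.2 0 (by decide), h0]
  refine Tr.par (k := n) (τ := fun _ => 4) (d₁ := 4) (R' := fun v => {(6, v)})
    (X' := fun v => {(5, v)}) (P := fun v s' => s'.mem (5, v) = s₁.mem (6, v))
    (by simp [r0]) ?_ ?_ ?_ ?_ ?_ ?_ ?_ ?_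
  · intro v hv
    refine Tr.simple rfl (by decide) (by decide) ?_ ?_ ?_
    · simp [Cmd.rd, State.branch]
    · simp [Cmd.wr, State.branch]
    · simp [Cmd.run, State.branch]
  · rintro v _ w _ hne ⟨a, q⟩ hx
    obtain ⟨rfl, rfl⟩ := Prod.mk.inj hx
    simp [hne.symm]
  · simp; omega
  · simp
  · simp
  · exact fun _ _ => Set.subset_univ _
  · intro v _
    simp
  · intro mem' h1 _ v hv
    obtain ⟨s', h2, -, h3⟩ := h1 v hv
    dsimp only
    rw [h3 _ rfl, h2]
    exact q1 v hv

/-- One round of the class reduction, with `u` in register `3`. -/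
def halve : Cmd :=
  .set 15 (.rg 3 / .cst 2) ;; .set 4 (.cst 2 * (.rg 2 * .rg 2)) ;;
  .upTo 17 15 (.set 4 (.cst 2 * .rg 4)) ;; refineAll ;; .set 3 (.rg 15)

/-- The class reduction. -/
def rounds : Cmd := .while (.rg 3) halve

/-- With h = ⌊u/2⌋ and S = 2K²·2^h, the old bound satisfies 2K⁴·2^u ≤ S², and the new one is K²S =
2K⁴·2^h, of the same form. -/
lemma halve_tr {W n K u : ℕ} {st nb wt c : ℕ → ℕ} {s : State}
    (hA : AdjData n st nb wt) (hs : Stored n st nb wt s.mem)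
    (hwt : ∀ p < st n, wt p < 2 ^ W) (hW : 2 * st n + n + 4 < 2 ^ W)
    (hK : 0 < K) (hu : 0 < u) (hKW : 2 * K ^ 4 * 2 ^ u < 2 ^ W)
    (h0 : s.reg 0 = n) (h2 : s.reg 2 = K) (h3 : s.reg 3 = u)
    (hc : ∀ v < n, s.mem (5, v) = c v) (hcS : ∀ v < n, c v < 2 * K ^ 4 * 2 ^ u) :
    Tr W halve s (500 * st n + 510 * n + 12 * u + 40)
      (200 * K + 60 * Nat.clog 2 (st n + 1) + 12 * u + 250)
      Set.univ {x | 5 ≤ x.1 ∧ x.1 ≤ 9}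
      (fun s' => s'.reg 3 = u / 2 ∧ (∀ v < n, s'.mem (5, v) < 2 * K ^ 4 * 2 ^ (u / 2)) ∧
        ∀ v < n, Refines st nb wt K (2 * (K * K) * 2 ^ (u / 2)) c v (s'.mem (5, v))) := by
  obtain ⟨h, hh⟩ : ∃ h, u / 2 = h := ⟨_, rfl⟩
  obtain ⟨S, hS⟩ : ∃ S, 2 * (K * K) * 2 ^ h = S := ⟨_, rfl⟩
  rw [hh, hS]
  have hKK : K * K * S = 2 * K ^ 4 * 2 ^ h := by rw [← hS]; ring
  have hK2 : 0 < K * K := Nat.mul_pos hK hK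
  have hpow : 2 * 2 ^ h ≤ 2 ^ u := by
    rw [← pow_succ']
    exact Nat.pow_le_pow_right (by omega) (by omega)
  have hpow' : 2 ^ u ≤ 2 * (2 ^ h * 2 ^ h) := by
    rw [← pow_add, ← pow_succ']
    exact Nat.pow_le_pow_right (by omega) (by omega)
  have hS0 : 0 < S := by rw [← hS]; positivity
  have hSW : 2 * S < 2 ^ W := by
    refine lt_of_le_of_lt ?_ hKW
    calc 2 * S = 2 * (K * K) * (2 * 2 ^ h) := by rw [← hS]; ring
      _ ≤ 2 * (K * K) * 2 ^ u := Nat.mul_le_mul_left _ hpow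
      _ ≤ 2 * (K * K) * 2 ^ u * (K * K) := Nat.le_mul_of_pos_right _ hK2
      _ = 2 * K ^ 4 * 2 ^ u := by ring
  have hKSW : K * K * S < 2 ^ W := by
    rw [hKK]
    refine lt_of_le_of_lt ?_ hKW
    exact Nat.mul_le_mul_left _ (by omega)
  -- The factor 2 in the bound is there for odd `u`, where `u = 2 * h + 1`.
  have hSS : 2 * K ^ 4 * 2 ^ u ≤ S * S := by
    calc 2 * K ^ 4 * 2 ^ u ≤ 2 * K ^ 4 * (2 * (2 ^ h * 2 ^ h)) := Nat.mul_le_mul_left _ hpow'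
      _ = S * S := by rw [← hS]; ring
  have hSle : ∀ i ≤ h, 2 * (K * K) * 2 ^ i ≤ S := fun i hi => by
    rw [← hS]
    exact Nat.mul_le_mul_left _ (Nat.pow_le_pow_right (by omega) hi)
  have h2K : 2 * (K * K) ≤ S := by simpa using hSle 0 (by omega)
  have o2 : 2 % 2 ^ W = 2 := Nat.mod_eq_of_lt (by omega)
  have e1 : K * K % 2 ^ W = K * K := Nat.mod_eq_of_lt (by omega)
  have e2 : 2 * (K * K) % 2 ^ W = 2 * (K * K) := Nat.mod_eq_of_lt (by omega)
  have huW : u < 2 ^ W := by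
    have h1 : u < 2 ^ u := Nat.lt_two_pow_self
    have h2 : 2 ^ u ≤ 2 * K ^ 4 * 2 ^ u := Nat.le_mul_of_pos_left _ (by positivity)
    omega
  refine Tr.bind (t₁ := 4) (d₁ := 4) (R₁ := ∅) (X₁ := ∅)
    (t₂ := 6 + ((h * 12 + 6) + ((500 * st n + 510 * n + 4) + 2)))
    (d₂ := 6 + ((h * 12 + 6) + ((200 * K + 60 * Nat.clog 2 (st n + 1) + 210) + 2)))
    (Q₁ := fun s' => s'.mem = s.mem ∧ s'.reg 15 = h)
    (Tr.simple rfl (by decide) (by decide) ?_ ?_ ?_) (by omega) (by omega)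
    (Set.empty_subset _) (Set.empty_subset _) (fun s₁ q1 f1 => ?_)
  · simp [Cmd.rd]
  · simp [Cmd.wr]
  · simp [Cmd.run, h3, o2, hh]
  refine Tr.bind (t₁ := 6) (d₁ := 6) (R₁ := ∅) (X₁ := ∅)
    (Q₁ := fun s' => s'.mem = s.mem ∧ s'.reg 4 = 2 * (K * K))
    (Tr.simple rfl (by decide) (by decide) ?_ ?_ ?_) le_rfl le_rfl
    (Set.empty_subset _) (Set.empty_subset _) (fun s₂ q2 f2 => ?_)
  · simp [Cmd.rd]
  · simp [Cmd.wr]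
  · simp [Cmd.run, f1.2 2 (by decide), h2, o2, e1, e2, q1.1]
  refine Tr.bind (R₁ := ∅) (X₁ := ∅) (t₁ := h * 12 + 6) (d₁ := h * 12 + 6)
    (Q₁ := fun s' => s'.reg 4 = S)
    (Tr.upTo (m := h) (t := 4) (d := 4) (fun i s' => s'.reg 4 = 2 * (K * K) * 2 ^ i)
      (by omega) ?_ (by decide) (by decide) (by decide) ?_ ?_ le_rfl le_rfl ?_)
    le_rfl le_rfl (Set.empty_subset _) (Set.empty_subset _) (fun s₃ q3 f3 => ?_)
  · rw [f2.2 15 (by decide), q1.2]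
  · simp [q2.2]
  · intro i hi s' hI _ _
    refine Tr.simple rfl (by decide) (by decide) ?_ ?_ ?_
    · simp [Cmd.rd]
    · simp [Cmd.wr]
    · have hp : 2 * (2 * (K * K) * 2 ^ i) = 2 * (K * K) * 2 ^ (i + 1) := by ring
      have hp' := hSle (i + 1) (by omega)
      simp only [Cmd.run, Expr.eval_mul, Expr.eval_cst, Expr.eval_rg, hI, o2, hp]
      simp
      exact Nat.mod_eq_of_lt (by omega)
  · intro s' hI _ _
    rw [hI, hS]
  have hm3 : s₃.mem = s.mem := by
    rw [← q2.1]
    exact funext fun x => f3.1 x (Set.notMem_empty _)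
  refine Tr.bind (refineAll_tr (s := s₃) (c := c) hA (hm3 ▸ hs) hwt hW hS0 hSW hK hKSW ?_ ?_ q3 ?_ ?_)
    le_rfl le_rfl subset_rfl subset_rfl (fun s₄ q4 f4 => ?_)
  · rw [f3.2 0 (by decide), f2.2 0 (by decide), f1.2 0 (by decide), h0]
  · rw [f3.2 2 (by decide), f2.2 2 (by decide), f1.2 2 (by decide), h2]
  · rw [hm3]
    exact hc
  · exact fun v hv => (hcS v hv).trans_le hSS
  refine Tr.simple rfl (by decide +revert) (by decide +revert) ?_ ?_ ?_
  · simp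
  · simp [Cmd.wr]
  · refine ⟨?_, fun v hv => ?_, q4⟩
    · simp [Cmd.run, f4.2 15 (by decide), f3.2 15 (by decide), f2.2 15 (by decide), q1.2]
    · rw [← hKK]
      exact (q4 v hv).lt hS0 ((hcS v hv).trans_le hSS)

/-- The potential `K * dmono + u * dtotal` never increases: a round adds at most one `dtotal` to the
first term, and `u` drops by at least one. This charges up to `u` losses although only `Nat.log 2 (2
* u)` rounds take place, which is affordable because `K` enters the depth but not the work. -/
lemma rounds_tr {W n K u₀ B : ℕ} {st nb wt : ℕ → ℕ}
    (hA : AdjData n st nb wt) (hwt : ∀ p < st n, wt p < 2 ^ W) (hW : 2 * st n + n + 4 < 2 ^ W)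
    (hK : 0 < K) (hKW : 2 * K ^ 4 * 2 ^ u₀ < 2 ^ W) (u : ℕ) : ∀ (c : ℕ → ℕ) (s : State),
    u ≤ u₀ → Stored n st nb wt s.mem → s.reg 0 = n → s.reg 2 = K → s.reg 3 = u →
    (∀ v < n, s.mem (5, v) = c v) → (∀ v < n, c v < 2 * K ^ 4 * 2 ^ u) →
    K * dmono n st nb wt c + u * dtotal n st wt ≤ B →
    Tr W rounds s (Nat.log 2 (2 * u) * (500 * st n + 510 * n + 12 * u₀ + 50) + 2)
      (Nat.log 2 (2 * u) * (200 * K + 60 * Nat.clog 2 (st n + 1) + 12 * u₀ + 260) + 2)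
      Set.univ {x | 5 ≤ x.1 ∧ x.1 ≤ 9}
      (fun s' => ∃ c', (∀ v < n, s'.mem (5, v) = c' v) ∧ (∀ v < n, c' v < 2 * K ^ 4) ∧
        K * dmono n st nb wt c' ≤ B) := by
  induction u using Nat.strong_induction_on with
  | _ u ih =>
  intro c s hu hs h0 h2 h3 hc hcS hB
  rcases Nat.eq_zero_or_pos u with rfl | hu0
  · refine Tr.while_done (by simp [h3]) (by simp) (by simp) (by simp) ⟨c, hc, ?_, ?_⟩
    · simpa using hcS
    · simpa using hB
  have hlog : Nat.log 2 (2 * u) = Nat.log 2 (2 * (u / 2)) + 1 := by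
    rw [mul_comm 2 u, Nat.log_mul_base (by omega) (by omega), mul_comm 2 (u / 2),
      Nat.log_div_mul_self]
  have hp : 2 * K ^ 4 * 2 ^ u < 2 ^ W :=
    lt_of_le_of_lt (Nat.mul_le_mul_left _ (Nat.pow_le_pow_right (by omega) hu)) hKW
  refine Tr.while_step (by simp [h3]; omega)
    (halve_tr hA hs hwt hW hK hu0 hp h0 h2 h3 hc hcS)
    (fun s' q f => ih (u / 2) (by omega) (fun v => s'.mem (5, v)) s' (by omega) ?_ ?_ ?_ q.1
      (fun v _ => rfl) q.2.1 ?_) ?_ ?_ (by simp) subset_rfl subset_rfl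
  · refine hs.congr fun x hx => f.1 x fun h => ?_
    have := h.1
    omega
  · rw [f.2 0 (by decide), h0]
  · rw [f.2 2 (by decide), h2]
  · have h1 := refine_dmono (c' := fun v => s'.mem (5, v)) hA q.2.2
    -- For `u > 0`, halving frees at least one `dtotal` to pay for the round.
    have h2 : (u / 2 + 1) * dtotal n st wt ≤ u * dtotal n st wt :=
      Nat.mul_le_mul_right _ (by omega)
    rw [add_mul, one_mul] at h2
    omega
  · rw [hlog, Nat.add_mul]
    simp
    omega
  · rw [hlog, Nat.add_mul]
    simp
    omega

/-! ## Linked lists of the vertices of a block and a class -/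

/-- From `v` on, the linked list `nxt` with end marker `n` runs through the elements of a set. -/
inductive Chain (nxt : ℕ → ℕ) (n : ℕ) : ℕ → Finset ℕ → Prop
  | nil : Chain nxt n n ∅
  | cons {v : ℕ} {S : Finset ℕ} : v < n → v ∉ S → Chain nxt n (nxt v) S →
      Chain nxt n v (insert v S)

lemma Chain.congr {nxt nxt' : ℕ → ℕ} {n v : ℕ} {S : Finset ℕ} (h : Chain nxt n v S) :
    (∀ u ∈ S, nxt' u = nxt u) → Chain nxt' n v S := by
  induction h with
  | nil => exact fun _ => .nil
  | cons hv hn _ ih =>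
    intro hS
    refine .cons hv hn ?_
    rw [hS _ (Finset.mem_insert_self _ _)]
    exact ih fun u hu => hS u (Finset.mem_insert_of_mem hu)

/-- The vertices of block `b` and class `j` among the first `i` vertices of the block. -/
def blockPart (n N : ℕ) (cls : ℕ → ℕ) (b j i : ℕ) : Finset ℕ :=
  (Finset.range n).filter fun v => cls v = j ∧ v / N = b ∧ v < b * N + i

/-- The vertices of block `b` and class `j`. -/
def block (n N : ℕ) (cls : ℕ → ℕ) (b j : ℕ) : Finset ℕ :=
  ((Finset.range n).filter fun v => cls v = j).filter fun v => v / N = b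

lemma mem_block {n N b j v : ℕ} {cls : ℕ → ℕ} :
    v ∈ block n N cls b j ↔ v < n ∧ cls v = j ∧ v / N = b := by
  simp [block, and_assoc]

lemma div_eq_iff_block {N b v : ℕ} (hN : 0 < N) :
    v / N = b ↔ b * N ≤ v ∧ v < b * N + N := by
  rw [Nat.div_eq_iff hN]
  have : 0 < b * N + N := by omega
  omega

lemma blockPart_eq {n N b j : ℕ} {cls : ℕ → ℕ} (hN : 0 < N) :
    blockPart n N cls b j N = block n N cls b j := by
  ext v
  rw [mem_block, blockPart, Finset.mem_filter, Finset.mem_range, div_eq_iff_block hN]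
  omega

/-- Insert the next vertex of the block into its list. -/
def listStep : Cmd :=
  .set 18 (.rg 7 * .rg 5 + .rg 17) ;;
  .ite (.less (.rg 18) (.rg 0))
    (.set 19 (.rg 7 * .rg 5 + .arr 5 (.rg 18)) ;; .store 11 (.rg 18) (.arr 10 (.rg 19)) ;;
      .store 10 (.rg 19) (.rg 18)) .skip

/-- Build the linked lists of a block. -/
def listBlock : Cmd :=
  .par 16 (.rg 5) (.store 10 (.rg 7 * .rg 5 + .rg 16) (.rg 0)) ;; .upTo 17 5 listStep

/-- Build the linked lists. -/
def buildLists : Cmd := .par 7 (.rg 0 / .rg 5 + .cst 1) listBlock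

/-- The cells of the linked lists of block `b`. -/
def listCells (N b : ℕ) : Set Cell :=
  {x | (x.1 = 10 ∨ x.1 = 11) ∧ b * N ≤ x.2 ∧ x.2 < b * N + N}

lemma mem_listCells {N b a q : ℕ} :
    (a, q) ∈ listCells N b ↔ (a = 10 ∨ a = 11) ∧ b * N ≤ q ∧ q < b * N + N := Iff.rfl

/-- The new vertex becomes the head of the list of its class. The list heads of a block fit into the
index range of the block itself because class numbers are below the block length `N`. -/
lemma listStep_tr {W n N b i : ℕ} {cls : ℕ → ℕ} {s : State} (hN : 0 < N) (hi : i < N)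
    (hW : b * N + N < 2 ^ W) (hW1 : 1 < 2 ^ W)
    (h0 : s.reg 0 = n) (h5 : s.reg 5 = N) (h7 : s.reg 7 = b)
    (h17 : s.reg 17 = i) (hcls : ∀ v < n, s.mem (5, v) = cls v) (hlt : ∀ v < n, cls v < N)
    (hch : ∀ j < N, Chain (fun v => s.mem (11, v)) n (s.mem (10, b * N + j))
      (blockPart n N cls b j i)) :
    Tr W listStep s 40 40 ({x | x.1 = 5} ∪ listCells N b) (listCells N b) (fun s' =>
      ∀ j < N, Chain (fun v => s'.mem (11, v)) n (s'.mem (10, b * N + j))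
        (blockPart n N cls b j (i + 1))) := by
  have o1 : 1 % 2 ^ W = 1 := Nat.mod_eq_of_lt hW1
  have e1 : b * N % 2 ^ W = b * N := Nat.mod_eq_of_lt (by omega)
  have e2 : (b * N + i) % 2 ^ W = b * N + i := Nat.mod_eq_of_lt (by omega)
  by_cases hv : b * N + i < n
  · obtain ⟨v, hvdef⟩ : ∃ v, b * N + i = v := ⟨_, rfl⟩
    have hcv := hlt v (by omega)
    have e3 : (b * N + cls v) % 2 ^ W = b * N + cls v := Nat.mod_eq_of_lt (by omega)
    rw [hvdef] at e2 hv
    have hc := hcls v hv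
    refine Tr.simple rfl (by decide) (by decide) ?_ ?_ ?_
    · simp [listStep, Cmd.rd, Cmd.run, h0, h5, h7, h17, e1, e2, e3, hv, hvdef, o1, hc,
        Set.insert_subset_iff, mem_listCells, hcv]
    · simp [listStep, Cmd.wr, Cmd.run, h0, h5, h7, h17, e1, e2, e3, hv, hvdef, o1, hc,
        Set.insert_subset_iff, mem_listCells, hcv]
      omega
    · intro j hj
      have hrun : (listStep.run W s).mem = Function.update (Function.update s.mem (11, v)
          (s.mem (10, b * N + cls v))) (10, b * N + cls v) v := by
        simp [listStep, Cmd.run, h0, h5, h7, h17, e1, e2, e3, hv, hvdef, o1, hc]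
      rw [hrun]
      have hnot : ∀ j', v ∉ blockPart n N cls b j' i := fun j' h => by
        have := (Finset.mem_filter.1 h).2.2.2
        omega
      have hold : Chain (fun u => Function.update (Function.update s.mem (11, v)
          (s.mem (10, b * N + cls v))) (10, b * N + cls v) v (11, u)) n (s.mem (10, b * N + j))
          (blockPart n N cls b j i) := by
        refine (hch j hj).congr fun u hu => ?_
        have : u ≠ v := fun h => hnot j (h ▸ hu)
        simp [this]
      have hvN : v / N = b := (div_eq_iff_block hN).2 (by omega)
      by_cases hjv : j = cls v
      · subst hjv
        have hins : blockPart n N cls b (cls v) (i + 1) =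
            insert v (blockPart n N cls b (cls v) i) := by
          ext u
          simp only [blockPart, Finset.mem_filter, Finset.mem_insert, Finset.mem_range]
          constructor
          · rintro ⟨h1, h2, h3, h4⟩
            by_cases huv : u = v
            · exact Or.inl huv
            · exact Or.inr ⟨h1, h2, h3, by omega⟩
          · rintro (rfl | ⟨h1, h2, h3, h4⟩)
            · exact ⟨hv, rfl, hvN, by omega⟩
            · exact ⟨h1, h2, h3, by omega⟩
        rw [hins, Function.update_self]
        refine .cons hv (hnot _) ?_
        simpa using hold
      · have hins : blockPart n N cls b j (i + 1) = blockPart n N cls b j i := by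
          ext u
          simp only [blockPart, Finset.mem_filter, Finset.mem_range]
          constructor
          · rintro ⟨h1, h2, h3, h4⟩
            have : u ≠ v := by rintro rfl; exact hjv h2.symm
            exact ⟨h1, h2, h3, by omega⟩
          · rintro ⟨h1, h2, h3, h4⟩
            exact ⟨h1, h2, h3, by omega⟩
        rw [hins]
        simpa [hjv] using hold
  · refine Tr.simple rfl (by decide) (by decide) ?_ ?_ ?_
    · simp [listStep, Cmd.rd, Cmd.run, h0, h5, h7, h17, e1, e2, hv]
    · simp [listStep, Cmd.wr, Cmd.run, h0, h5, h7, h17, e1, e2, hv]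
    · intro j hj
      have hins : blockPart n N cls b j (i + 1) = blockPart n N cls b j i := by
        ext u
        simp only [blockPart, Finset.mem_filter, Finset.mem_range]
        constructor
        · rintro ⟨h1, h2, h3, h4⟩
          exact ⟨h1, h2, h3, by omega⟩
        · rintro ⟨h1, h2, h3, h4⟩
          exact ⟨h1, h2, h3, by omega⟩
      rw [hins]
      simpa [listStep, Cmd.run, h0, h5, h7, h17, e1, e2, hv] using hch j hj

lemma listBlock_tr {W n N b : ℕ} {cls : ℕ → ℕ} {s : State} (hN : 0 < N)
    (hW : b * N + N < 2 ^ W) (hW1 : 1 < 2 ^ W)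
    (h0 : s.reg 0 = n) (h5 : s.reg 5 = N) (h7 : s.reg 7 = b)
    (hcls : ∀ v < n, s.mem (5, v) = cls v) (hlt : ∀ v < n, cls v < N) :
    Tr W listBlock s (60 * N + 10) (60 * N + 20) ({x | x.1 = 5} ∪ listCells N b) (listCells N b)
      (fun s' => ∀ j < N, Chain (fun v => s'.mem (11, v)) n (s'.mem (10, b * N + j))
        (block n N cls b j)) := by
  have e1 : b * N % 2 ^ W = b * N := Nat.mod_eq_of_lt (by omega)
  refine Tr.bind (t₁ := 8 * N + 2) (d₁ := 10) (R₁ := ∅) (X₁ := listCells N b)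
    (Q₁ := fun s' => ∀ j < N, s'.mem (10, b * N + j) = n) (t₂ := N * 48 + 6) (d₂ := N * 48 + 6)
    (Tr.par (k := N) (τ := fun _ => 7) (d₁ := 7) (R' := fun _ => ∅)
      (X' := fun j => {(10, b * N + j)}) (P := fun j s' => s'.mem (10, b * N + j) = n)
      (by simp [h5]) ?_ ?_ ?_ ?_ ?_ ?_ ?_ ?_) (by omega) (by omega) (Set.empty_subset _) subset_rfl
    (fun s₁ q1 f1 => ?_)
  · intro j hj
    have e2 : (b * N + j) % 2 ^ W = b * N + j := Nat.mod_eq_of_lt (by omega)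
    refine Tr.simple rfl (by decide) (by decide) ?_ ?_ ?_
    · simp [Cmd.rd]
    · simp [Cmd.wr, State.branch, h5, h7, e1, e2]
    · simp [Cmd.run, State.branch, h5, h7, e1, e2, h0]
  · rintro i _ j _ hne ⟨a, q⟩ hx
    obtain ⟨rfl, rfl⟩ := Prod.mk.inj hx
    simp [hne.symm]
  · simp; omega
  · simp
  · simp
  · simp
  · intro j hj
    simp [mem_listCells, hj]
  · intro mem' h1 _ j hj
    obtain ⟨s', h2, -, h3⟩ := h1 j hj
    dsimp only
    rw [h3 _ rfl, h2]
  have hcls₁ : ∀ v < n, s₁.mem (5, v) = cls v := fun v hv => by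
    rw [f1.1 _ (by rw [mem_listCells]; omega), hcls v hv]
  refine Tr.upTo (m := N) (t := 40) (d := 40) (fun i s' =>
    (s'.reg 0 = n ∧ s'.reg 7 = b) ∧ (∀ v < n, s'.mem (5, v) = cls v) ∧
    ∀ j < N, Chain (fun v => s'.mem (11, v)) n (s'.mem (10, b * N + j))
        (blockPart n N cls b j i)) (by omega) ?_ (by decide) (by decide) (by decide) ?_ ?_
    (by omega) (by omega) ?_
  · rw [f1.2 5 (by decide), h5]
  · refine ⟨?_, hcls₁, fun j hj => ?_⟩
    · simp [f1.2 0 (by decide), f1.2 7 (by decide), h0, h7]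
    · have : blockPart n N cls b j 0 = ∅ := by
        refine Finset.filter_eq_empty_iff.2 fun v _ h => ?_
        have := ((div_eq_iff_block hN).1 h.2.1).1
        omega
      rw [this]
      dsimp only
      rw [q1 j hj]
      exact .nil
  · rintro i hi s' ⟨⟨g0, g7⟩, hc, hch⟩ g17 g5
    refine (listStep_tr hN hi hW hW1 g0 g5 g7 g17 hc hlt hch).weaken fun s'' h f => ?_
    refine ⟨?_, fun v hv => ?_, h⟩
    · simp [f.2 0 (by decide), f.2 7 (by decide), g0, g7]
    · dsimp only
      rw [f.1 _ (by rw [mem_listCells]; omega), hc v hv]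
  · rintro s' ⟨_, _, h⟩ _ _ j hj
    rw [← blockPart_eq hN]
    exact h j hj

/-- The blocks are independent and each is processed sequentially in O(N) steps. As `N ≤ n`, the `n
/ N + 1` blocks together cost O(n), including the last, incomplete one. -/
lemma buildLists_tr {W n N : ℕ} {cls : ℕ → ℕ} {s : State} (hN : 0 < N) (hNn : N ≤ n)
    (hW : 2 * n + 2 < 2 ^ W) (h0 : s.reg 0 = n) (h5 : s.reg 5 = N)
    (hcls : ∀ v < n, s.mem (5, v) = cls v) (hlt : ∀ v < n, cls v < N) :
    Tr W buildLists s (140 * n + 20) (60 * N + 30) Set.univ {x | x.1 = 10 ∨ x.1 = 11}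
      (fun s' => ∀ b < n / N + 1, ∀ j < N,
        Chain (fun v => s'.mem (11, v)) n (s'.mem (10, b * N + j)) (block n N cls b j)) := by
  have o1 : 1 % 2 ^ W = 1 := Nat.mod_eq_of_lt (by omega)
  have hdiv : n / N ≤ n := Nat.div_le_self _ _
  have hdm : n / N * N ≤ n := Nat.div_mul_le_self _ _
  have hb : ∀ b < n / N + 1, b * N ≤ n := fun b hb =>
    (Nat.mul_le_mul_right N (show b ≤ n / N by omega)).trans hdm
  have e1 : (n / N + 1) % 2 ^ W = n / N + 1 := Nat.mod_eq_of_lt (by omega)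
  refine Tr.par (k := n / N + 1) (τ := fun _ => 60 * N + 10) (d₁ := 60 * N + 20)
    (R' := fun b => {x | x.1 = 5} ∪ listCells N b) (X' := fun b => listCells N b)
    (P := fun b s' => ∀ j < N,
        Chain (fun v => s'.mem (11, v)) n (s'.mem (10, b * N + j)) (block n N cls b j))
    (by simp [h0, h5, o1, e1]) ?_ ?_ ?_ ?_ ?_ ?_ ?_ ?_
  · intro b hb'
    have := hb b hb'
    refine listBlock_tr (s := s.branch 7 b) hN (by omega) (by omega) ?_ ?_ ?_ hcls hlt
    · simpa [State.branch] using h0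
    · simpa [State.branch] using h5
    · simp [State.branch]
  · rintro i _ j _ hne ⟨a, q⟩ hx
    simp only [Set.mem_union, Set.mem_ofPred_eq, mem_listCells] at hx ⊢
    rcases Nat.lt_or_gt_of_ne hne with h | h
    · have := Nat.mul_le_mul_right N (Nat.succ_le_of_lt h)
      rw [Nat.succ_mul] at this
      omega
    · have := Nat.mul_le_mul_right N (Nat.succ_le_of_lt h)
      rw [Nat.succ_mul] at this
      omega
  · have : (n / N + 1) * (60 * N + 10 + 1) = 60 * (n / N * N) + 60 * N + 11 * (n / N) + 11 := by
      ring
    simp [this]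
    omega
  · simp; omega
  · simp
  · exact fun _ _ => Set.subset_univ _
  · rintro b _ x hx
    exact hx.1
  · intro mem' h1 _ b hb' j hj
    obtain ⟨s', h2, -, h3⟩ := h1 b hb'
    dsimp only
    rw [h3 _ (by rw [mem_listCells]; omega)]
    refine (h2 j hj).congr fun v hv => h3 _ ?_
    rw [mem_block, div_eq_iff_block hN] at hv
    rw [mem_listCells]
    omega

/-! ## Coloring the classes one after the other -/

/-- Write the keys of the neighbors: the colors of those of lower classes. -/
def colorKeys : Cmd :=
  .par 16 (.rg 10)
    (.set 17 (.arr 2 (.rg 9 + .rg 16)) ;;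
      .ite (.less (.arr 5 (.rg 17)) (.rg 6)) (.store 7 (.rg 9 + .rg 16) (.arr 4 (.rg 17)))
        (.store 7 (.rg 9 + .rg 16) (.rg 2)))

/-- The cells with the colors of the vertices of classes below `j`. -/
def lowerColors (n : ℕ) (cls : ℕ → ℕ) (j : ℕ) : Set Cell := {x | x.1 = 4 ∧ x.2 < n ∧ cls x.2 < j}

/-- Neighbors that are not in a lower class get the key `K`, which is no color, so they do not
influence the choice. Their colors must not even be read: those in the current class may be written
concurrently. -/
lemma colorKeys_tr {W n off deg j K : ℕ} {cls : ℕ → ℕ} {s : State} (h9 : s.reg 9 = off)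
    (h10 : s.reg 10 = deg) (h6 : s.reg 6 = j) (h2 : s.reg 2 = K)
    (hcls : ∀ v < n, s.mem (5, v) = cls v) (hnb : ∀ p < deg, s.mem (2, off + p) < n)
    (hW : off + deg < 2 ^ W) (hW1 : 1 < 2 ^ W) :
    Tr W colorKeys s (deg * 30 + 2) 30
      ({x | x.1 = 2 ∨ x.1 = 5} ∪ lowerColors n cls j ∪ keyCells off deg)
      (keyCells off deg) (fun s' => ∀ p < deg, s'.mem (7, off + p) =
        if cls (s.mem (2, off + p)) < j then s.mem (4, s.mem (2, off + p)) else K) := by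
  refine Tr.par (k := deg) (τ := fun _ => 26) (d₁ := 26)
    (R' := fun i => {x | x.1 = 2 ∨ x.1 = 5} ∪ lowerColors n cls j)
    (X' := fun i => keyCells (off + i) 1)
    (P := fun p s' => s'.mem (7, off + p) =
        if cls (s.mem (2, off + p)) < j then s.mem (4, s.mem (2, off + p)) else K)
    (by simp [h10]) ?_ ?_ ?_ ?_ ?_ ?_ ?_ ?_
  · intro i hi
    have e1 : (off + i) % 2 ^ W = off + i := Nat.mod_eq_of_lt (by omega)
    have o1 : 1 % 2 ^ W = 1 := Nat.mod_eq_of_lt hW1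
    have hn := hnb i hi
    have hc := hcls _ hn
    by_cases hlt : cls (s.mem (2, off + i)) < j
    · refine Tr.simple rfl (by decide) (by decide) ?_ ?_ ?_
      · simp [Cmd.rd, Cmd.run, State.branch, h9, h6, e1, o1, hc, hlt, Set.insert_subset_iff,
          lowerColors, hn]
      · simp [Cmd.wr, Cmd.run, State.branch, h9, h6, e1, o1, hc, hlt, mem_keyCells]
      · simp [Cmd.run, State.branch, h9, h6, e1, o1, hc, hlt]
    · refine Tr.simple rfl (by decide) (by decide) ?_ ?_ ?_
      · simp [Cmd.rd, Cmd.run, State.branch, h9, h6, e1, hc, hlt, Set.insert_subset_iff]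
      · simp [Cmd.wr, Cmd.run, State.branch, h9, h6, e1, hc, hlt, mem_keyCells]
      · simp [Cmd.run, State.branch, h9, h6, h2, e1, hc, hlt]
  · rintro i _ j _ hne ⟨a, q⟩ hx
    simp only [mem_keyCells, Set.mem_union, Set.mem_ofPred_eq, lowerColors] at hx ⊢
    omega
  · simp; omega
  · simp
  · simp
  · exact fun i hi => Set.subset_union_left
  · rintro i hi ⟨a, q⟩ hx
    rw [mem_keyCells] at hx ⊢
    omega
  · intro mem' h1 _ p hp
    obtain ⟨s', h2, -, h3⟩ := h1 p hp
    dsimp only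
    rw [h3 _ (by rw [mem_keyCells]; omega), h2]

/-- Color the vertex in register `8`. -/
def colorVertex : Cmd := loadVertex ;; colorKeys ;; pick ;; .store 4 (.rg 8) (.rg 14)

/-- The scratch cells and the color of vertex `v`. -/
def vertexCells (st : ℕ → ℕ) (v : ℕ) : Set Cell := own st v ∪ {(4, v)}

/-- The cells that are only read when vertices of class `j` are colored. -/
def fixedCells (n : ℕ) (cls : ℕ → ℕ) (j : ℕ) : Set Cell :=
  {x | x.1 = 1 ∨ x.1 = 2 ∨ x.1 = 3 ∨ x.1 = 5 ∨ x.1 = 10 ∨ x.1 = 11} ∪ lowerColors n cls j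

/-- The color of `v` is one of `K` colors, and it is shared by at most the fraction `1 / K` of the
neighbors in lower classes, by weight. -/
def GoodColor (st nb wt cls : ℕ → ℕ) (K : ℕ) (v : ℕ) (col : ℕ → ℕ) : Prop :=
  col v < K ∧ K * adjSum st nb wt v (fun u => cls u < cls v ∧ col u = col v) ≤ wdeg st wt v

lemma adjSum_congr {n : ℕ} {st nb wt : ℕ → ℕ} (hA : AdjData n st nb wt) {v : ℕ} (hv : v < n)
    {P P' : ℕ → Prop} [DecidablePred P] [DecidablePred P'] (h : ∀ u < n, (P u ↔ P' u)) :
    adjSum st nb wt v P = adjSum st nb wt v P' := by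
  refine Finset.sum_congr rfl fun p hp => ?_
  have := hA.mono (show v + 1 ≤ n by omega) le_rfl
  rw [Finset.mem_range] at hp
  simp only [h _ (hA.nb_lt (st v + p) (by omega))]

/-- The condition involves only the color of `v` and the colors of lower classes, so what is colored
later cannot spoil it. -/
lemma GoodColor.congr {n K v : ℕ} {st nb wt cls col col' : ℕ → ℕ} (hA : AdjData n st nb wt)
    (hv : v < n) (h : GoodColor st nb wt cls K v col) (hcv : col' v = col v)
    (hc : ∀ u < n, cls u < cls v → col' u = col u) : GoodColor st nb wt cls K v col' := by
  refine ⟨hcv ▸ h.1, ?_⟩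
  rw [adjSum_congr hA hv (P' := fun u => cls u < cls v ∧ col u = col v)]
  · exact h.2
  · intro u hu
    by_cases hlt : cls u < cls v
    · simp [hlt, hcv, hc u hu hlt]
    · simp [hlt]

lemma colorVertex_tr {W n K v : ℕ} {st nb wt cls : ℕ → ℕ} {s : State}
    (hA : AdjData n st nb wt) (hs : Stored n st nb wt s.mem)
    (hwt : ∀ p < st n, wt p < 2 ^ W) (hW : 2 * st n + n + 4 < 2 ^ W) (hK : 0 < K)
    (h2 : s.reg 2 = K) (h6 : s.reg 6 = cls v) (h8 : s.reg 8 = v) (hv : v < n)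
    (hcls : ∀ v < n, s.mem (5, v) = cls v) :
    Tr W colorVertex s (500 * (st (v + 1) - st v + 1))
      (200 * K + 60 * Nat.clog 2 (st n + 1) + 200)
      (fixedCells n cls (cls v) ∪ vertexCells st v) (vertexCells st v)
      (fun s' => GoodColor st nb wt cls K v (fun u => s'.mem (4, u))) := by
  obtain ⟨deg, hdeg⟩ : ∃ deg, st (v + 1) - st v = deg := ⟨_, rfl⟩
  have hst : st v + deg = st (v + 1) := by
    have := hA.step v hv
    omega
  have hstn : st (v + 1) ≤ st n := hA.mono hv le_rfl
  have hown : own st v = keyCells (st v) deg ∪ cntCells (2 * st v + v) (2 * deg + 1) := by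
    rw [own, hdeg]
  have hclog : Nat.clog 2 (deg + 1) ≤ Nat.clog 2 (st n + 1) := Nat.clog_mono_right 2 (by omega)
  have hm2 : ∀ p < deg, s.mem (2, st v + p) = nb (st v + p) :=
    fun p hp => hs.neighbor _ (by omega)
  have hm3 : ∀ p < deg, s.mem (3, st v + p) = wt (st v + p) := fun p hp => hs.weight _ (by omega)
  rw [vertexCells, hdeg, hown]
  refine Tr.bind (loadVertex_tr hs h8 hv (by omega))
    (t₂ := (deg * 30 + 2) + (400 * (deg + 1) + 3))
    (d₂ := 30 + ((200 * K + 60 * Nat.clog 2 (deg + 1) + 100) + 3))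
    (by omega) (by omega) ?_ (Set.empty_subset _) (fun s₁ q1 f1 => ?_)
  · rintro x hx
    exact Or.inl (Or.inl (Or.inl hx))
  obtain ⟨m1, r9, r10⟩ := q1
  rw [hdeg] at r10
  have hnb : ∀ p < deg, nb (st v + p) < n := fun p hp => hA.nb_lt _ (by omega)
  refine Tr.bind (colorKeys_tr (n := n) (s := s₁) (off := st v) (deg := deg) (j := cls v) (K := K)
    (cls := cls) r9 r10 ?_ ?_ ?_ ?_ (by omega) (by omega))
    le_rfl le_rfl ?_ ?_ (fun s₃ q3 f3 => ?_)
  · rw [f1.2 6 (by decide), h6]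
  · rw [f1.2 2 (by decide), h2]
  · rwa [m1]
  · intro p hp
    rw [m1, hm2 p hp]
    exact hnb p hp
  · refine Set.union_subset_union (Set.union_subset_union_left _ ?_)
      (Set.subset_union_left.trans Set.subset_union_left)
    rintro x (hx | hx)
    · exact Or.inr (Or.inl hx)
    · exact Or.inr (Or.inr (Or.inr (Or.inl hx)))
  · exact Set.subset_union_left.trans Set.subset_union_left
  have hm33 : ∀ p < deg, s₃.mem (3, st v + p) = wt (st v + p) := fun p hp => by
    rw [f3.1 _ (by rw [mem_keyCells]; omega), m1, hm3 p hp]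
  have hkey : ∀ p < deg, s₃.mem (7, st v + p) =
      if cls (nb (st v + p)) < cls v then s.mem (4, nb (st v + p)) else K := by
    intro p hp
    rw [q3 p hp, m1, hm2 p hp]
  refine Tr.bind (pick_tr (s := s₃) (v := v) (off := st v) (deg := deg) hK ?_ ?_ ?_ ?_ (by omega)
    ?_) le_rfl le_rfl ?_ ?_ (fun s₄ q4 f4 => ?_)
  · rw [f3.2 2 (by decide), f1.2 2 (by decide), h2]
  · rw [f3.2 8 (by decide), f1.2 8 (by decide), h8]
  · rw [f3.2 9 (by decide), r9]
  · rw [f3.2 10 (by decide), r10]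
  · intro p hp
    rw [hm33 p hp]
    exact hwt _ (by omega)
  · rw [Set.union_assoc]
    refine Set.union_subset_union ?_ Set.subset_union_left
    rintro x (hx : x.1 = 3)
    exact Or.inl (Or.inr (Or.inr (Or.inl hx)))
  · exact Set.subset_union_right.trans Set.subset_union_left
  obtain ⟨hx, hle⟩ := q4
  set x := s₄.reg 14 with hxdef
  have r8 : s₄.reg 8 = v := by
    rw [f4.2 8 (by decide), f3.2 8 (by decide), f1.2 8 (by decide), h8]
  have hm4 : ∀ u, s₄.mem (4, u) = s.mem (4, u) := fun u => by
    rw [f4.1 _ (by rw [mem_cntCells]; omega), f3.1 _ (by rw [mem_keyCells]; omega), m1]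
  refine Tr.simple rfl (by decide +revert) (by decide +revert) ?_ ?_ ?_
  · simp [Cmd.rd]
  · simp [Cmd.wr, r8]
  · have hself : (Cmd.run W (.store 4 (.rg 8) (.rg 14)) s₄).mem (4, v) = x := by
      simp [Cmd.run, r8, ← hxdef]
    have hother : ∀ u, cls u < cls v →
        (Cmd.run W (.store 4 (.rg 8) (.rg 14)) s₄).mem (4, u) = s.mem (4, u) := fun u hu => by
      have : u ≠ v := by rintro rfl; exact lt_irrefl _ hu
      simp [Cmd.run, r8, this, hm4]
    refine ⟨hself.trans_lt hx, ?_⟩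
    rw [wdeg, hdeg, ← Finset.sum_congr rfl fun p hp => hm33 p (Finset.mem_range.1 hp)]
    convert hle using 2
    rw [adjSum, bucketWt, hdeg]
    refine Finset.sum_congr rfl fun p hp => ?_
    dsimp only
    rw [hkey p (Finset.mem_range.1 hp), hm33 p (Finset.mem_range.1 hp)]
    by_cases hlt : cls (nb (st v + p)) < cls v
    · simp [hlt, hother _ hlt, hself]
    · simp [hlt, hx.ne']

/-- Color the vertices of the current class and of block `b`. -/
def walk : Cmd :=
  .set 8 (.arr 10 (.rg 7 * .rg 5 + .rg 6)) ;;
  .while (.less (.rg 8) (.rg 0)) (colorVertex ;; .set 8 (.arr 11 (.rg 8)))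

/-- The cells of the vertices in `S`. -/
def setCells (st : ℕ → ℕ) (S : Finset ℕ) : Set Cell := {x | ∃ v ∈ S, x ∈ vertexCells st v}

lemma vertexCells_arr {st : ℕ → ℕ} {v : ℕ} {x : Cell} (hx : x ∈ vertexCells st v) :
    x.1 = 7 ∨ x.1 = 8 ∨ x.1 = 9 ∨ x = (4, v) := by
  rcases hx with hx | hx
  · have := own_arr hx
    omega
  · exact Or.inr (Or.inr (Or.inr hx))

/-- Induction along the linked list. Coloring the remaining vertices changes neither the color of
`v`, since `v ∉ S`, nor any color of a lower class, since all vertices of the list have class `j`.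
-/
lemma walkLoop_tr {W n K j D : ℕ} {st nb wt cls nxt : ℕ → ℕ}
    (hA : AdjData n st nb wt)
    (hwt : ∀ p < st n, wt p < 2 ^ W) (hW : 2 * st n + n + 4 < 2 ^ W) (hK : 0 < K)
    (hD : 200 * K + 60 * Nat.clog 2 (st n + 1) + 200 = D)
    {h : ℕ} {S : Finset ℕ} (hch : Chain nxt n h S) : ∀ s : State,
    Stored n st nb wt s.mem → s.reg 0 = n → s.reg 2 = K → s.reg 6 = j → s.reg 8 = h →
    (∀ v < n, s.mem (5, v) = cls v) → (∀ v, s.mem (11, v) = nxt v) → (∀ v ∈ S, cls v = j) →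
    (∀ v ∈ S, v < n) →
    Tr W (.while (.less (.rg 8) (.rg 0)) (colorVertex ;; .set 8 (.arr 11 (.rg 8)))) s
      (∑ v ∈ S, 510 * (st (v + 1) - st v + 1) + 4) (S.card * (D + 10) + 4)
      (fixedCells n cls j ∪ setCells st S) (setCells st S)
      (fun s' => ∀ v ∈ S, GoodColor st nb wt cls K v (fun u => s'.mem (4, u))) := by
  induction hch with
  | nil =>
    intro s _ h0 _ _ h8 _ _ _ _
    exact Tr.while_done (by simp [h0, h8]) (by simp) (by simp) (by simp) (by simp)
  | @cons v S hv hvS _ ih =>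
    intro s hs h0 h2 h6 h8 hcls hnxt hj hlt
    have o1 : 1 % 2 ^ W = 1 := Nat.mod_eq_of_lt (by omega)
    have hcv : cls v = j := hj v (Finset.mem_insert_self _ _)
    have hsub : vertexCells st v ⊆ setCells st (insert v S) :=
      fun x hx => ⟨v, Finset.mem_insert_self _ _, hx⟩
    have hsub' : setCells st S ⊆ setCells st (insert v S) := by
      rintro x ⟨u, hu, hx⟩
      exact ⟨u, Finset.mem_insert_of_mem hu, hx⟩
    refine Tr.while_step (t₁ := 500 * (st (v + 1) - st v + 1) + 3) (d₁ := D + 3)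
      (t₂ := ∑ v ∈ S, 510 * (st (v + 1) - st v + 1) + 4) (d₂ := S.card * (D + 10) + 4)
      (R₁ := fixedCells n cls j ∪ vertexCells st v) (X₁ := vertexCells st v)
      (Q₁ := fun s' => GoodColor st nb wt cls K v (fun u => s'.mem (4, u)) ∧ s'.reg 8 = nxt v ∧
        ∀ r, r ≠ 8 → colorVertex.keeps r = true → s'.reg r = s.reg r)
      ?_ ?_ (fun s' q f => ?_) ?_ ?_ (by simp)
      (Set.union_subset_union_right _ hsub) hsub
    · simp [h8, h0, hv, o1]
    · refine Tr.bind (colorVertex_tr hA hs hwt hW hK h2 (by rw [h6, hcv]) h8 hv hcls)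
        (t₂ := 3) (d₂ := 3) le_rfl (by omega) (by rw [hcv]) subset_rfl (fun s₁ q1 f1 => ?_)
      have r8 : s₁.reg 8 = v := by rw [f1.2 8 (by decide), h8]
      refine Tr.simple rfl (by decide +revert) (by decide +revert) ?_ ?_ ?_
      · simp [Cmd.rd, fixedCells, r8]
      · simp [Cmd.wr]
      · refine ⟨q1, ?_, fun r hr hkr => ?_⟩
        · have : ((11, v) : Cell) ∉ vertexCells st v := fun hx => by
            have := vertexCells_arr hx
            simp at this
          simp [Cmd.run, r8, f1.1 _ this, hnxt]
        · simp [Cmd.run, hr, f1.2 r hkr]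
    · obtain ⟨q1, q2, q3⟩ := q
      have hfix : ∀ x : Cell, x.1 ≠ 4 → x.1 ≠ 7 → x.1 ≠ 8 → x.1 ≠ 9 → s'.mem x = s.mem x := by
        intro x h4 h7 h8 h9
        refine f.1 x fun hx => ?_
        rcases vertexCells_arr hx with h | h | h | h
        · exact h7 h
        · exact h8 h
        · exact h9 h
        · exact h4 (by rw [h])
      refine (ih s' ?_ ?_ ?_ ?_ q2 ?_ ?_ ?_ ?_).mono le_rfl le_rfl
        (Set.union_subset_union_right _ hsub') hsub' ?_
      · exact hs.congr fun x hx => hfix x (by omega) (by omega) (by omega) (by omega)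
      · rw [q3 0 (by decide) (by decide), h0]
      · rw [q3 2 (by decide) (by decide), h2]
      · rw [q3 6 (by decide) (by decide), h6]
      · intro u hu
        rw [hfix _ (by simp) (by simp) (by simp) (by simp),
          hcls u hu]
      · intro u
        rw [hfix _ (by simp) (by simp) (by simp) (by simp),
          hnxt u]
      · exact fun u hu => hj u (Finset.mem_insert_of_mem hu)
      · exact fun u hu => hlt u (Finset.mem_insert_of_mem hu)
      · intro s'' hgood f'
        have hkeep : ∀ u, u ∉ S → s''.mem (4, u) = s'.mem (4, u) := by
          intro u hu
          refine f'.1 _ ?_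
          rintro ⟨w, hw, hx⟩
          rcases vertexCells_arr hx with h | h | h | h
          · simp at h
          · simp at h
          · simp at h
          · obtain rfl := (Prod.mk.inj h).2
            exact hu hw
        intro u hu
        rcases Finset.mem_insert.1 hu with rfl | hu
        · refine q1.congr hA hv (hkeep _ hvS) fun w _ hw => hkeep w fun hwS => ?_
          rw [hj w (Finset.mem_insert_of_mem hwS), hcv] at hw
          exact lt_irrefl _ hw
        · exact hgood u hu
    · rw [Finset.sum_insert hvS]
      simp
      omega
    · rw [Finset.card_insert_of_notMem hvS]
      simp
      ring_nf
      omega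

/-- A block contains at most `N` vertices, which bounds the depth of the sequential walk through one
of its lists. -/
lemma walk_tr {W n N K j b D : ℕ} {st nb wt cls : ℕ → ℕ} {s : State}
    (hA : AdjData n st nb wt) (hs : Stored n st nb wt s.mem)
    (hwt : ∀ p < st n, wt p < 2 ^ W) (hW : 2 * st n + n + 4 < 2 ^ W) (hK : 0 < K)
    (hD : 200 * K + 60 * Nat.clog 2 (st n + 1) + 200 = D)
    (h0 : s.reg 0 = n) (h2 : s.reg 2 = K) (h5 : s.reg 5 = N) (h6 : s.reg 6 = j) (h7 : s.reg 7 = b)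
    (hN : 0 < N) (hbW : b * N + j < 2 ^ W)
    (hcls : ∀ v < n, s.mem (5, v) = cls v)
    (hch : Chain (fun v => s.mem (11, v)) n (s.mem (10, b * N + j)) (block n N cls b j)) :
    Tr W walk s (∑ v ∈ block n N cls b j, 510 * (st (v + 1) - st v + 1) + 12)
      (N * (D + 10) + 12)
      (fixedCells n cls j ∪ setCells st (block n N cls b j)) (setCells st (block n N cls b j))
      (fun s' => ∀ v ∈ block n N cls b j,
        GoodColor st nb wt cls K v (fun u => s'.mem (4, u))) := by
  have e1 : b * N % 2 ^ W = b * N := Nat.mod_eq_of_lt (by omega)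
  have e2 : (b * N + j) % 2 ^ W = b * N + j := Nat.mod_eq_of_lt hbW
  have hcard : (block n N cls b j).card ≤ N := by
    calc (block n N cls b j).card ≤ (Finset.Ico (b * N) (b * N + N)).card := by
          refine Finset.card_le_card fun v hv => ?_
          rw [Finset.mem_Ico]
          exact (div_eq_iff_block hN).1 (mem_block.1 hv).2.2
      _ = N := by simp
  have hcard' : (block n N cls b j).card * (D + 10) ≤ N * (D + 10) :=
    Nat.mul_le_mul_right _ hcard
  refine Tr.bind (t₁ := 8) (d₁ := 8) (R₁ := {x | x.1 = 10}) (X₁ := ∅)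
    (t₂ := ∑ v ∈ block n N cls b j, 510 * (st (v + 1) - st v + 1) + 4)
    (d₂ := (block n N cls b j).card * (D + 10) + 4)
    (Q₁ := fun s' => s'.mem = s.mem ∧ s'.reg 8 = s.mem (10, b * N + j))
    (Tr.simple rfl (by decide) (by decide) ?_ ?_ ?_) (by omega) (by omega) ?_
    (Set.empty_subset _) (fun s₁ q1 f1 => ?_)
  · simp [Cmd.rd]
  · simp [Cmd.wr]
  · simp [Cmd.run, h5, h6, h7, e1, e2]
  · rintro x (hx : x.1 = 10)
    exact Or.inl (Or.inl (by simp [hx]))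
  · refine walkLoop_tr hA hwt hW hK hD hch s₁ (q1.1 ▸ hs) ?_ ?_ ?_ q1.2 (q1.1 ▸ hcls) ?_
      (fun v hv => (mem_block.1 hv).2.1) (fun v hv => (mem_block.1 hv).1)
    · rw [f1.2 0 (by decide), h0]
    · rw [f1.2 2 (by decide), h2]
    · rw [f1.2 6 (by decide), h6]
    · simp [q1.1]

/-- Color the vertices of the current class. -/
def colorClass : Cmd := .par 7 (.rg 0 / .rg 5 + .cst 1) walk

/-- Walks in different blocks are free of races: the only colors read from outside the block belong
to classes below `j`, the only colors written belong to class `j`, and the scratch cells of distinct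
vertices are disjoint. -/
lemma colorClass_tr {W n N K j D : ℕ} {st nb wt cls : ℕ → ℕ} {s : State}
    (hA : AdjData n st nb wt) (hs : Stored n st nb wt s.mem)
    (hwt : ∀ p < st n, wt p < 2 ^ W) (hW : 2 * st n + 2 * n + 4 < 2 ^ W) (hK : 0 < K)
    (hD : 200 * K + 60 * Nat.clog 2 (st n + 1) + 200 = D)
    (h0 : s.reg 0 = n) (h2 : s.reg 2 = K) (h5 : s.reg 5 = N) (h6 : s.reg 6 = j)
    (hj : j < N) (hNn : N ≤ n)
    (hcls : ∀ v < n, s.mem (5, v) = cls v)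
    (hch : ∀ b < n / N + 1, Chain (fun v => s.mem (11, v)) n (s.mem (10, b * N + j))
      (block n N cls b j)) :
    Tr W colorClass s
      (∑ v ∈ Finset.range n with cls v = j, 510 * (st (v + 1) - st v + 1) + (n / N + 1) * 13 + 6)
      (N * (D + 10) + 18) Set.univ {x | 4 ≤ x.1 ∧ x.1 ≤ 9 ∧ x.1 ≠ 5}
      (fun s' => (∀ v < n, cls v = j → GoodColor st nb wt cls K v (fun u => s'.mem (4, u))) ∧
        ∀ v < n, cls v < j → s'.mem (4, v) = s.mem (4, v)) := by
  have hN : 0 < N := by omega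
  have o1 : 1 % 2 ^ W = 1 := Nat.mod_eq_of_lt (by omega)
  have hdiv : n / N ≤ n := Nat.div_le_self _ _
  have hdm : n / N * N ≤ n := Nat.div_mul_le_self _ _
  have e1 : (n / N + 1) % 2 ^ W = n / N + 1 := Nat.mod_eq_of_lt (by omega)
  refine Tr.par (k := n / N + 1)
    (τ := fun b => ∑ v ∈ block n N cls b j, 510 * (st (v + 1) - st v + 1) + 12)
    (d₁ := N * (D + 10) + 12)
    (R' := fun b => fixedCells n cls j ∪ setCells st (block n N cls b j))
    (X' := fun b => setCells st (block n N cls b j))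
    (P := fun b s' => ∀ v ∈ block n N cls b j,
        GoodColor st nb wt cls K v (fun u => s'.mem (4, u)))
    (by simp [h0, h5, o1, e1]) ?_ ?_ ?_ ?_ ?_ ?_ ?_ ?_
  · intro b hb
    have hbN : b * N ≤ n := (Nat.mul_le_mul_right N (show b ≤ n / N by omega)).trans hdm
    refine walk_tr (s := s.branch 7 b) hA hs hwt (by omega) hK hD ?_ ?_ ?_ ?_ ?_ hN (by omega)
      hcls (hch b hb)
    · simpa [State.branch] using h0
    · simpa [State.branch] using h2
    · simpa [State.branch] using h5
    · simpa [State.branch] using h6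
    · simp [State.branch]
  · rintro i _ i' _ hne x ⟨v, hv, hx⟩
    rw [mem_block] at hv
    have hnot : x ∉ setCells st (block n N cls i j) := by
      rintro ⟨w, hw, hx'⟩
      rw [mem_block] at hw
      have hvw : v ≠ w := by
        rintro rfl
        exact hne (hw.2.2.symm.trans hv.2.2)
      rcases hx with hx | hx
      · rcases hx' with hx' | hx'
        · exact hA.own_disjoint hv.1 hw.1 hvw hx hx'
        · have := own_arr hx
          rw [Set.mem_singleton_iff] at hx'
          simp [hx'] at this
      · rw [Set.mem_singleton_iff] at hx
        rcases hx' with hx' | hx'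
        · have := own_arr hx'
          simp [hx] at this
        · rw [Set.mem_singleton_iff, hx] at hx'
          exact hvw (Prod.mk.inj hx').2
    refine ⟨?_, hnot⟩
    rintro ((hf | hf) | hf)
    · have := vertexCells_arr hx
      simp only [Set.mem_ofPred_eq] at hf
      rcases this with h | h | h | h
      · omega
      · omega
      · omega
      · rw [h] at hf
        simp at hf
    · have := vertexCells_arr hx
      obtain ⟨hf1, hf2, hf3⟩ := hf
      rcases this with h | h | h | h
      · omega
      · omega
      · omega
      · rw [h] at hf3
        simp only [hv.2.1, lt_irrefl] at hf3
    · exact hnot hf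
  · have hfib : ∑ b ∈ Finset.range (n / N + 1), ∑ v ∈ block n N cls b j,
        510 * (st (v + 1) - st v + 1) =
        ∑ v ∈ Finset.range n with cls v = j, 510 * (st (v + 1) - st v + 1) := by
      refine Finset.sum_fiberwise_of_maps_to (g := fun v => v / N) (fun v hv => ?_) _
      rw [Finset.mem_filter, Finset.mem_range] at hv
      rw [Finset.mem_range]
      exact Nat.lt_succ_of_le (Nat.div_le_div_right hv.1.le)
    simp only [add_assoc]
    rw [Finset.sum_add_distrib, hfib]
    simp
    omega
  · simp; omega
  · simp
  · exact fun _ _ => Set.subset_univ _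
  · rintro b _ x ⟨v, _, hx⟩
    rcases vertexCells_arr hx with h | h | h | h
    all_goals simp [h]
  · intro mem' h1 h2
    have hlow : ∀ v < n, cls v < j → mem' (4, v) = s.mem (4, v) := by
      intro v hv hcv
      refine h2 _ fun b _ => ?_
      rintro ⟨w, hw, hx⟩
      rcases vertexCells_arr hx with h | h | h | h
      · simp at h
      · simp at h
      · simp at h
      · obtain rfl := (Prod.mk.inj h).2
        have := (mem_block.1 hw).2.1
        omega
    refine ⟨fun v hv hcv => ?_, hlow⟩
    have hb : v / N < n / N + 1 := Nat.lt_succ_of_le (Nat.div_le_div_right hv.le)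
    have hvb : v ∈ block n N cls (v / N) j := mem_block.2 ⟨hv, hcv, rfl⟩
    obtain ⟨s', h3, f3, h4⟩ := h1 _ hb
    refine (h3 v hvb).congr hA hv (h4 _ ⟨v, hvb, Or.inr rfl⟩) fun u hu hlt => ?_
    rw [hcv] at hlt
    dsimp only
    rw [hlow u hu hlt]
    refine (f3.1 _ ?_).symm
    rintro ⟨w, hw, hx⟩
    rcases vertexCells_arr hx with h | h | h | h
    · simp at h
    · simp at h
    · simp at h
    · obtain rfl := (Prod.mk.inj h).2
      have := (mem_block.1 hw).2.1
      omega

/-- Color all vertices, class by class. -/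
def greedy : Cmd := buildLists ;; .upTo 6 5 colorClass

lemma greedy_tr {W n N K D : ℕ} {st nb wt cls : ℕ → ℕ} {s : State}
    (hA : AdjData n st nb wt) (hs : Stored n st nb wt s.mem)
    (hwt : ∀ p < st n, wt p < 2 ^ W) (hW : 2 * st n + 2 * n + 4 < 2 ^ W) (hK : 0 < K)
    (hD : 200 * K + 60 * Nat.clog 2 (st n + 1) + 200 = D)
    (h0 : s.reg 0 = n) (h2 : s.reg 2 = K) (h5 : s.reg 5 = N)
    (hN : 0 < N) (hNn : N ≤ n)
    (hcls : ∀ v < n, s.mem (5, v) = cls v) (hlt : ∀ v < n, cls v < N) :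
    Tr W greedy s (510 * st n + 800 * n + 50) (N * (N * (D + 10) + 100) + 50) Set.univ Set.univ
      (fun s' => ∀ v < n, GoodColor st nb wt cls K v (fun u => s'.mem (4, u))) := by
  have hdm : n / N * N ≤ n := Nat.div_mul_le_self _ _
  -- The classes partition the vertices, so the vertex costs add up to O(`st n` + n). The overhead
  -- of starting `n / N + 1` walks for each of `N` classes is O(n), because `n / N * N ≤ n` and `N ≤
  -- n`.
  have hsumN : ∑ j ∈ Finset.range N,
      (∑ v ∈ Finset.range n with cls v = j, 510 * (st (v + 1) - st v + 1) +
        (n / N + 1) * 13 + 6 + 8) ≤ 510 * st n + 550 * n := by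
    have hfib : ∑ j ∈ Finset.range N, ∑ v ∈ Finset.range n with cls v = j,
        510 * (st (v + 1) - st v + 1) = ∑ v ∈ Finset.range n, 510 * (st (v + 1) - st v + 1) :=
      Finset.sum_fiberwise_of_maps_to (fun v hv =>
        Finset.mem_range.2 (hlt v (Finset.mem_range.1 hv))) _
    have h1 : N * ((n / N + 1) * 13 + (6 + 8)) = 13 * (n / N * N) + 27 * N := by ring
    simp only [add_assoc]
    rw [Finset.sum_add_distrib, hfib, ← Finset.mul_sum, Finset.sum_add_distrib,
      hA.sum_deg le_rfl, Finset.sum_const, Finset.card_range, smul_eq_mul, Finset.sum_const,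
      Finset.card_range, smul_eq_mul, h1]
    omega
  have hmul : N * (N * (D + 10) + 18 + 8) + 74 * N = N * (N * (D + 10) + 100) := by ring
  refine Tr.bind (buildLists_tr (cls := cls) hN hNn (by omega) h0 h5 hcls hlt)
    (t₂ := 510 * st n + 550 * n + 6) (d₂ := N * (N * (D + 10) + 18 + 8) + 6)
    (by omega) (by omega) (Set.subset_univ _) (Set.subset_univ _) (fun s₁ q1 f1 => ?_)
  have hs₁ : Stored n st nb wt s₁.mem := hs.congr fun x hx => f1.1 x fun h => by
    have h' : x.1 = 10 ∨ x.1 = 11 := h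
    omega
  refine Tr.upTo_sum (m := N) (d := N * (D + 10) + 18) (t := fun j =>
      ∑ v ∈ Finset.range n with cls v = j, 510 * (st (v + 1) - st v + 1) + (n / N + 1) * 13 + 6)
    (fun j s' => (s'.reg 0 = n ∧ s'.reg 2 = K) ∧
      (∀ x : Cell, x.1 ≤ 3 ∨ x.1 = 5 ∨ 10 ≤ x.1 → s'.mem x = s₁.mem x) ∧
      ∀ v < n, cls v < j → GoodColor st nb wt cls K v (fun u => s'.mem (4, u)))
    (by omega) ?_ (by decide) (by decide) (by decide) ?_ ?_ (by omega) (by omega) ?_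
  · rw [f1.2 5 (by decide), h5]
  · refine ⟨?_, fun x _ => rfl, fun v _ h => absurd h (Nat.not_lt_zero _)⟩
    simp [f1.2 0 (by decide), f1.2 2 (by decide), h0, h2]
  · rintro j hj s' ⟨⟨g0, g2⟩, gm, gc⟩ g6 g5
    refine (colorClass_tr (cls := cls) hA (hs₁.congr fun x hx => gm x (by omega)) hwt hW hK hD g0
      g2 g5 g6 hj hNn ?_ ?_).mono le_rfl le_rfl subset_rfl (Set.subset_univ _) ?_
    · intro v hv
      rw [gm _ (by simp), f1.1 _ (by simp), hcls v hv]
    · intro b hb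
      have h10 : s'.mem (10, b * N + j) = s₁.mem (10, b * N + j) := gm _ (by simp)
      rw [h10]
      exact (q1 b hb j hj).congr fun u _ => gm _ (by simp)
    · rintro s'' ⟨k1, k2⟩ f
      refine ⟨?_, fun x hx => ?_, fun v hv hlt' => ?_⟩
      · simp [f.2 0 (by decide), f.2 2 (by decide), g0, g2]
      · rw [← gm x hx]
        refine f.1 x fun h => ?_
        simp only [Set.mem_ofPred_eq] at h
        omega
      · rcases Nat.lt_succ_iff_lt_or_eq.1 hlt' with h | h
        · exact (gc v hv h).congr hA hv (k2 v hv h) fun u hu hu' => k2 u hu (by omega)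
        · exact k1 v hv h
  · rintro s' ⟨_, _, h⟩ _ _ v hv
    exact h v hv (hlt v hv)

/-! ## The complete algorithm -/

/-- Halve register `15` until it is at most `1`, counting the steps in register `3`. -/
def logLoop : Cmd :=
  .while (.less (.cst 1) (.rg 15)) (.set 15 (.rg 15 / .cst 2) ;; .set 3 (.rg 3 + .cst 1))

lemma logLoop_tr {W : ℕ} (hW : 2 < 2 ^ W) (x : ℕ) : ∀ (u : ℕ) (s : State),
    s.reg 15 = x → s.reg 3 = u → u + Nat.log 2 x < 2 ^ W →
    Tr W logLoop s (Nat.log 2 x * 12 + 4) (Nat.log 2 x * 12 + 4) ∅ ∅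
      (fun s' => s'.reg 3 = u + Nat.log 2 x) := by
  induction x using Nat.strong_induction_on with
  | _ x ih =>
  intro u s h15 h3 hu
  have o1 : 1 % 2 ^ W = 1 := Nat.mod_eq_of_lt (by omega)
  have o2 : 2 % 2 ^ W = 2 := Nat.mod_eq_of_lt (by omega)
  by_cases hx : 1 < x
  · have hlog : Nat.log 2 x = Nat.log 2 (x / 2) + 1 := by
      rw [Nat.log_of_one_lt_of_le (by omega) (by omega)]
    have e1 : (u + 1) % 2 ^ W = u + 1 := Nat.mod_eq_of_lt (by omega)
    refine Tr.while_step (t₁ := 8) (d₁ := 8) (R₁ := ∅) (X₁ := ∅)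
      (Q₁ := fun s' => s'.reg 15 = x / 2 ∧ s'.reg 3 = u + 1)
      (t₂ := Nat.log 2 (x / 2) * 12 + 4) (d₂ := Nat.log 2 (x / 2) * 12 + 4) ?_
      (Tr.simple rfl (by decide) (by decide) ?_ ?_ ?_) (fun s' q _ => ?_) ?_ ?_ (by simp)
      subset_rfl subset_rfl
    · simp [h15, o1, hx]
    · simp [Cmd.rd]
    · simp [Cmd.wr]
    · simp [Cmd.run, h15, h3, o1, o2, e1]
    · refine (ih (x / 2) (by omega) (u + 1) s' q.1 q.2 (by omega)).weaken fun s'' h _ => ?_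
      omega
    · simp; omega
    · simp; omega
  · have hlog : Nat.log 2 x = 0 := Nat.log_eq_zero_iff.2 (by omega)
    refine Tr.while_done ?_ (by simp) (by simp) (by simp) ?_
    · simp [h15, o1, hx]
    · rw [h3, hlog, add_zero]

/-- Use the vertices as classes. -/
def initClasses : Cmd := .par 8 (.rg 0) (.store 5 (.rg 8) (.rg 8))

/-- Give the vertices different colors. -/
def initColors : Cmd := .par 8 (.rg 0) (.store 4 (.rg 8) (.rg 8))

lemma init_tr {W n a : ℕ} {s : State} (h0 : s.reg 0 = n) :
    Tr W (.par 8 (.rg 0) (.store a (.rg 8) (.rg 8))) s (4 * n + 2) 5 ∅ {x | x.1 = a}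
      (fun s' => ∀ v < n, s'.mem (a, v) = v) := by
  refine Tr.par (k := n) (τ := fun _ => 3) (d₁ := 3) (R' := fun _ => ∅)
    (X' := fun v => {(a, v)}) (P := fun v s' => s'.mem (a, v) = v)
    (by simp [h0]) ?_ ?_ ?_ ?_ ?_ ?_ ?_ ?_
  · intro v hv
    refine Tr.simple rfl le_rfl le_rfl ?_ ?_ ?_
    · simp [Cmd.rd]
    · simp [Cmd.wr, State.branch]
    · simp [Cmd.run, State.branch]
  · rintro v _ w _ hne ⟨b, q⟩ hx
    obtain ⟨rfl, rfl⟩ := Prod.mk.inj hx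
    simp [hne.symm]
  · simp; omega
  · simp
  · simp
  · simp
  · intro v _
    simp
  · intro mem' h1 _ v hv
    obtain ⟨s', h2, -, h3⟩ := h1 v hv
    dsimp only
    rw [h3 _ rfl, h2]

/-- Compute the parameter `K` and the number `2 * K ^ 4` of classes to be reached. -/
def setParams : Cmd :=
  .set 2 (.cst 2 * (.rg 1 * (.rg 3 + .cst 1))) ;;
  .set 15 (.cst 2 * ((.rg 2 * .rg 2) * (.rg 2 * .rg 2)))

/-- Reduce the number of classes if that is possible. -/
def reduce : Cmd :=
  .ite (.less (.rg 0) (.rg 15)) (.set 5 (.rg 0)) (.set 5 (.rg 15) ;; rounds)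

/-- The algorithm for `⌈1 / ε⌉ < n`. -/
def colorMain : Cmd :=
  .set 3 (.cst 0) ;; .set 15 (.rg 0) ;; logLoop ;; setParams ;; initClasses ;; reduce ;;
  .set 2 (.cst 4 * .rg 1) ;; greedy

/-- Load `n`, and compute the number `⌈1 / ε⌉`. -/
def loadInput : Cmd :=
  .set 0 (.arr 0 (.cst 0)) ;;
  .set 1 ((.arr 0 (.cst 2) - .cst 1) / .arr 0 (.cst 1) + .cst 1)

/-- The defective coloring algorithm. -/
def defectiveColoring : Cmd := loadInput ;; .ite (.less (.rg 1) (.rg 0)) colorMain initColors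

lemma dmono_id {n : ℕ} {st nb wt : ℕ → ℕ}
    (hloop : ∀ v < n, ∀ p < st (v + 1) - st v, nb (st v + p) ≠ v) :
    dmono n st nb wt (fun v => v) = 0 := by
  refine Finset.sum_eq_zero fun v hv => Finset.sum_eq_zero fun p hp => if_neg ?_
  exact hloop v (Finset.mem_range.1 hv) p (Finset.mem_range.1 hp)

/-- If `n < M`, the identifiers are already good classes. Otherwise the reduction starts from the
identifiers, and its largest intermediate bound is `M * 2 ^ u ≤ n * n`, which fits into a word. In
both cases `N ≤ n`, as the block structure requires. -/
lemma reduce_tr {W n K u M : ℕ} {st nb wt : ℕ → ℕ} {s : State} (hA : AdjData n st nb wt)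
    (hs : Stored n st nb wt s.mem) (hn : 0 < n)
    (hloop : ∀ v < n, ∀ p < st (v + 1) - st v, nb (st v + p) ≠ v)
    (hwt : ∀ p < st n, wt p < 2 ^ W) (hW : 2 * st n + n + 4 < 2 ^ W) (hnW : n * n < 2 ^ W)
    (hK : 0 < K) (hu : u = Nat.log 2 n) (hM : M = 2 * K ^ 4)
    (h0 : s.reg 0 = n) (h2 : s.reg 2 = K) (h3 : s.reg 3 = u) (h15 : s.reg 15 = M)
    (hid : ∀ v < n, s.mem (5, v) = v) :
    Tr W reduce s (Nat.log 2 (2 * u) * (500 * st n + 510 * n + 12 * u + 50) + 10)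
      (Nat.log 2 (2 * u) * (200 * K + 60 * Nat.clog 2 (st n + 1) + 12 * u + 260) + 10)
      Set.univ {x | 5 ≤ x.1 ∧ x.1 ≤ 9}
      (fun s' => ∃ (N : ℕ) (cls : ℕ → ℕ), s'.reg 5 = N ∧ 0 < N ∧ N ≤ n ∧ N ≤ M ∧
        (∀ v < n, s'.mem (5, v) = cls v) ∧ (∀ v < n, cls v < N) ∧
        K * dmono n st nb wt cls ≤ u * dtotal n st wt) := by
  have o1 : 1 % 2 ^ W = 1 := Nat.mod_eq_of_lt (by omega)
  by_cases hlt : n < M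
  · refine Tr.ite_pos (t₁ := 2) (d₁ := 2) ?_ (Tr.simple rfl (by decide) (by decide) ?_ ?_ ?_)
      (by simp) (by simp) (by simp)
    · simp [h0, h15, hlt, o1]
    · simp [Cmd.rd]
    · simp [Cmd.wr]
    · refine ⟨n, fun v => v, ?_, hn, le_rfl, hlt.le, ?_, fun v hv => hv, ?_⟩
      · simp [Cmd.run, h0]
      · simpa [Cmd.run] using hid
      · rw [dmono_id hloop]
        exact Nat.zero_le _
  · have hMn : M ≤ n := not_lt.1 hlt
    have hpow : 2 ^ u ≤ n := hu ▸ Nat.pow_log_le_self 2 (by omega)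
    refine Tr.ite_neg (t₁ := 2 + (Nat.log 2 (2 * u) * (500 * st n + 510 * n + 12 * u + 50) + 2))
      (d₁ := 2 + (Nat.log 2 (2 * u) *
        (200 * K + 60 * Nat.clog 2 (st n + 1) + 12 * u + 260) + 2)) ?_
      (Tr.bind (t₁ := 2) (d₁ := 2) (R₁ := ∅) (X₁ := ∅)
        (Q₁ := fun s' => s'.mem = s.mem ∧ s'.reg 5 = M)
        (Tr.simple rfl (by decide) (by decide) ?_ ?_ ?_) le_rfl le_rfl
        (Set.empty_subset _) (Set.empty_subset _) (fun s₁ q1 f1 => ?_))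
      (by simp; omega) (by simp; omega) (by simp)
    · simp [h0, h15, hlt]
    · simp [Cmd.rd]
    · simp [Cmd.wr]
    · simp [Cmd.run, h15]
    · refine (rounds_tr (u₀ := u) (B := u * dtotal n st wt) hA hwt hW hK ?_ u (fun v => v) s₁ le_rfl
        (q1.1 ▸ hs) ?_ ?_ ?_ (q1.1 ▸ hid) ?_ ?_).weaken ?_
      · rw [← hM]
        exact (Nat.mul_le_mul hMn hpow).trans_lt hnW
      · rw [f1.2 0 (by decide), h0]
      · rw [f1.2 2 (by decide), h2]
      · rw [f1.2 3 (by decide), h3]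
      · intro v hv
        have h1 : n < 2 ^ (u + 1) := hu ▸ Nat.lt_pow_succ_log_self (by omega) n
        have h2 : 2 ^ (u + 1) ≤ 2 * K ^ 4 * 2 ^ u := by
          rw [pow_succ', mul_right_comm]
          exact Nat.le_mul_of_pos_right _ (by positivity)
        omega
      · rw [dmono_id hloop]
        simp
      · rintro s' ⟨c', k1, k2, k3⟩ f
        refine ⟨M, c', ?_, ?_, hMn, le_rfl, k1, ?_, k3⟩
        · rw [f.2 5 (by decide), q1.2]
        · rw [hM]
          positivity
        · rwa [hM]

/-- Only the `F` rounds of the class reduction are multiplied; everything else is linear in `e + n`,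
and the terms in `u` are absorbed by `u < n`. -/
lemma colorMain_work {n u F : ℕ} (e : ℕ) (hF1 : F ≤ Nat.log 2 u + 1) (hun : u < n) (hn : 2 ≤ n) :
    2 + (2 + ((u * 12 + 4) + (30 + ((4 * n + 2) +
      ((F * (500 * e + 510 * n + 12 * u + 50) + 10) + (4 + (510 * e + 800 * n + 50))))))) ≤
      (Nat.log 2 u + 1) * (2000 * e + 2000 * n) := by
  have h1 : F * (500 * e + 510 * n + 12 * u + 50) ≤
      (Nat.log 2 u + 1) * (500 * e + 550 * n) :=
    Nat.mul_le_mul hF1 (by omega)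
  have h2 : 510 * e + 820 * n + 200 ≤ (Nat.log 2 u + 1) * (510 * e + 920 * n) :=
    le_trans (by omega) (Nat.le_mul_of_pos_left _ (Nat.succ_pos _))
  have h3 : (Nat.log 2 u + 1) * (500 * e + 550 * n) +
      (Nat.log 2 u + 1) * (510 * e + 920 * n) ≤
      (Nat.log 2 u + 1) * (2000 * e + 2000 * n) := by
    rw [← mul_add]
    exact Nat.mul_le_mul_left _ (by omega)
  omega

/-- The greedy stage dominates: it runs through `M` classes, each with walks of length up to `M` and
depth O(D) per vertex, where `M = 32 * X ^ 4` and `D` is O(X). This gives the exponent 4 + 4 + 1 =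
9. -/
lemma colorMain_depth {X M K F L D T u : ℕ} (hX1 : 0 < X) (hM : M = 2 * K ^ 4) (hK : K = 2 * X)
    (hFX : F ≤ X) (hLX : L ≤ 2 * X) (hTX : T ≤ X) (huX : u + 1 ≤ X)
    (hD : 200 * (4 * T) + 60 * L + 200 = D) :
    2 + (2 + ((u * 12 + 4) + (30 + (5 +
      ((F * (200 * K + 60 * L + 12 * u + 260) + 10) +
        (4 + (M * (M * (D + 10) + 100) + 50))))))) ≤ 2000000 * X ^ 9 := by
  have hp : ∀ e, 1 ≤ X ^ e := fun e => Nat.one_le_pow _ _ hX1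
  have h1 : D + 10 ≤ 1130 * X := by omega
  have hMX : M = 32 * X ^ 4 := by rw [hM, hK]; ring
  have h2 : M * (M * (D + 10) + 100) ≤ 1160320 * X ^ 9 := by
    calc M * (M * (D + 10) + 100)
        ≤ 32 * X ^ 4 * (32 * X ^ 4 * (1130 * X) + 100 * X ^ 5) := by
          rw [hMX]
          gcongr
          exact Nat.le_mul_of_pos_right _ (hp 5)
      _ = 1160320 * X ^ 9 := by ring
  have h3 : F * (200 * K + 60 * L + 12 * u + 260) ≤ 800 * X ^ 9 := by
    calc F * (200 * K + 60 * L + 12 * u + 260) ≤ X * (800 * X) :=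
          Nat.mul_le_mul hFX (by omega)
      _ = 800 * X ^ 2 := by ring
      _ ≤ 800 * X ^ 9 := Nat.mul_le_mul_left _ (Nat.pow_le_pow_right hX1 (by omega))
  have h4 : X ≤ X ^ 9 := Nat.le_self_pow (by omega) X
  omega

-- The parameter K = 2(u + 1)T is chosen so that u/K ≤ 1/(2T): all rounds together lose at most half
-- of the allowed fraction 1/T, and the greedy stage with 4T colors may lose the other half.
set_option maxHeartbeats 1000000 in
lemma colorMain_tr {W n T : ℕ} {st nb wt : ℕ → ℕ} {s : State} (hA : AdjData n st nb wt)
    (hs : Stored n st nb wt s.mem)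
    (hloop : ∀ v < n, ∀ p < st (v + 1) - st v, nb (st v + p) ≠ v)
    (hwt : ∀ p < st n, wt p < 2 ^ W) (hst : st n ≤ n * n) (hW : (n + 1) ^ 13 ≤ 2 ^ W)
    (hT : 0 < T) (hTn : T < n) (h0 : s.reg 0 = n) (h1 : s.reg 1 = T) :
    Tr W colorMain s ((Nat.log 2 (Nat.log 2 n) + 1) * (2000 * st n + 2000 * n))
      (2000000 * ((Nat.log 2 n + 1) * T) ^ 9) Set.univ Set.univ
      (fun s' => ∃ cls : ℕ → ℕ, 2 * T * dmono n st nb wt cls ≤ dtotal n st wt ∧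
        ∀ v < n, GoodColor st nb wt cls (4 * T) v (fun u => s'.mem (4, u))) := by
  obtain ⟨u, hu⟩ : ∃ u, u = Nat.log 2 n := ⟨_, rfl⟩
  obtain ⟨X, hX⟩ : ∃ X, X = (u + 1) * T := ⟨_, rfl⟩
  obtain ⟨K, hK⟩ : ∃ K, K = 2 * X := ⟨_, rfl⟩
  obtain ⟨M, hM⟩ : ∃ M, M = 2 * K ^ 4 := ⟨_, rfl⟩
  obtain ⟨F, hF⟩ : ∃ F, F = Nat.log 2 (2 * u) := ⟨_, rfl⟩
  obtain ⟨L, hL⟩ : ∃ L, L = Nat.clog 2 (st n + 1) := ⟨_, rfl⟩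
  rw [← hu, ← hX]
  have hX1 : 0 < X := hX ▸ Nat.mul_pos (by omega) hT
  have hTX : T ≤ X := hX ▸ Nat.le_mul_of_pos_left _ (by omega)
  have huX : u + 1 ≤ X := hX ▸ Nat.le_mul_of_pos_right _ hT
  have hun : u < n := hu ▸ Nat.log_lt_self 2 (by omega)
  have hn2 : 2 ≤ n := by omega
  have hXn : X ≤ n * n := hX ▸ Nat.mul_le_mul (by omega) hTn.le
  have hF1 : F ≤ Nat.log 2 u + 1 := by
    rcases Nat.eq_zero_or_pos u with h | h
    · simp [hF, h]
    · rw [hF, mul_comm, Nat.log_mul_base (by omega) (by omega)]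
  have hFX : F ≤ X := by
    have := Nat.log_le_self 2 u
    omega
  have hLX : L ≤ 2 * X := by
    rw [hL]
    refine Nat.clog_le_of_le_pow ?_
    have h1 : n + 1 ≤ 2 ^ (u + 1) := hu ▸ Nat.lt_pow_succ_log_self (by omega) n
    calc st n + 1 ≤ (n + 1) * (n + 1) := by nlinarith
      _ ≤ 2 ^ (u + 1) * 2 ^ (u + 1) := Nat.mul_le_mul h1 h1
      _ = 2 ^ (2 * (u + 1)) := by rw [← pow_add]; congr 1; ring
      _ ≤ 2 ^ (2 * X) := Nat.pow_le_pow_right (by omega) (by omega)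
  -- The largest number that occurs is `M ≤ 2 ^ 5 * n ^ 8`. Since `2 ≤ n + 1`, it is bounded by a
  -- power of `n + 1` with exponent 5 + 8 = 13, the exponent in `hW`.
  have hbig : ∀ m e, m ≤ 2 ^ 5 * (n + 1) ^ e → e ≤ 8 → m ≤ 2 ^ W := by
    intro m e hm he
    calc m ≤ 2 ^ 5 * (n + 1) ^ e := hm
      _ ≤ (n + 1) ^ 5 * (n + 1) ^ 8 := Nat.mul_le_mul (Nat.pow_le_pow_left (by omega) _)
          (Nat.pow_le_pow_right (by omega) he)
      _ = (n + 1) ^ 13 := by ring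
      _ ≤ 2 ^ W := hW
  have hKn : K ≤ 2 * (n * n) := by omega
  have hn4 : 2 * st n + 2 * n + 4 < 2 ^ W := by
    refine hbig _ 2 ?_ (by omega)
    nlinarith
  have hnn : n * n < 2 ^ W := hbig _ 2 (by nlinarith) (by omega)
  have hKW : K < 2 ^ W := hbig _ 2 (by nlinarith) (by omega)
  have hMle : M ≤ 2 ^ 5 * (n * n) ^ 4 := by
    calc M = 2 * K ^ 4 := hM
      _ ≤ 2 * (2 * (n * n)) ^ 4 := Nat.mul_le_mul_left _ (Nat.pow_le_pow_left hKn _)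
      _ = 2 ^ 5 * (n * n) ^ 4 := by ring
  have hMW : M < 2 ^ W := by
    refine hbig _ 8 ?_ le_rfl
    refine Nat.succ_le_of_lt (hMle.trans_lt ?_)
    refine Nat.mul_lt_mul_of_pos_left ?_ (by norm_num)
    rw [← pow_two, ← pow_mul]
    exact Nat.pow_lt_pow_left (by omega) (by norm_num)
  have o1 : 1 % 2 ^ W = 1 := Nat.mod_eq_of_lt (by omega)
  have o2 : 2 % 2 ^ W = 2 := Nat.mod_eq_of_lt (by omega)
  have o4 : 4 % 2 ^ W = 4 := Nat.mod_eq_of_lt (by omega)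
  have hK1 : 1 ≤ K := by omega
  have hKK : K * K ≤ M := by
    calc K * K ≤ K * K * (K * K) := Nat.le_mul_of_pos_right _ (Nat.mul_pos hK1 hK1)
      _ ≤ 2 * (K * K * (K * K)) := by omega
      _ = M := by rw [hM]; ring
  have hM' : 2 * (K * K * (K * K)) = M := by rw [hM]; ring
  have e1 : (u + 1) % 2 ^ W = u + 1 := Nat.mod_eq_of_lt (by omega)
  have e2 : (T * (u + 1)) % 2 ^ W = X := by
    rw [mul_comm, ← hX]
    exact Nat.mod_eq_of_lt (by omega)
  have e3 : (2 * X) % 2 ^ W = K := by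
    rw [← hK]
    exact Nat.mod_eq_of_lt (by omega)
  have e4 : (K * K) % 2 ^ W = K * K := Nat.mod_eq_of_lt (by omega)
  have e5 : (K * K * (K * K)) % 2 ^ W = K * K * (K * K) := Nat.mod_eq_of_lt (by omega)
  have e6 : (2 * (K * K * (K * K))) % 2 ^ W = M := by
    rw [hM']
    exact Nat.mod_eq_of_lt (by omega)
  have e7 : (4 * T) % 2 ^ W = 4 * T := Nat.mod_eq_of_lt (hbig _ 1 (by rw [pow_one]; omega) (by omega))
  obtain ⟨D, hD⟩ : ∃ D, 200 * (4 * T) + 60 * L + 200 = D := ⟨_, rfl⟩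
  have hwork := colorMain_work (st n) hF1 hun hn2
  have hdepth := colorMain_depth hX1 hM hK hFX hLX (D := D) (T := T) (u := u) hTX huX hD
  refine Tr.mono (t₁ := _) (d₁ := _) (R₁ := Set.univ) (X₁ := Set.univ) ?_ hwork hdepth subset_rfl
    subset_rfl (fun s' h _ => h)
  refine Tr.bind (R₁ := ∅) (X₁ := ∅) (Q₁ := fun s' => s'.mem = s.mem ∧ s'.reg 3 = 0)
    (Tr.simple rfl (by decide) (by decide) ?_ ?_ ?_) le_rfl le_rfl
    (Set.empty_subset _) (Set.empty_subset _) (fun s₁ q1 f1 => ?_)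
  · simp [Cmd.rd]
  · simp [Cmd.wr]
  · simp [Cmd.run]
  refine Tr.bind (R₁ := ∅) (X₁ := ∅) (Q₁ := fun s' => s'.mem = s.mem ∧ s'.reg 15 = n)
    (Tr.simple rfl (by decide) (by decide) ?_ ?_ ?_) le_rfl le_rfl
    (Set.empty_subset _) (Set.empty_subset _) (fun s₂ q2 f2 => ?_)
  · simp [Cmd.rd]
  · simp [Cmd.wr]
  · simp [Cmd.run, q1.1, f1.2 0 (by decide), h0]
  have hlog := logLoop_tr (W := W) (by omega) n 0 s₂ q2.2
    (by rw [f2.2 3 (by decide), q1.2]) (by omega)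
  rw [zero_add, ← hu] at hlog
  refine Tr.bind hlog le_rfl le_rfl
    (Set.empty_subset _) (Set.empty_subset _) (fun s₃ q3 f3 => ?_)
  have hm3 : s₃.mem = s.mem := by
    rw [← q2.1]
    exact funext fun x => f3.1 x (Set.notMem_empty _)
  have r01 : s₃.reg 1 = T := by
    rw [f3.2 1 (by decide), f2.2 1 (by decide), f1.2 1 (by decide), h1]
  have r00 : s₃.reg 0 = n := by
    rw [f3.2 0 (by decide), f2.2 0 (by decide), f1.2 0 (by decide), h0]
  refine Tr.bind (R₁ := ∅) (X₁ := ∅)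
    (Q₁ := fun s' => s'.mem = s.mem ∧ s'.reg 2 = K ∧ s'.reg 15 = M)
    (Tr.simple rfl (by decide) (by decide) ?_ ?_ ?_) le_rfl le_rfl
    (Set.empty_subset _) (Set.empty_subset _) (fun s₄ q4 f4 => ?_)
  · simp [setParams, Cmd.rd]
  · simp [setParams, Cmd.wr]
  · simp [setParams, Cmd.run, r01, q3, o1, o2, e1, e2, e3, e4, e5, e6, hm3]
  refine Tr.bind (init_tr (a := 5) (s := s₄) (n := n) ?_) le_rfl le_rfl (Set.empty_subset _)
    (Set.subset_univ _) (fun s₅ q5 f5 => ?_)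
  · rw [f4.2 0 (by decide), r00]
  have hs₅ : Stored n st nb wt s₅.mem := hs.congr fun x hx => by
    rw [f5.1 x fun h => ?_, q4.1]
    have h' : x.1 = 5 := h
    omega
  have hred := reduce_tr (s := s₅) (K := K) (u := u) (M := M) hA hs₅ (by omega) hloop hwt
    (by omega) hnn hK1 hu hM (by rw [f5.2 0 (by decide), f4.2 0 (by decide), r00])
    (by rw [f5.2 2 (by decide), q4.2.1]) (by rw [f5.2 3 (by decide), f4.2 3 (by decide), q3])
    (by rw [f5.2 15 (by decide), q4.2.2]) q5
  rw [← hF, ← hL] at hred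
  refine Tr.bind hred le_rfl le_rfl subset_rfl (Set.subset_univ _) (fun s₆ q6 f6 => ?_)
  obtain ⟨N, cls, r5, hN, hNn, hNM, hcls, hlt, hmono⟩ := q6
  have hs₆ : Stored n st nb wt s₆.mem := hs₅.congr fun x hx => f6.1 x fun h => by
    have := h.1
    omega
  refine Tr.bind (R₁ := ∅) (X₁ := ∅)
    (Q₁ := fun s' => s'.mem = s₆.mem ∧ s'.reg 2 = 4 * T)
    (Tr.simple rfl (by decide) (by decide) ?_ ?_ ?_) le_rfl le_rfl
    (Set.empty_subset _) (Set.empty_subset _) (fun s₇ q7 f7 => ?_)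
  · simp [Cmd.rd]
  · simp [Cmd.wr]
  · simp [Cmd.run, f6.2 1 (by decide), f5.2 1 (by decide), f4.2 1 (by decide), r01, o4, e7]
  have hNM' : N * (N * (D + 10) + 100) ≤ M * (M * (D + 10) + 100) := by gcongr
  refine (greedy_tr (s := s₇) (N := N) (K := 4 * T) (D := D) (cls := cls) hA (q7.1 ▸ hs₆) hwt hn4
    (by omega) (by rw [← hL, hD]) ?_ q7.2 ?_ hN hNn (q7.1 ▸ hcls) hlt).mono le_rfl (by omega)
    subset_rfl subset_rfl ?_
  · rw [f7.2 0 (by decide), f6.2 0 (by decide), f5.2 0 (by decide), f4.2 0 (by decide), r00]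
  · rw [f7.2 5 (by decide), r5]
  · intro s' h _
    refine ⟨cls, ?_, h⟩
    -- Replacing the factor `u` on the right by `u + 1` lets it cancel against the one in `K`.
    have h1 : (u + 1) * (2 * T * dmono n st nb wt cls) ≤ (u + 1) * dtotal n st wt := by
      calc (u + 1) * (2 * T * dmono n st nb wt cls) = K * dmono n st nb wt cls := by
            rw [hK, hX]; ring
        _ ≤ u * dtotal n st wt := hmono
        _ ≤ (u + 1) * dtotal n st wt := Nat.mul_le_mul_right _ (by omega)
    exact Nat.le_of_mul_le_mul_left h1 (by omega)

/-- The case `n ≤ T` is separated not only because distinct colors are then allowed: `T` can be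
almost as large as a word, so products such as `4 * T` are safe only when `T < n`. -/
lemma defectiveColoring_tr {W n a b T : ℕ} {st nb wt : ℕ → ℕ} {s : State}
    (hA : AdjData n st nb wt) (hs : Stored n st nb wt s.mem)
    (hloop : ∀ v < n, ∀ p < st (v + 1) - st v, nb (st v + p) ≠ v)
    (hwt : ∀ p < st n, wt p < 2 ^ W) (hst : st n ≤ n * n) (hW : (n + 1) ^ 13 ≤ 2 ^ W)
    (hn : 0 < n) (h0 : s.mem (0, 0) = n) (ha : s.mem (0, 1) = a) (hb : s.mem (0, 2) = b)
    (hb0 : 0 < b) (hbW : b < 2 ^ W) (hT : T = (b - 1) / a + 1) :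
    Tr W defectiveColoring s ((Nat.log 2 (Nat.log 2 n) + 1) * (2000 * st n + 2050 * n))
      (2000050 * ((Nat.log 2 n + 1) * T) ^ 9) Set.univ Set.univ
      (fun s' => (n ≤ T ∧ ∀ v < n, s'.mem (4, v) = v) ∨
        ∃ cls : ℕ → ℕ, 2 * T * dmono n st nb wt cls ≤ dtotal n st wt ∧
          ∀ v < n, GoodColor st nb wt cls (4 * T) v (fun u => s'.mem (4, u))) := by
  have h4W : 4 < 2 ^ W := by
    calc 4 < 2 ^ 13 := by norm_num
      _ ≤ (n + 1) ^ 13 := Nat.pow_le_pow_left (by omega) _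
      _ ≤ 2 ^ W := hW
  have o1 : 1 % 2 ^ W = 1 := Nat.mod_eq_of_lt (by omega)
  have o2 : 2 % 2 ^ W = 2 := Nat.mod_eq_of_lt (by omega)
  -- Rounding up as `(b - 1) / a + 1` keeps all intermediate values at most `b`, whereas `a + b - 1`
  -- could overflow.
  have hTb : T ≤ b := by
    have : (b - 1) / a ≤ b - 1 := Nat.div_le_self _ _
    rw [hT]
    omega
  have e1 : ((b - 1) / a + 1) % 2 ^ W = T := by
    rw [← hT]
    exact Nat.mod_eq_of_lt (hTb.trans_lt hbW)
  have hT0 : 0 < T := by rw [hT]; exact Nat.succ_pos _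
  have hX1 : 1 ≤ ((Nat.log 2 n + 1) * T) ^ 9 :=
    Nat.one_le_pow _ _ (Nat.mul_pos (Nat.succ_pos _) hT0)
  have hwork : 20 + (4 + (Nat.log 2 (Nat.log 2 n) + 1) * (2000 * st n + 2000 * n)) ≤
      (Nat.log 2 (Nat.log 2 n) + 1) * (2000 * st n + 2050 * n) := by
    have h1 : (Nat.log 2 (Nat.log 2 n) + 1) * (2000 * st n + 2050 * n) =
        (Nat.log 2 (Nat.log 2 n) + 1) * (2000 * st n + 2000 * n) +
          (Nat.log 2 (Nat.log 2 n) + 1) * (50 * n) := by ring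
    have h2 : 50 * n ≤ (Nat.log 2 (Nat.log 2 n) + 1) * (50 * n) :=
      Nat.le_mul_of_pos_left _ (Nat.succ_pos _)
    omega
  refine Tr.bind (t₁ := 20) (d₁ := 20) (R₁ := Set.univ) (X₁ := ∅)
    (t₂ := 4 + (Nat.log 2 (Nat.log 2 n) + 1) * (2000 * st n + 2000 * n))
    (d₂ := 4 + 2000000 * ((Nat.log 2 n + 1) * T) ^ 9)
    (Q₁ := fun s' => s'.mem = s.mem ∧ s'.reg 0 = n ∧ s'.reg 1 = T)
    (Tr.simple rfl (by decide) (by decide) (Set.subset_univ _) ?_ ?_) hwork (by omega)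
    subset_rfl (Set.empty_subset _) (fun s₁ q1 f1 => ?_)
  · simp [loadInput, Cmd.wr]
  · simp [loadInput, Cmd.run, o1, o2, h0, ha, hb, e1]
  obtain ⟨m1, r0, r1⟩ := q1
  by_cases hTn : T < n
  · refine Tr.ite_pos ?_ ((colorMain_tr hA (m1 ▸ hs) hloop hwt hst hW hT0 hTn r0 r1).weaken
      fun s' h _ => Or.inr h) (by simp) (by simp) (by simp)
    simp [r0, r1, hTn, o1]
  · refine Tr.ite_neg (t₁ := 4 * n + 2) (d₁ := 5) ?_ ((init_tr (a := 4) r0).mono le_rfl le_rfl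
      (Set.subset_univ _) (Set.subset_univ _) fun s' h _ => Or.inl ⟨not_lt.1 hTn, h⟩) ?_ ?_ ?_
    · simp [r0, r1, hTn]
    · have : 2000 * n ≤ (Nat.log 2 (Nat.log 2 n) + 1) * (2000 * st n + 2000 * n) :=
        le_trans (by omega) (Nat.le_mul_of_pos_left _ (Nat.succ_pos _))
      simp
      omega
    · simp
      omega
    · simp

/-! ## Graphs in memory -/

section Input

variable {n : ℕ} (adj : Fin n → List (Fin n))

lemma adjStart_zero : adjStart adj 0 = 0 := by simp [adjStart]

lemma adjStart_succ (v : Fin n) : adjStart adj (v + 1) = adjStart adj v + (adj v).length := by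
  have h : (Finset.univ.filter fun u : Fin n => u.val < v.val + 1) =
      insert v (Finset.univ.filter fun u : Fin n => u.val < v.val) := by
    ext u
    simp only [Finset.mem_filter, Finset.mem_univ, true_and, Finset.mem_insert, Fin.ext_iff]
    omega
  rw [adjStart, adjStart, h, Finset.sum_insert (by simp), add_comm]

lemma adjStart_self : adjStart adj n = ∑ v, (adj v).length := by simp [adjStart]

lemma exists_entry {p : ℕ} : ∀ {m : ℕ}, m ≤ n → p < adjStart adj m →
    ∃ (v : Fin n) (j : ℕ), j < (adj v).length ∧ p = adjStart adj v + j
  | 0, _, hp => by simp [adjStart_zero] at hp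
  | m + 1, hm, hp => by
    by_cases h : p < adjStart adj m
    · exact exists_entry (by omega) h
    · have := adjStart_succ adj ⟨m, hm⟩
      dsimp only at this
      exact ⟨⟨m, hm⟩, p - adjStart adj m, by omega, by dsimp only; omega⟩

end Input

/-! ### Sums over ordered pairs of adjacent vertices, and the combination of the two losses. -/

open Classical in
/-- Every edge is counted once in each direction. -/
lemma sum_sum_adj {n : ℕ} (G : SimpleGraph (Fin n)) (f : Sym2 (Fin n) → ℕ) :
    ∑ v, ∑ u, (if G.Adj v u then f s(v, u) else 0) = 2 * ∑ e ∈ G.edgeFinset, f e := by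
  rw [← Fintype.sum_prod_type' (f := fun v u => if G.Adj v u then f s(v, u) else 0),
    ← Finset.sum_filter, ← Finset.sum_fiberwise_of_maps_to (g := fun x => s(x.1, x.2))
      (t := G.edgeFinset) (by simp), Finset.mul_sum]
  refine Finset.sum_congr rfl fun e he => ?_
  induction e with
  | _ a b =>
  have hab : G.Adj a b := by simpa using he
  have h : ((Finset.univ.filter fun x : Fin n × Fin n => G.Adj x.1 x.2).filter
      fun x => s(x.1, x.2) = s(a, b)) = {(a, b), (b, a)} := by
    ext ⟨x, y⟩
    simp only [Finset.mem_filter, Finset.mem_univ, true_and, Sym2.eq_iff, Finset.mem_insert,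
      Finset.mem_singleton, Prod.mk.injEq]
    constructor
    · exact And.right
    · rintro (⟨rfl, rfl⟩ | ⟨rfl, rfl⟩)
      · simp [hab]
      · simp [hab.symm]
  rw [h, Finset.sum_pair (by simp [hab.ne]), Sym2.eq_swap (a := b), two_mul]

open Classical in
lemma sum_sum_mono {n : ℕ} (G : SimpleGraph (Fin n)) (w : Sym2 (Fin n) → ℕ) (col : Fin n → ℕ) :
    ∑ v, ∑ u, (if G.Adj v u ∧ col u = col v then w s(v, u) else 0) = 2 * monoWeight G w col := by
  rw [monoWeight, Finset.sum_filter, ← sum_sum_adj]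
  refine Finset.sum_congr rfl fun v _ => Finset.sum_congr rfl fun u _ => ?_
  rw [ite_and]
  simp [Sym2.map_mk, eq_comm]

open Classical in
lemma sum_sum_total {n : ℕ} (G : SimpleGraph (Fin n)) (w : Sym2 (Fin n) → ℕ) :
    ∑ v, ∑ u, (if G.Adj v u then w s(v, u) else 0) = 2 * totalWeight G w := sum_sum_adj G w

open Classical in
/-- If monochromatic edges are rare inside the classes, and rare towards lower classes for every
vertex, then they are rare. -/
lemma mul_monoWeight_le {n T : ℕ} (G : SimpleGraph (Fin n)) (w : Sym2 (Fin n) → ℕ)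
    (cls col : Fin n → ℕ)
    (h1 : 2 * T * ∑ v, ∑ u, (if G.Adj v u ∧ cls u = cls v then w s(v, u) else 0) ≤
      ∑ v, ∑ u, if G.Adj v u then w s(v, u) else 0)
    (h2 : ∀ v, 4 * T * ∑ u, (if G.Adj v u ∧ cls u < cls v ∧ col u = col v then w s(v, u) else 0) ≤
      ∑ u, if G.Adj v u then w s(v, u) else 0) :
    T * monoWeight G w col ≤ totalWeight G w := by
  obtain ⟨A, hA⟩ : ∃ A, A = ∑ v, ∑ u, (if G.Adj v u ∧ cls u = cls v then w s(v, u) else 0) :=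
    ⟨_, rfl⟩
  obtain ⟨B, hB⟩ : ∃ B, B = ∑ v, ∑ u,
      (if G.Adj v u ∧ cls u < cls v ∧ col u = col v then w s(v, u) else 0) := ⟨_, rfl⟩
  have h3 : 4 * T * B ≤ 2 * totalWeight G w := by
    rw [hB, Finset.mul_sum, ← sum_sum_total]
    exact Finset.sum_le_sum fun v _ => h2 v
  -- Exchanging the endpoints: `B` also counts the edges between different classes from their lower
  -- ends.
  have hB' : B = ∑ v, ∑ u,
      (if G.Adj v u ∧ cls v < cls u ∧ col u = col v then w s(v, u) else 0) := by
    rw [hB, Finset.sum_comm]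
    refine Finset.sum_congr rfl fun v _ => Finset.sum_congr rfl fun u _ => ?_
    simp only [G.adj_comm u v, Sym2.eq_swap (a := u), eq_comm (a := col v)]
  -- An ordered monochromatic pair has equal classes, or its second vertex is lower or higher. For
  -- pairs with equal classes the colors are ignored, and all of their weight is counted in `A`.
  have h4 : 2 * monoWeight G w col ≤ A + (B + B) := by
    rw [← sum_sum_mono]
    nth_rw 2 [hB']
    rw [hA, hB]
    simp only [← Finset.sum_add_distrib]
    refine Finset.sum_le_sum fun v _ => Finset.sum_le_sum fun u _ => ?_
    by_cases h : G.Adj v u ∧ col u = col v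
    · rcases lt_trichotomy (cls u) (cls v) with hc | hc | hc
      · simp [h, hc, hc.ne, hc.not_gt]
      · simp [h, hc]
      · simp [h, hc, hc.ne', hc.not_gt]
    · simp [h]
  rw [sum_sum_total, ← hA] at h1
  have h5 : 4 * (T * monoWeight G w col) ≤ 2 * T * A + 4 * T * B := by
    calc 4 * (T * monoWeight G w col) = 2 * T * (2 * monoWeight G w col) := by ring
      _ ≤ 2 * T * (A + (B + B)) := Nat.mul_le_mul_left _ h4
      _ = 2 * T * A + 4 * T * B := by ring
  omega

lemma monoWeight_eq_zero {n : ℕ} (G : SimpleGraph (Fin n)) (w : Sym2 (Fin n) → ℕ)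
    {col : Fin n → ℕ} (h : Function.Injective col) : monoWeight G w col = 0 := by
  classical
  rw [monoWeight, Finset.sum_filter]
  refine Finset.sum_eq_zero fun e he => if_neg ?_
  induction e with
  | _ a b =>
  have hab : G.Adj a b := by simpa using he
  simpa [Sym2.map_mk] using fun hc => hab.ne (h hc)

end WorkDepth

/-! ### From the memory format to sums over the graph. -/

section Memory

variable {W n : ℕ} {G : SimpleGraph (Fin n)} {w : Sym2 (Fin n) → ℕ} {ε : ℝ}
  {adj : Fin n → List (Fin n)} {s : State}

lemma IsInput.adjData (h : IsInput W G w ε adj s) :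
    AdjData n (adjStart adj) (fun p => s.mem (2, p)) (fun p => s.mem (3, p)) where
  zero := adjStart_zero adj
  step v hv := by
    have := adjStart_succ adj ⟨v, hv⟩
    dsimp only at this
    omega
  nb_lt p hp := by
    obtain ⟨v, j, hj, rfl⟩ := exists_entry adj le_rfl hp
    rw [h.neighbor v j hj]
    exact Fin.is_lt _

lemma IsInput.stored (h : IsInput W G w ε adj s) :
    Stored n (adjStart adj) (fun p => s.mem (2, p)) (fun p => s.mem (3, p)) s.mem where
  start := h.start
  neighbor _ _ := rfl
  weight _ _ := rfl

lemma IsInput.loopless (h : IsInput W G w ε adj s) (v : ℕ) (hv : v < n) (p : ℕ)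
    (hp : p < adjStart adj (v + 1) - adjStart adj v) : s.mem (2, adjStart adj v + p) ≠ v := by
  have h1 := adjStart_succ adj ⟨v, hv⟩
  dsimp only at h1
  have hj : p < (adj ⟨v, hv⟩).length := by omega
  have h2 := h.neighbor ⟨v, hv⟩ p hj
  dsimp only at h2
  rw [h2]
  intro h3
  have h4 : (adj ⟨v, hv⟩)[p] = ⟨v, hv⟩ := Fin.ext h3
  have h5 := (h.adj_iff _ _).1 (List.getElem_mem hj)
  rw [h4] at h5
  exact G.irrefl h5

open Classical in
lemma IsInput.toFinset_adj (h : IsInput W G w ε adj s) (v : Fin n) :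
    (adj v).toFinset = Finset.univ.filter fun u => G.Adj v u := by
  ext u
  simp [h.adj_iff]

-- Since an adjacency list has no repetitions and contains exactly the neighbors, summing over its
-- positions is summing over the neighbors. The other translations are special cases or sums of this
-- one.
open Classical in
lemma IsInput.adjSum_eq (h : IsInput W G w ε adj s) (v : Fin n) (P : ℕ → Prop) [DecidablePred P] :
    adjSum (adjStart adj) (fun p => s.mem (2, p)) (fun p => s.mem (3, p)) v P =
      ∑ u : Fin n, if G.Adj v u ∧ P u then w s(v, u) else 0 := by
  have h1 : ∀ j : Fin (adj v).length,
      (if P (s.mem (2, adjStart adj v + j)) then s.mem (3, adjStart adj v + j) else 0) =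
        if P (adj v)[(j : ℕ)] then w s(v, (adj v)[(j : ℕ)]) else 0 := fun j => by
    rw [h.neighbor v j j.2, h.weight v j j.2]
  rw [adjSum, adjStart_succ, Nat.add_sub_cancel_left, Finset.sum_range,
    Finset.sum_congr rfl fun j _ => h1 j,
    Fin.sum_univ_fun_getElem (adj v) (fun u : Fin n => if P u then w s(v, u) else 0),
    ← List.sum_toFinset _ (h.nodup v), h.toFinset_adj, Finset.sum_filter]
  exact Finset.sum_congr rfl fun u _ => (ite_and _ _ _ _).symm

open Classical in
lemma IsInput.wdeg_eq (h : IsInput W G w ε adj s) (v : Fin n) :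
    wdeg (adjStart adj) (fun p => s.mem (3, p)) v =
      ∑ u : Fin n, if G.Adj v u then w s(v, u) else 0 := by
  simpa [adjSum, wdeg] using h.adjSum_eq v fun _ => True

open Classical in
lemma IsInput.dtotal_eq (h : IsInput W G w ε adj s) :
    dtotal n (adjStart adj) (fun p => s.mem (3, p)) =
      ∑ v : Fin n, ∑ u : Fin n, if G.Adj v u then w s(v, u) else 0 := by
  rw [dtotal, Finset.sum_range]
  exact Finset.sum_congr rfl fun v _ => h.wdeg_eq v

open Classical in
lemma IsInput.dmono_eq (h : IsInput W G w ε adj s) (cls : ℕ → ℕ) :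
    dmono n (adjStart adj) (fun p => s.mem (2, p)) (fun p => s.mem (3, p)) cls =
      ∑ v : Fin n, ∑ u : Fin n, if G.Adj v u ∧ cls u = cls v then w s(v, u) else 0 := by
  rw [dmono, Finset.sum_range]
  exact Finset.sum_congr rfl fun v _ => h.adjSum_eq v _

lemma IsInput.adjStart_eq (h : IsInput W G w ε adj s) :
    adjStart adj n = 2 * G.edgeSet.ncard := by
  classical
  rw [adjStart_self, Set.ncard_eq_toFinset_card', Finset.card_eq_sum_ones,
    ← SimpleGraph.edgeFinset, ← sum_sum_adj]
  refine Finset.sum_congr rfl fun v _ => ?_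
  rw [← List.toFinset_card_of_nodup (h.nodup v), h.toFinset_adj, Finset.card_filter]

lemma IsInput.adjStart_le (h : IsInput W G w ε adj s) : adjStart adj n ≤ n * n := by
  rw [adjStart_self]
  calc ∑ v, (adj v).length ≤ ∑ _v : Fin n, n :=
        Finset.sum_le_sum fun v _ => by simpa using (h.nodup v).length_le_card
    _ = n * n := by simp

end Memory

namespace WorkDepth

/-- The number `⌈1 / ε⌉` of colors, for `ε = a / b`. -/
lemma colors_bounds {a b T : ℕ} {ε : ℝ} (hε : 0 < ε) (h : ε = (a : ℝ) / b) (hb : 0 < b)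
    (hT : T = (b - 1) / a + 1) : T ≤ ⌈1 / ε⌉₊ ∧ 1 ≤ ε * T := by
  have hb' : (0 : ℝ) < b := by exact_mod_cast hb
  have ha : 0 < a := by
    rcases Nat.eq_zero_or_pos a with rfl | ha
    · simp [h] at hε
    · exact ha
  have ha' : (0 : ℝ) < a := by exact_mod_cast ha
  constructor
  -- Successor below a ceiling turns into a strict inequality, and ⌊(b - 1)/a⌋ < b/a holds because
  -- ⌊(b - 1)/a⌋·a ≤ b - 1.
  · rw [hT, Nat.succ_le_iff, Nat.lt_ceil, h, one_div_div, lt_div_iff₀ ha']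
    have : (b - 1) / a * a < b := by
      have := Nat.div_mul_le_self (b - 1) a
      omega
    exact_mod_cast this
  · rw [h, div_mul_eq_mul_div, one_le_div hb']
    have : b ≤ a * T := by
      have := Nat.lt_mul_div_succ (b - 1) ha
      rw [hT]
      omega
    exact_mod_cast this

end WorkDepth

theorem mainTheorem7 :
    ∃ (P : Cmd) (C : ℕ),
      ∀ (W n : ℕ) (G : SimpleGraph (Fin n)) (w : Sym2 (Fin n) → ℕ) (ε : ℝ)
        (adj : Fin n → List (Fin n)) (s : State),
        1 ≤ n → 0 < ε → (n + 1) ^ C ≤ 2 ^ W → IsInput W G w ε adj s →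
        Halts W P s ∧
        ∀ o : Outcome, Exec W P s o →
          (∀ v : Fin n, outputColor o.state v < C * ⌈1 / ε⌉₊) ∧
          (monoWeight G w (outputColor o.state) : ℝ) ≤ ε * (totalWeight G w : ℝ) ∧
          o.work ≤ C * ((G.edgeSet.ncard + n) * (Nat.log 2 (Nat.log 2 n) + 1)) ∧
          o.depth ≤ C * ((Nat.log 2 n + 1) * ⌈1 / ε⌉₊) ^ C := by
  classical
  -- The constant has to cover the depth factor 2000050, the work factor 4000, the 4 in the number
  -- of colors, and the exponents 9 and 13. Only a lower bound on it is kept, so that powers with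
  -- exponent `C` stay symbolic.
  obtain ⟨C, hC⟩ : ∃ C, 3000000 ≤ C := ⟨_, le_rfl⟩
  refine ⟨defectiveColoring, C, fun W n G w ε adj s hn hε hW h => ?_⟩
  obtain ⟨T, hT⟩ : ∃ T, T = (s.mem (0, 2) - 1) / s.mem (0, 1) + 1 := ⟨_, rfl⟩
  obtain ⟨hT1, hT2⟩ := colors_bounds hε h.eps h.den_pos hT
  have hT0 : 0 < T := hT ▸ Nat.succ_pos _
  obtain ⟨hh, ho⟩ := defectiveColoring_tr h.adjData h.stored h.loopless
    (fun p _ => h.mem_word _) h.adjStart_le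
    ((Nat.pow_le_pow_right (Nat.succ_pos n) (by omega)).trans hW) hn h.size rfl rfl h.den_pos
    (h.mem_word _) hT
  refine ⟨hh, fun o hex => ?_⟩
  obtain ⟨hwork, hdepth, -, -, hQ⟩ := ho o hex
  refine ⟨fun v => ?_, ?_, ?_, ?_⟩
  · have h4 : 4 * T ≤ C * ⌈1 / ε⌉₊ := Nat.mul_le_mul (by omega) hT1
    rcases hQ with ⟨h1, h2⟩ | ⟨cls, -, h2⟩
    · rw [outputColor, h2 v v.2]
      have := v.2
      omega
    · exact (h2 v v.2).1.trans_le h4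
  · have key : T * monoWeight G w (outputColor o.state) ≤ totalWeight G w := by
      rcases hQ with ⟨-, h2⟩ | ⟨cls, h1, h2⟩
      · rw [monoWeight_eq_zero, mul_zero]
        · exact Nat.zero_le _
        · intro v u hvu
          rw [outputColor, outputColor, h2 v v.2, h2 u u.2] at hvu
          exact Fin.ext hvu
      · refine mul_monoWeight_le G w (fun v => cls v) _ ?_ fun v => ?_
        · rwa [h.dmono_eq, h.dtotal_eq] at h1
        · have h3 := (h2 v v.2).2
          rwa [h.adjSum_eq, h.wdeg_eq] at h3
    have key' : (T : ℝ) * monoWeight G w (outputColor o.state) ≤ totalWeight G w := by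
      exact_mod_cast key
    calc (monoWeight G w (outputColor o.state) : ℝ)
        ≤ ε * T * monoWeight G w (outputColor o.state) :=
          le_mul_of_one_le_left (Nat.cast_nonneg _) hT2
      _ = ε * (T * monoWeight G w (outputColor o.state)) := mul_assoc _ _ _
      _ ≤ ε * totalWeight G w := mul_le_mul_of_nonneg_left key' hε.le
  · refine hwork.trans ?_
    rw [h.adjStart_eq]
    calc (Nat.log 2 (Nat.log 2 n) + 1) * (2000 * (2 * G.edgeSet.ncard) + 2050 * n)
        ≤ (Nat.log 2 (Nat.log 2 n) + 1) * (4000 * (G.edgeSet.ncard + n)) :=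
          Nat.mul_le_mul_left _ (by omega)
      _ = 4000 * ((G.edgeSet.ncard + n) * (Nat.log 2 (Nat.log 2 n) + 1)) := by ring
      _ ≤ C * ((G.edgeSet.ncard + n) * (Nat.log 2 (Nat.log 2 n) + 1)) :=
          Nat.mul_le_mul_right _ (by omega)
  · refine hdepth.trans (Nat.mul_le_mul (by omega) ?_)
    calc ((Nat.log 2 n + 1) * T) ^ 9 ≤ ((Nat.log 2 n + 1) * T) ^ C :=
          Nat.pow_le_pow_right (Nat.mul_pos (Nat.succ_pos _) hT0) (by omega)
      _ ≤ ((Nat.log 2 n + 1) * ⌈1 / ε⌉₊) ^ C :=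
          Nat.pow_le_pow_left (Nat.mul_le_mul_left _ hT1) _
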